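/- **Setting.** For a set $\mathcal G$ of one- and two-qubit gates (unitaries) let $\mathcal D_{\mathcal G}(n,d)$ be the set of distributions $P(x)=|\langle x|U|0^n\rangle|^2$ on $\{0,1\}^n$, where $U$ is a depth-$d$ circuit on $n$ qubits arranged on a line, i.e. a product of $d$ layers, each consisting of gates from $\mathcal G$ that act on pairwise disjoint sets of one qubit or of two neighbouring qubits (in either order); qubits may idle. Let $\mathcal D_{\mathrm{Cl}}(n,d)$ be this class for the set of all one- and two-qubit Clifford gates. Call $\mathcal G$ universal if every two-qubit unitary is, up to a global phase, a limit of two-qubit circuits over $\mathcal G$. A statistical query oracle $\mathrm{Stat}_\tau(P)$ answers each query $\phi:\{0,1\}^n\to[-1,1]$ by some $v$ with $|\mathbb E_{x\sim P}[\phi(x)]-v|\le\tau$. Given a depth function $d:\mathbb N\to\mathbb N$ and a tolerance $\tau:\mathbb N\to\mathbb R$, a query-efficient algorithm for learning $\mathcal D_{\mathcal G}(n,d(n))$ with respect to generators (evaluators) is an adaptive randomized algorithm that, for all sufficiently large $n$, all $\varepsilon,\delta\in(0,1)$ and all $P\in\mathcal D_{\mathcal G}(n,d(n))$, uses at most $\mathrm{poly}(n,1/\varepsilon,1/\delta)$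 queries to $\mathrm{Stat}_{\tau(n)}(P)$ and, whichever valid answers the oracle gives, outputs with probability at least $1-\delta$ a generator (an algorithm that samples from $Q$), respectively an evaluator (an algorithm that computes $x\mapsto Q(x)$), of some distribution $Q$ with $\mathrm{TV}(P,Q)<\varepsilon$. No bound is imposed on its computation between the queries or on the resources of the generator or evaluator that it outputs. **Theorem.** Let $\tau$ be at least inverse polynomial, $\tau(n)=\Omega(1/\mathrm{poly}(n))$. Then, neither with respect to generators nor with respect to evaluators, is there a query-efficient algorithm for learning from statistical queries of tolerance $\tau(n)$ 1. the classes $\mathcal D_{\mathrm{Cl}}(n,d(n))$, for any $d(n)=\omega(\log n)$; 2. the classes $\mathcal D_{\mathcal G}(n,d(n))$, for any universal gate set $\mathcal G$ and any $d(n)=\omega(\log^k n)$, where $k$ is a constant that depends only on $\mathcal G$. Moreover, $k$ can be as small as $2$: there is a finite universal gate set for which (2) holds with $k=2$. -/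

import Mathlib

open Filter Asymptotics Matrix
open scoped ENNReal

noncomputable section

namespace CircuitLearning

/-! ### Distributions over bit strings -/

/-- Bit strings of length `n`. -/
abbrev BitString (n : ℕ) : Type := Fin n → Bool

/-- Probability distributions on the bit strings of length `n`. -/
abbrev ProbDist (n : ℕ) : Type := stdSimplex ℝ (BitString n)

/-- Total variation distance. -/
def tv {n : ℕ} (P Q : ProbDist n) : ℝ := (1 / 2) * ∑ x, |P.1 x - Q.1 x|

/-! ### Local quantum circuits -/

/-- Operators on `n` qubits, as matrices in the computational basis. -/
abbrev Op (n : ℕ) : Type := Matrix (BitString n) (BitString n) ℂ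

/-- A gate set: a set of one-qubit gates and a set of two-qubit gates (both arbitrary). -/
structure GateSet where
  one : Set (Matrix.unitaryGroup (BitString 1) ℂ)
  two : Set (Matrix.unitaryGroup (BitString 2) ℂ)

open Classical in
/-- The `m`-qubit operator `g` acting on the qubits `e 0, …, e (m - 1)` of an `n`-qubit system and
trivially on the others (meant for injective `e`). -/
def embedOp {m n : ℕ} (e : Fin m → Fin n) (g : Op m) : Op n :=
  fun a b => if ∀ i, (∀ j, e j ≠ i) → a i = b i then g (a ∘ e) (b ∘ e) else 0

/-- A gate of the gate set `G` together with a place on a line of `n` qubits: one-qubit gates act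
on any qubit, two-qubit gates on any two neighbouring qubits, in either order. -/
inductive PlacedGate (G : GateSet) (n : ℕ) : Type
  | one (g : Matrix.unitaryGroup (BitString 1) ℂ) (hg : g ∈ G.one) (i : Fin n) : PlacedGate G n
  | two (g : Matrix.unitaryGroup (BitString 2) ℂ) (hg : g ∈ G.two) (i j : Fin n)
      (hij : i.val + 1 = j.val ∨ j.val + 1 = i.val) : PlacedGate G n

/-- The qubits on which a placed gate acts. -/
def PlacedGate.support {G : GateSet} {n : ℕ} : PlacedGate G n → Finset (Fin n)
  | .one _ _ i => {i}
  | .two _ _ i j _ => {i, j}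

/-- The `n`-qubit operator of a placed gate. -/
def PlacedGate.toOp {G : GateSet} {n : ℕ} : PlacedGate G n → Op n
  | .one g _ i => embedOp ![i] (g : Op 1)
  | .two g _ i j _ => embedOp ![i, j] (g : Op 2)

/-- `U` is a single layer: a product of gates of `G` acting on pairwise disjoint sets of qubits.
Qubits may stay idle. -/
def IsLayer (G : GateSet) (n : ℕ) (U : Op n) : Prop :=
  ∃ L : List (PlacedGate G n),
    L.Pairwise (fun a b => Disjoint a.support b.support) ∧ U = (L.map PlacedGate.toOp).prod

/-- `U` is realized by a one-dimensional nearest-neighbour circuit of depth `d` on `n` qubits with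
gates from `G`, that is, by `d` consecutive layers. -/
def IsCircuit (G : GateSet) (n : ℕ) : ℕ → Op n → Prop
  | 0, U => U = 1
  | d + 1, U => ∃ L V : Op n, IsLayer G n L ∧ IsCircuit G n d V ∧ U = L * V

/-- The class of output distributions `x ↦ |⟨x|U|0ⁿ⟩|²` of the depth-`d` nearest-neighbour circuits
`U` on `n` qubits with gates from `G`. -/
def outputDistributions (G : GateSet) (n d : ℕ) : Set (ProbDist n) :=
  {P | ∃ U : Op n, IsCircuit G n d U ∧ ∀ x, P.1 x = ‖U x (fun _ => false)‖ ^ 2}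

/-- A gate set is universal if the circuits over it on two qubits approximate every two-qubit
unitary to arbitrary accuracy, up to a global phase. -/
def GateSet.Universal (G : GateSet) : Prop :=
  ∀ U ∈ Matrix.unitaryGroup (BitString 2) ℂ, ∀ η : ℝ, 0 < η →
    ∃ (d : ℕ) (V : Op 2) (z : ℂ), IsCircuit G 2 d V ∧ ‖z‖ = 1 ∧
      ∀ a b, ‖V a b - z * U a b‖ < η

/-- The Pauli operator `X^x Z^z` on `m` qubits, where `X^x` applies `X` to the qubits in the
support of `x` and `Z^z` applies `Z` to those in the support of `z`. -/
def pauli {m : ℕ} (x z : BitString m) : Op m :=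
  fun a b => if a = (fun i => xor (b i) (x i)) then
    ∏ i, (if z i && b i then (-1 : ℂ) else 1) else 0

/-- A Clifford unitary maps Pauli operators to Pauli operators, up to a power of `i`,
under conjugation. -/
def IsClifford {m : ℕ} (U : Matrix.unitaryGroup (BitString m) ℂ) : Prop :=
  ∀ x z : BitString m, ∃ (k : ℕ) (x' z' : BitString m),
    (U : Op m) * pauli x z * (U : Op m)ᴴ = Complex.I ^ k • pauli x' z'

/-- All one- and two-qubit Clifford gates. -/
def cliffordGates : GateSet where
  one := {U | IsClifford U}
  two := {U | IsClifford U}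

/-! ### Learning from statistical queries -/

/-- Statistical queries: functions on bit strings with values in `[-1, 1]`. -/
abbrev Query (n : ℕ) : Type := BitString n → Set.Icc (-1 : ℝ) 1

/-- The map `O` answers every query `φ` by a value within `τ` of the expectation of `φ` under
`P`. -/
def IsStatOracle {n : ℕ} (τ : ℝ) (P : ProbDist n) (O : Query n → ℝ) : Prop :=
  ∀ φ : Query n, |∑ x, P.1 x * (φ x : ℝ) - O φ| ≤ τ

/-- Adaptive randomized query algorithms with outputs in `Out`. Such an algorithm stops with an
output, or poses a query and continues depending on the answer, or draws a random number from a
discrete distribution and continues depending on it. Computation between the queries is free. -/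
inductive SQAlgorithm (n : ℕ) (Out : Type) : Type
  | output (r : Out) : SQAlgorithm n Out
  | query (φ : Query n) (next : ℝ → SQAlgorithm n Out) : SQAlgorithm n Out
  | random (p : PMF ℕ) (next : ℕ → SQAlgorithm n Out) : SQAlgorithm n Out

/-- Run with the oracle `O`, the algorithm poses at most the given number of queries. -/
def SQAlgorithm.UsesAtMost {n : ℕ} {Out : Type} (O : Query n → ℝ) :
    SQAlgorithm n Out → ℕ → Prop
  | .output _, _ => True
  | .query _ _, 0 => False
  | .query φ next, q + 1 => (next (O φ)).UsesAtMost O q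
  | .random p next, q => ∀ i ∈ p.support, (next i).UsesAtMost O q

open Classical in
/-- The probability that the algorithm, run with the oracle `O`, produces an output in `S`. -/
def SQAlgorithm.prob {n : ℕ} {Out : Type} (O : Query n → ℝ) (S : Set Out) :
    SQAlgorithm n Out → ℝ≥0∞
  | .output r => if r ∈ S then 1 else 0
  | .query φ next => (next (O φ)).prob O S
  | .random p next => ∑' i, p i * (next i).prob O S

/-- A randomized procedure that produces bit strings: a function of a random seed. No bound on its
resources is imposed. -/
structure Generator (n : ℕ) where
  seed : PMF ℕ
  sample : ℕ → BitString n

/-- `g` is a generator for `P`: its samples are distributed according to `P`. -/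
def IsGeneratorFor (n : ℕ) (g : Generator n) (P : ProbDist n) : Prop :=
  ∀ x, ((g.seed.map g.sample) x).toReal = P.1 x

/-- A procedure that takes a bit string and returns a number. No bound on its resources is
imposed. -/
abbrev Evaluator (n : ℕ) : Type := BitString n → ℝ

/-- `e` is an evaluator for `P`: it returns the probability of its input. -/
def IsEvaluatorFor (n : ℕ) (e : Evaluator n) (P : ProbDist n) : Prop :=
  ∀ x, e x = P.1 x

/-- The classes `D n` are learnable query-efficiently from statistical queries of tolerance `τ n`,
with respect to the representations `Rep` with meaning `Represents`: for all large `n` and all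
accuracies `ε` and failure probabilities `δ`, some algorithm outputs, with probability at least
`1 - δ`, a representation of a distribution closer than `ε` to the unknown distribution, whichever
valid answers it gets, and it uses at most `poly(n, 1/ε, 1/δ)` queries. -/
def QueryEfficientlyLearnable (D : (n : ℕ) → Set (ProbDist n)) (τ : ℕ → ℝ) (Rep : ℕ → Type)
    (Represents : (n : ℕ) → Rep n → ProbDist n → Prop) : Prop :=
  ∃ C c n₀ : ℕ, ∀ n : ℕ, n₀ ≤ n → ∀ ε δ : ℝ, 0 < ε → ε < 1 → 0 < δ → δ < 1 →
    ∃ (A : SQAlgorithm n (Rep n)) (q : ℕ), (q : ℝ) ≤ C * (n + 1 / ε + 1 / δ) ^ c ∧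
      ∀ P ∈ D n, ∀ O : Query n → ℝ, IsStatOracle (τ n) P O →
        A.UsesAtMost O q ∧
        ENNReal.ofReal (1 - δ) ≤ A.prob O {r | ∃ Q : ProbDist n, Represents n r Q ∧ tv P Q < ε}

/-- The tolerance is at least inverse polynomial, `τ = Ω(1 / poly(n))`. -/
def InversePolynomial (τ : ℕ → ℝ) : Prop :=
  ∃ (c : ℕ) (a : ℝ), 0 < a ∧ ∀ᶠ n : ℕ in atTop, a / (n : ℝ) ^ c ≤ τ n

/-- There is no query-efficient algorithm for learning the classes `D n` from inverse polynomially
accurate statistical queries, neither with respect to generators nor with respect to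
evaluators. -/
def SQHard (D : (n : ℕ) → Set (ProbDist n)) : Prop :=
  ∀ τ : ℕ → ℝ, InversePolynomial τ →
    ¬ QueryEfficientlyLearnable D τ Generator IsGeneratorFor ∧
    ¬ QueryEfficientlyLearnable D τ Evaluator IsEvaluatorFor

end CircuitLearning

end
open CircuitLearning

noncomputable section

namespace CircuitLearning

/-! ### Embedded operators -/

section EmbedOp

variable {k m n : ℕ}

/-! Hardness rests on one notion, `HardFamily`: a finite weighted family of distributions in the
class such that every bounded test has nearly the same expectation under a typical member as under a
fixed reference `R`, while a typical member is far from `R` in total variation. An adversarial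
oracle answers with the expectation under `R` whenever this is valid. By Chebyshev's inequality each
query exposes only weight `v / τ ^ 2` of the family, and one output can be close to many members
only if these are close to `R`; this gives `HardFamily.query_bound`. Families on `m = O(log n)`
qubits have variance `2 ^ (-Θ(m))`, below any prescribed inverse power of `n`. Padding with idle
zero qubits carries them to `n` qubits at a depth that depends on `m` alone (`HardFamily.pad`), so
`sqHard_of_hardFamily` applies as soon as the allowed depth dominates the depth needed on `m`
qubits.

For Clifford gates the family consists of the uniform distributions on pairs `(x, s · x)`, prepared
by moving the parity qubit along the line in depth linear in `m`. The corresponding characters are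
orthogonal, which gives the variance bound (`hardFamily_parity`). A finite universal gate set
containing the gates used here inherits this bound. Its universality follows from the density of the
powers of `exp i` in the circle and from the generation of the unitary group by phases and plane
rotations.

For an arbitrary universal gate set the family consists of random circuits, and the variance is a
second moment. Finitely many two-qubit circuits, one of them the identity, have an averaged operator
`g ⊗ ḡ ⊗ g ⊗ ḡ` whose powers converge exponentially to the projection onto the unitary invariants
(`exists_average_pow_tendsto`); these are spanned by the identity and the swap
(`eq_add_of_invariant`). Ideal random gates therefore act as a Markov chain on labellings of the
sites by "initial", "identity" or "swap". The total swap overlap is conserved, and a potential of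
the nonconstant labellings shrinks by `9 / 10` in each sweep of the line. After linearly many sweeps
a traceless observable has second moment `O(2 ^ (-m))` (`GateSet.Universal.exists_random_circuit`).
A last gate from a finite set found by compactness keeps the outputs away from uniform on average
(`sum_tv_uniformDist_ge`). About `m ^ 2` gates are applied one after another, each realized by a
number of repetitions of order `m ^ 2`, so the depth is of order `m ^ 4` and `k = 4` works. -/

lemma extend_comp_self {e : Fin m → Fin n} (he : Function.Injective e) (a : BitString n)
    (y : BitString m) : Function.extend e y a ∘ e = y :=
  Function.extend_comp he y a

lemma extend_apply_off {e : Fin m → Fin n} (a : BitString n) (y : BitString m) {i : Fin n}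
    (hi : ∀ j, e j ≠ i) : Function.extend e y a i = a i :=
  Function.extend_apply' _ _ _ (fun ⟨j, hj⟩ => hi j hj)

lemma extend_eq_of_agree {e : Fin m → Fin n} (he : Function.Injective e) {a b : BitString n}
    (h : ∀ i, (∀ j, e j ≠ i) → a i = b i) : Function.extend e (b ∘ e) a = b := by
  funext i
  by_cases hi : ∃ j, e j = i
  · obtain ⟨j, rfl⟩ := hi
    rw [he.extend_apply]; rfl
  · rw [extend_apply_off a _ (fun j hj => hi ⟨j, hj⟩)]
    exact h i (fun j hj => hi ⟨j, hj⟩)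

lemma extend_injective {e : Fin m → Fin n} (he : Function.Injective e) (a : BitString n) :
    Function.Injective (fun y : BitString m => Function.extend e y a) := by
  intro y y' h
  have := congrArg (fun f => f ∘ e) h
  simpa [extend_comp_self he] using this

/-- Row `a` is supported on the strings that agree with `a` outside the image of `e`, and these are
parametrized by the bits placed on that image. -/
lemma sum_embedOp_mul {e : Fin m → Fin n} (he : Function.Injective e) (g : Op m)
    (a : BitString n) (f : BitString n → ℂ) :
    ∑ b, embedOp e g a b * f b = ∑ y, g (a ∘ e) y * f (Function.extend e y a) := by
  symm
  refine Fintype.sum_of_injective (fun y => Function.extend e y a) (extend_injective he a) _ _ ?_ ?_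
  · intro b hb
    have : ¬ ∀ i, (∀ j, e j ≠ i) → a i = b i := fun h =>
      hb ⟨b ∘ e, extend_eq_of_agree he h⟩
    simp [embedOp, this]
  · intro y
    have : ∀ i, (∀ j, e j ≠ i) → a i = Function.extend e y a i := fun i hi =>
      (extend_apply_off a y hi).symm
    simp only [embedOp, if_pos this, extend_comp_self he]

lemma embedOp_mulVec {e : Fin m → Fin n} (he : Function.Injective e) (g : Op m)
    (ψ : BitString n → ℂ) (a : BitString n) :
    (embedOp e g *ᵥ ψ) a = ∑ y, g (a ∘ e) y * ψ (Function.extend e y a) :=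
  sum_embedOp_mul he g a ψ

lemma embedOp_mul {e : Fin m → Fin n} (he : Function.Injective e) (g h : Op m) :
    embedOp e g * embedOp e h = embedOp e (g * h) := by
  ext a c
  rw [Matrix.mul_apply, sum_embedOp_mul he g a (fun b => embedOp e h b c)]
  simp only [embedOp, extend_comp_self he]
  by_cases hac : ∀ i, (∀ j, e j ≠ i) → a i = c i
  · have : ∀ y, ∀ i, (∀ j, e j ≠ i) → Function.extend e y a i = c i := fun y i hi => by
      rw [extend_apply_off a y hi, hac i hi]
    simp only [if_pos hac, if_pos (this _), Matrix.mul_apply]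
  · have : ∀ y, ¬ ∀ i, (∀ j, e j ≠ i) → Function.extend e y a i = c i := fun y hy => hac
      fun i hi => by rw [← hy i hi, extend_apply_off a y hi]
    simp only [if_neg hac, if_neg (this _), mul_zero, Finset.sum_const_zero]

lemma embedOp_one {e : Fin m → Fin n} : embedOp e (1 : Op m) = 1 := by
  ext a b
  simp only [embedOp, Matrix.one_apply]
  by_cases hab : a = b
  · subst hab; simp
  · rw [if_neg hab]
    split_ifs with h1 h2
    · exfalso
      apply hab
      funext i
      by_cases hi : ∃ j, e j = i
      · obtain ⟨j, rfl⟩ := hi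
        exact congrFun h2 j
      · exact h1 i (fun j hj => hi ⟨j, hj⟩)
    · rfl
    · rfl

lemma embedOp_conjTranspose (e : Fin m → Fin n) (g : Op m) :
    (embedOp e g)ᴴ = embedOp e gᴴ := by
  ext a b
  simp only [embedOp, Matrix.conjTranspose_apply]
  have : (∀ i, (∀ j, e j ≠ i) → b i = a i) ↔ (∀ i, (∀ j, e j ≠ i) → a i = b i) := by
    constructor <;> intro h i hi <;> exact (h i hi).symm
  by_cases h : ∀ i, (∀ j, e j ≠ i) → a i = b i
  · rw [if_pos h, if_pos (this.2 h)]
  · rw [if_neg h, if_neg (fun h' => h (this.1 h')), star_zero]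

lemma embedOp_embedOp {f : Fin k → Fin m} {e : Fin m → Fin n} (he : Function.Injective e)
    (g : Op k) : embedOp e (embedOp f g) = embedOp (e ∘ f) g := by
  ext a b
  have key : (∀ i, (∀ j, (e ∘ f) j ≠ i) → a i = b i) ↔
      (∀ i, (∀ j, e j ≠ i) → a i = b i) ∧ ∀ i, (∀ j, f j ≠ i) → (a ∘ e) i = (b ∘ e) i := by
    constructor
    · intro h
      refine ⟨fun i hi => h i fun j => hi _, fun i hi => h _ fun j hj => hi j (he hj)⟩
    · rintro ⟨h1, h2⟩ i hi
      by_cases h : ∃ j, e j = i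
      · obtain ⟨j, rfl⟩ := h
        exact h2 j fun l hl => hi l (congrArg e hl)
      · exact h1 i fun j hj => h ⟨j, hj⟩
  simp only [embedOp]
  by_cases h1 : ∀ i, (∀ j, e j ≠ i) → a i = b i
  · by_cases h2 : ∀ i, (∀ j, f j ≠ i) → (a ∘ e) i = (b ∘ e) i
    · rw [if_pos h1, if_pos h2, if_pos (key.2 ⟨h1, h2⟩)]; rfl
    · rw [if_pos h1, if_neg h2, if_neg fun h => h2 (key.1 h).2]
  · rw [if_neg h1, if_neg fun h => h1 (key.1 h).1]

lemma embedOp_mem_unitary {e : Fin m → Fin n} (he : Function.Injective e) {g : Op m}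
    (hg : g ∈ Matrix.unitaryGroup (BitString m) ℂ) :
    embedOp e g ∈ Matrix.unitaryGroup (BitString n) ℂ := by
  rw [Matrix.mem_unitaryGroup_iff] at hg ⊢
  rw [Matrix.star_eq_conjTranspose] at hg ⊢
  rw [embedOp_conjTranspose, embedOp_mul he, hg, embedOp_one]

lemma embedOp_list_prod {e : Fin m → Fin n} (he : Function.Injective e) (l : List (Op m)) :
    embedOp e l.prod = (l.map (embedOp e)).prod := by
  induction l with
  | nil => simp [embedOp_one]
  | cons a l ih => simp [← embedOp_mul he, ih]

end EmbedOp

/-! ### Circuits -/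

section Circuits

variable {G : GateSet} {m n : ℕ}

lemma isLayer_one (G : GateSet) (n : ℕ) : IsLayer G n 1 := ⟨[], by simp, by simp⟩

lemma isLayer_toOp (g : PlacedGate G n) : IsLayer G n g.toOp := ⟨[g], by simp, by simp⟩

lemma isCircuit_one (G : GateSet) (n d : ℕ) : IsCircuit G n d 1 := by
  induction d with
  | zero => rfl
  | succ d ih => exact ⟨1, 1, isLayer_one G n, ih, by simp⟩

lemma IsLayer.isCircuit {U : Op n} (h : IsLayer G n U) : IsCircuit G n 1 U :=
  ⟨U, 1, h, rfl, by simp⟩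

lemma IsCircuit.mul {d₁ d₂ : ℕ} {U V : Op n} (hU : IsCircuit G n d₁ U)
    (hV : IsCircuit G n d₂ V) : IsCircuit G n (d₁ + d₂) (U * V) := by
  induction d₁ generalizing U with
  | zero => rw [hU]; simpa using hV
  | succ d ih =>
    obtain ⟨L, W, hL, hW, rfl⟩ := hU
    rw [Nat.add_right_comm]
    exact ⟨L, W * V, hL, ih hW, by rw [Matrix.mul_assoc]⟩

lemma IsCircuit.mono {d₁ d₂ : ℕ} (h : d₁ ≤ d₂) {U : Op n} (hU : IsCircuit G n d₁ U) :
    IsCircuit G n d₂ U := by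
  have := hU.mul (isCircuit_one G n (d₂ - d₁))
  rwa [Matrix.mul_one, Nat.add_sub_cancel' h] at this

lemma PlacedGate.toOp_mem_unitary (g : PlacedGate G n) :
    g.toOp ∈ Matrix.unitaryGroup (BitString n) ℂ := by
  cases g with
  | one g hg i =>
    refine embedOp_mem_unitary ?_ g.2
    intro a b _
    exact Subsingleton.elim a b
  | two g hg i j hij =>
    refine embedOp_mem_unitary ?_ g.2
    have : i ≠ j := by rintro rfl; omega
    intro a b h
    fin_cases a <;> fin_cases b <;> simp_all [eq_comm]

lemma IsLayer.mem_unitary {U : Op n} (h : IsLayer G n U) :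
    U ∈ Matrix.unitaryGroup (BitString n) ℂ := by
  obtain ⟨L, -, rfl⟩ := h
  refine Submonoid.list_prod_mem _ fun V hV => ?_
  obtain ⟨g, -, rfl⟩ := List.mem_map.1 hV
  exact g.toOp_mem_unitary

lemma IsCircuit.mem_unitary {d : ℕ} {U : Op n} (h : IsCircuit G n d U) :
    U ∈ Matrix.unitaryGroup (BitString n) ℂ := by
  induction d generalizing U with
  | zero => rw [h]; exact one_mem _
  | succ d ih =>
    obtain ⟨L, W, hL, hW, rfl⟩ := h
    exact mul_mem hL.mem_unitary (ih hW)

/-- Translation by `a` on a line of qubits. -/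
def shiftFin (a : ℕ) (h : a + m ≤ n) (i : Fin m) : Fin n := ⟨a + i.val, by omega⟩

lemma shiftFin_injective (a : ℕ) (h : a + m ≤ n) : Function.Injective (shiftFin a h) := by
  intro i j hij
  simpa [shiftFin, Fin.ext_iff] using hij

/-- The translate of a placed gate. -/
def PlacedGate.shift (a : ℕ) (h : a + m ≤ n) : PlacedGate G m → PlacedGate G n
  | .one g hg i => .one g hg (shiftFin a h i)
  | .two g hg i j hij => .two g hg (shiftFin a h i) (shiftFin a h j)
      (by simp only [shiftFin]; omega)

lemma PlacedGate.toOp_shift (a : ℕ) (h : a + m ≤ n) (g : PlacedGate G m) :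
    (g.shift a h).toOp = embedOp (shiftFin a h) g.toOp := by
  cases g with
  | one g hg i =>
    simp only [PlacedGate.shift, PlacedGate.toOp]
    rw [embedOp_embedOp (shiftFin_injective a h)]
    congr 1
    funext x; fin_cases x; rfl
  | two g hg i j hij =>
    simp only [PlacedGate.shift, PlacedGate.toOp]
    rw [embedOp_embedOp (shiftFin_injective a h)]
    congr 1
    funext x; fin_cases x <;> rfl

lemma PlacedGate.support_shift (a : ℕ) (h : a + m ≤ n) (g : PlacedGate G m) :
    (g.shift a h).support = g.support.map ⟨shiftFin a h, shiftFin_injective a h⟩ := by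
  cases g <;> simp [PlacedGate.shift, PlacedGate.support]

lemma IsLayer.shift (a : ℕ) (h : a + m ≤ n) {U : Op m} (hU : IsLayer G m U) :
    IsLayer G n (embedOp (shiftFin a h) U) := by
  obtain ⟨L, hL, rfl⟩ := hU
  refine ⟨L.map (PlacedGate.shift a h), ?_, ?_⟩
  · rw [List.pairwise_map]
    refine hL.imp fun {x y} hxy => ?_
    rw [PlacedGate.support_shift, PlacedGate.support_shift]
    exact (Finset.disjoint_map _).2 hxy
  · rw [embedOp_list_prod (shiftFin_injective a h), List.map_map, List.map_map]
    congr 1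
    exact List.map_congr_left fun g _ => (g.toOp_shift a h).symm

/-- Translation keeps neighbours adjacent and supports disjoint, so a circuit on a short segment
runs inside a longer line at no cost in depth. -/
lemma IsCircuit.shift (a : ℕ) (h : a + m ≤ n) {d : ℕ} {U : Op m} (hU : IsCircuit G m d U) :
    IsCircuit G n d (embedOp (shiftFin a h) U) := by
  induction d generalizing U with
  | zero => rw [hU]; exact embedOp_one
  | succ d ih =>
    obtain ⟨L, W, hL, hW, rfl⟩ := hU
    exact ⟨_, _, hL.shift a h, ih hW, (embedOp_mul (shiftFin_injective a h) _ _).symm⟩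

lemma outputDistributions_mono {d₁ d₂ : ℕ} (h : d₁ ≤ d₂) :
    outputDistributions G n d₁ ⊆ outputDistributions G n d₂ :=
  fun _ ⟨U, hU, hP⟩ => ⟨U, hU.mono h, hP⟩

end Circuits

/-! ### Padding with zeros -/

section Pad

variable {G : GateSet} {m n : ℕ}

/-- Append zeros to a bit string. -/
def padBits (h : m ≤ n) (y : BitString m) : BitString n :=
  Function.extend (shiftFin 0 (by omega : 0 + m ≤ n)) y (fun _ => false)

lemma padBits_injective (h : m ≤ n) : Function.Injective (padBits h) :=
  extend_injective (shiftFin_injective 0 _) _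

lemma sum_extend_zero {R : Type*} [AddCommMonoid R] {α β : Type*} [Fintype α] [Fintype β]
    {f : α → β} (hf : Function.Injective f) (F : β → R) (g : α → R)
    (h0 : ∀ b, b ∉ Set.range f → F b = 0) (h1 : ∀ a, F (f a) = g a) :
    ∑ b, F b = ∑ a, g a :=
  (Fintype.sum_of_injective f hf g F h0 fun a => (h1 a).symm).symm

open Classical in
/-- Append zeros to the samples of a distribution. -/
def padDist (h : m ≤ n) (P : ProbDist m) : ProbDist n :=
  ⟨Function.extend (padBits h) P.1 0, by
    refine ⟨fun x => ?_, ?_⟩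
    · by_cases hx : ∃ y, padBits h y = x
      · obtain ⟨y, rfl⟩ := hx
        rw [(padBits_injective h).extend_apply]; exact P.2.1 y
      · rw [Function.extend_apply' _ _ _ hx]; rfl
    · rw [sum_extend_zero (padBits_injective h) _ P.1 (fun b hb => ?_) (fun a => ?_)]
      · exact P.2.2
      · rw [Function.extend_apply' _ _ _ (fun ⟨y, hy⟩ => hb ⟨y, hy⟩)]; rfl
      · rw [(padBits_injective h).extend_apply]⟩

lemma padDist_padBits (h : m ≤ n) (P : ProbDist m) (y : BitString m) :
    (padDist h P).1 (padBits h y) = P.1 y :=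
  (padBits_injective h).extend_apply _ _ _

lemma padDist_of_notMem (h : m ≤ n) (P : ProbDist m) {x : BitString n}
    (hx : x ∉ Set.range (padBits h)) : (padDist h P).1 x = 0 :=
  Function.extend_apply' _ _ _ hx

lemma sum_padDist_mul (h : m ≤ n) (P : ProbDist m) (φ : BitString n → ℝ) :
    ∑ x, (padDist h P).1 x * φ x = ∑ y, P.1 y * φ (padBits h y) :=
  sum_extend_zero (padBits_injective h) _ _
    (fun b hb => by rw [padDist_of_notMem h P hb, zero_mul])
    (fun a => by rw [padDist_padBits])

lemma tv_padDist (h : m ≤ n) (P Q : ProbDist m) : tv (padDist h P) (padDist h Q) = tv P Q := by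
  unfold tv
  rw [sum_extend_zero (padBits_injective h) _ (fun y => |P.1 y - Q.1 y|)]
  · intro b hb
    rw [padDist_of_notMem h P hb, padDist_of_notMem h Q hb]; simp
  · intro a
    rw [padDist_padBits, padDist_padBits]

/-- The circuit runs on the first `m` qubits, and the others idle in the zero state. -/
lemma padDist_mem {d : ℕ} (h : m ≤ n) {P : ProbDist m} (hP : P ∈ outputDistributions G m d) :
    padDist h P ∈ outputDistributions G n d := by
  obtain ⟨U, hU, hPU⟩ := hP
  have h0 : 0 + m ≤ n := by omega
  refine ⟨embedOp (shiftFin 0 h0) U, hU.shift 0 h0, fun x => ?_⟩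
  by_cases hx : ∃ y, padBits h y = x
  · obtain ⟨y, rfl⟩ := hx
    rw [padDist_padBits, hPU]
    simp only [embedOp]
    rw [if_pos]
    · congr 3
      exact (extend_comp_self (shiftFin_injective 0 h0) (fun _ => false) y).symm
    · intro i hi
      exact extend_apply_off (fun _ => false) y hi
  · rw [padDist_of_notMem h P hx]
    simp only [embedOp]
    rw [if_neg]
    · simp
    · intro hi
      exact hx ⟨x ∘ shiftFin 0 h0,
        extend_eq_of_agree (shiftFin_injective 0 h0) fun i hi' => (hi i hi').symm⟩

end Pad

/-! ### A lower bound for statistical query algorithms -/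

section SQ

variable {n : ℕ} {Out : Type}

lemma SQAlgorithm.prob_le_one (O : Query n → ℝ) (S : Set Out) (A : SQAlgorithm n Out) :
    A.prob O S ≤ 1 := by
  induction A with
  | output r => simp only [SQAlgorithm.prob]; split_ifs <;> simp
  | query φ next ih => exact ih _
  | random p next ih =>
    simp only [SQAlgorithm.prob]
    calc ∑' i, p i * (next i).prob O S ≤ ∑' i, p i * 1 :=
          ENNReal.tsum_le_tsum fun i => mul_le_mul_right (ih i) _
      _ = 1 := by simp [p.tsum_coe]

open Classical in
/-- If the oracles `O ω` rarely deviate from one fixed oracle `V`, and no single output is good for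
many `ω`, then the average success probability is small. -/
lemma SQAlgorithm.sum_prob_le {Ω : Type*} [Fintype Ω] (O : Ω → Query n → ℝ) (V : Query n → ℝ)
    (S : Ω → Set Out) (w : Ω → ℝ≥0∞) (κ β : ℝ≥0∞)
    (hκ : ∀ φ, ∑ ω with O ω φ ≠ V φ, w ω ≤ κ) (hβ : ∀ r, ∑ ω with r ∈ S ω, w ω ≤ β)
    (A : SQAlgorithm n Out) :
    ∀ (q : ℕ) (T : Finset Ω), (∀ ω ∈ T, A.UsesAtMost (O ω) q) →
      ∑ ω ∈ T, w ω * A.prob (O ω) (S ω) ≤ q * κ + β := by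
  induction A with
  | output r =>
    intro q T _
    simp only [SQAlgorithm.prob]
    calc ∑ ω ∈ T, w ω * (if r ∈ S ω then 1 else 0)
        ≤ ∑ ω, w ω * (if r ∈ S ω then 1 else 0) :=
          Finset.sum_le_sum_of_subset (Finset.subset_univ T)
      _ = ∑ ω with r ∈ S ω, w ω := by simp [Finset.sum_filter]
      _ ≤ β := hβ r
      _ ≤ q * κ + β := le_add_self
  | query φ next ih =>
    intro q T hT
    cases q with
    | zero =>
      have : T = ∅ := Finset.eq_empty_of_forall_notMem fun ω hω => hT ω hω
      simp [this]
    | succ q =>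
      -- The members that deviate at this query are given up, at total cost `κ`. All others receive
      -- the same answer `V φ` and enter the same branch, where the induction hypothesis applies
      -- with one query less.
      rw [← Finset.sum_filter_add_sum_filter_not T (fun ω => O ω φ ≠ V φ)]
      have h1 : ∑ ω ∈ T with O ω φ ≠ V φ, w ω * (SQAlgorithm.query φ next).prob (O ω) (S ω)
          ≤ κ := by
        refine le_trans ?_ (hκ φ)
        calc _ ≤ ∑ ω ∈ T with O ω φ ≠ V φ, w ω := by
              refine Finset.sum_le_sum fun ω _ => ?_
              calc _ ≤ w ω * 1 := mul_le_mul_right (SQAlgorithm.prob_le_one _ _ _) _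
                _ = w ω := mul_one _
          _ ≤ _ := Finset.sum_le_sum_of_subset
              (Finset.filter_subset_filter _ (Finset.subset_univ T))
      have h2 : ∑ ω ∈ T with ¬ O ω φ ≠ V φ,
          w ω * (SQAlgorithm.query φ next).prob (O ω) (S ω) ≤ q * κ + β := by
        have : ∀ ω ∈ T.filter (fun ω => ¬ O ω φ ≠ V φ),
            w ω * (SQAlgorithm.query φ next).prob (O ω) (S ω)
              = w ω * (next (V φ)).prob (O ω) (S ω) := by
          intro ω hω
          have h := (Finset.mem_filter.1 hω).2
          push Not at h
          simp only [SQAlgorithm.prob, h]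
        rw [Finset.sum_congr rfl this]
        refine ih (V φ) q _ fun ω hω => ?_
        have h := (Finset.mem_filter.1 hω).2
        push Not at h
        have := hT ω (Finset.mem_filter.1 hω).1
        simp only [SQAlgorithm.UsesAtMost] at this
        rwa [h] at this
      calc _ ≤ κ + (q * κ + β) := add_le_add h1 h2
        _ = ((q + 1 : ℕ) : ℝ≥0∞) * κ + β := by push_cast; ring
  | random p next ih =>
    intro q T hT
    simp only [SQAlgorithm.prob]
    calc ∑ ω ∈ T, w ω * ∑' i, p i * (next i).prob (O ω) (S ω)
        = ∑ ω ∈ T, ∑' i, p i * (w ω * (next i).prob (O ω) (S ω)) := by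
          refine Finset.sum_congr rfl fun ω _ => ?_
          rw [← ENNReal.tsum_mul_left]
          exact tsum_congr fun i => by ring
      _ = ∑' i, p i * ∑ ω ∈ T, w ω * (next i).prob (O ω) (S ω) := by
          rw [← Summable.tsum_finsetSum (fun _ _ => ENNReal.summable)]
          exact tsum_congr fun i => by rw [Finset.mul_sum]
      _ ≤ ∑' i, p i * (q * κ + β) := by
          refine ENNReal.tsum_le_tsum fun i => ?_
          -- The query bound is known only for draws of positive probability; the others contribute
          -- nothing to the sum.
          by_cases hi : i ∈ p.support
          · refine mul_le_mul_right (ih i q T fun ω hω => ?_) _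
            have := hT ω hω
            simp only [SQAlgorithm.UsesAtMost] at this
            exact this i hi
          · have : p i = 0 := by simpa [PMF.mem_support_iff] using hi
            simp [this]
      _ = q * κ + β := by rw [ENNReal.tsum_mul_right, p.tsum_coe, one_mul]

end SQ

/-! ### Total variation distance and bounded tests. -/

section TotalVariation

variable {n : ℕ}

/-- Expectation of a function of a random bit string. -/
def expect (P : ProbDist n) (φ : BitString n → ℝ) : ℝ := ∑ x, P.1 x * φ x

lemma tv_le_one (P Q : ProbDist n) : tv P Q ≤ 1 := by
  unfold tv
  have : ∑ x, |P.1 x - Q.1 x| ≤ ∑ x, (P.1 x + Q.1 x) := by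
    refine Finset.sum_le_sum fun x _ => ?_
    have h1 := P.2.1 x
    have h2 := Q.2.1 x
    rw [abs_le]; constructor <;> linarith
  rw [Finset.sum_add_distrib, P.2.2, Q.2.2] at this
  linarith

lemma tv_triangle (P Q R : ProbDist n) : tv P R ≤ tv P Q + tv Q R := by
  unfold tv
  rw [← mul_add, ← Finset.sum_add_distrib]
  gcongr
  exact abs_sub_le _ _ _

lemma two_mul_tv (P Q : ProbDist n) : 2 * tv P Q = ∑ x, |P.1 x - Q.1 x| := by
  unfold tv; ring

lemma abs_expect_sub_le (P Q : ProbDist n) {φ : BitString n → ℝ} (hφ : ∀ x, |φ x| ≤ 1) :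
    |expect P φ - expect Q φ| ≤ 2 * tv P Q := by
  rw [two_mul_tv]
  unfold expect
  rw [← Finset.sum_sub_distrib]
  refine (Finset.abs_sum_le_sum_abs _ _).trans (Finset.sum_le_sum fun x _ => ?_)
  rw [← sub_mul, abs_mul]
  exact mul_le_of_le_one_right (abs_nonneg _) (hφ x)

/-- The sign of `P - Q` is an optimal test. -/
lemma exists_expect_sub_eq (P Q : ProbDist n) :
    ∃ φ : BitString n → ℝ, (∀ x, |φ x| ≤ 1) ∧ expect P φ - expect Q φ = 2 * tv P Q := by
  refine ⟨fun x => if 0 ≤ P.1 x - Q.1 x then 1 else -1, fun x => ?_, ?_⟩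
  · dsimp only; split_ifs <;> simp
  · rw [two_mul_tv]
    unfold expect
    rw [← Finset.sum_sub_distrib]
    refine Finset.sum_congr rfl fun x _ => ?_
    rw [← sub_mul]
    dsimp only
    split_ifs with h
    · rw [abs_of_nonneg (by linarith)]; ring
    · rw [abs_of_neg (by linarith)]; ring

end TotalVariation

/-! ### Hard families and the query lower bound. -/

section HardFamily

/-- The set `D` contains a finite weighted family of distributions whose expectations deviate from
those of a fixed distribution by at most `v` in mean square, and whose average distance from that
distribution is at least `t`. -/
def HardFamily {n : ℕ} (D : Set (ProbDist n)) (v t : ℝ) : Prop :=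
  ∃ (Ω : Type) (_ : Fintype Ω) (w : Ω → ℝ) (P : Ω → ProbDist n) (R : ProbDist n),
    (∀ ω, 0 ≤ w ω) ∧ ∑ ω, w ω = 1 ∧ (∀ ω, P ω ∈ D) ∧
    (∀ φ : BitString n → ℝ, (∀ x, |φ x| ≤ 1) →
      ∑ ω, w ω * (expect (P ω) φ - expect R φ) ^ 2 ≤ v) ∧
    t ≤ ∑ ω, w ω * tv (P ω) R

variable {n : ℕ}

lemma HardFamily.mono {D D' : Set (ProbDist n)} {v v' t : ℝ} (h : HardFamily D v t)
    (hD : D ⊆ D') (hv : v ≤ v') : HardFamily D' v' t := by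
  obtain ⟨Ω, hΩ, w, P, R, h1, h2, h3, h4, h5⟩ := h
  exact ⟨Ω, hΩ, w, P, R, h1, h2, fun ω => hD (h3 ω), fun φ hφ => (h4 φ hφ).trans hv, h5⟩

/-- A test on `n` bits restricts to a test on the first `m` bits without changing any expectation,
and padding preserves distances. -/
lemma HardFamily.pad {G : GateSet} {m d : ℕ} (h : m ≤ n) {v t : ℝ}
    (H : HardFamily (outputDistributions G m d) v t) :
    HardFamily (outputDistributions G n d) v t := by
  obtain ⟨Ω, hΩ, w, P, R, h1, h2, h3, h4, h5⟩ := H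
  refine ⟨Ω, hΩ, w, fun ω => padDist h (P ω), padDist h R, h1, h2,
    fun ω => padDist_mem h (h3 ω), fun φ hφ => ?_, ?_⟩
  · have := h4 (fun y => φ (padBits h y)) fun y => hφ _
    simpa only [expect, sum_padDist_mul] using this
  · simpa only [tv_padDist] using h5

lemma markov_sum {Ω : Type*} [Fintype Ω] {w f : Ω → ℝ} (hw : ∀ ω, 0 ≤ w ω)
    (hf : ∀ ω, 0 ≤ f ω) {c : ℝ} (p : Ω → Prop) [DecidablePred p] (hp : ∀ ω, p ω → c ≤ f ω) :
    c * ∑ ω with p ω, w ω ≤ ∑ ω, w ω * f ω := by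
  rw [Finset.mul_sum, Finset.sum_filter]
  refine Finset.sum_le_sum fun ω _ => ?_
  split_ifs with h
  · rw [mul_comm]; exact mul_le_mul_of_nonneg_left (hp ω h) (hw ω)
  · exact mul_nonneg (hw ω) (hf ω)

open Classical in
/-- A query algorithm which learns a set containing a hard family needs many queries. -/
lemma HardFamily.query_bound {D : Set (ProbDist n)} {v t τ ε δ : ℝ} (H : HardFamily D v t)
    {Rep : Type} {Represents : Rep → ProbDist n → Prop}
    (huniq : ∀ r Q Q', Represents r Q → Represents r Q' → Q = Q')
    (hτ : 0 < τ) (hε : 0 < ε) (hτε : τ ≤ ε) (hεt : 4 * ε ≤ t / 2)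
    {q : ℕ} (A : SQAlgorithm n Rep)
    (hA : ∀ P ∈ D, ∀ O : Query n → ℝ, IsStatOracle τ P O → A.UsesAtMost O q ∧
        ENNReal.ofReal (1 - δ) ≤ A.prob O {r | ∃ Q, Represents r Q ∧ tv P Q < ε}) :
    t / 2 - δ ≤ (q + 1) * (v / τ ^ 2) := by
  obtain ⟨Ω, hΩ, w, P, R, hw, hw1, hPD, hvar, htv⟩ := H
  have hv0 : 0 ≤ v := le_trans (Finset.sum_nonneg fun ω _ => mul_nonneg (hw ω) (sq_nonneg _))
    (hvar 0 (by simp))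
  have hκ0 : 0 ≤ v / τ ^ 2 := by positivity
  -- deviations are rare
  have hdev : ∀ φ : BitString n → ℝ, (∀ x, |φ x| ≤ 1) →
      ∑ ω with τ < |expect (P ω) φ - expect R φ|, w ω ≤ v / τ ^ 2 := by
    intro φ hφ
    rw [le_div_iff₀ (by positivity), mul_comm]
    refine le_trans (markov_sum hw (fun ω => sq_nonneg _) _ fun ω hω => ?_) (hvar φ hφ)
    rw [← sq_abs (expect (P ω) φ - expect R φ)]
    exact pow_le_pow_left₀ hτ.le hω.le 2
  let V : Query n → ℝ := fun φ => expect R (fun x => (φ x : ℝ))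
  -- The adversary hides the member behind the reference value and reveals the exact expectation
  -- only when the reference value would be invalid.
  let O : Ω → Query n → ℝ := fun ω φ =>
    if τ < |expect (P ω) (fun x => (φ x : ℝ)) - V φ| then expect (P ω) (fun x => (φ x : ℝ))
    else V φ
  have hO : ∀ ω, IsStatOracle τ (P ω) (O ω) := by
    intro ω φ
    change |expect (P ω) (fun x => (φ x : ℝ)) - O ω φ| ≤ τ
    simp only [O]
    split_ifs with h
    · simp [hτ.le]
    · exact not_lt.1 h
  have hqabs : ∀ φ : Query n, ∀ x, |(φ x : ℝ)| ≤ 1 := fun φ x => abs_le.2 (φ x).2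
  -- no output is good for many members
  have hgood : ∀ Q : ProbDist n, ∑ ω with tv (P ω) Q < ε, w ω ≤ v / τ ^ 2 + (1 - t / 2) := by
    intro Q
    have hfar : ∑ ω with tv (P ω) R < t / 2, w ω ≤ 1 - t / 2 := by
      have h1 : ∑ ω, w ω * tv (P ω) R ≤ t / 2 * ∑ ω, w ω + ∑ ω with ¬ tv (P ω) R < t / 2, w ω := by
        rw [Finset.mul_sum, Finset.sum_filter, ← Finset.sum_add_distrib]
        refine Finset.sum_le_sum fun ω _ => ?_
        split_ifs with h
        · have := mul_le_mul_of_nonneg_left h.le (hw ω); linarith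
        · have h1 := mul_le_mul_of_nonneg_left (tv_le_one (P ω) R) (hw ω)
          have h2 : 0 ≤ t / 2 * w ω := mul_nonneg (by linarith) (hw ω)
          linarith
      have h2 := Finset.sum_filter_add_sum_filter_not Finset.univ
        (fun ω => tv (P ω) R < t / 2) w
      rw [hw1] at h1 h2
      linarith
    -- The optimal test between `Q` and `R` decides. If some member near `Q` does not deviate on it,
    -- then `Q` is within `ε + τ / 2` of `R`, so every member near `Q` is within `t / 2` of `R`, and
    -- such members have weight at most `1 - t / 2`. Otherwise all members near `Q` deviate on one
    -- test, and deviations are rare.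
    by_cases hclose : ∃ ω, tv (P ω) Q < ε ∧ ¬ τ < |expect (P ω) (Classical.choose
        (exists_expect_sub_eq Q R)) - expect R (Classical.choose (exists_expect_sub_eq Q R))|
    · obtain ⟨ω, h1, h2⟩ := hclose
      obtain ⟨hφ1, hφ2⟩ := Classical.choose_spec (exists_expect_sub_eq Q R)
      set φ := Classical.choose (exists_expect_sub_eq Q R)
      have h3 := abs_expect_sub_le (P ω) Q hφ1
      have h4 : 2 * tv Q R ≤ 2 * ε + τ := by
        rw [← hφ2]
        have := (abs_le.1 h3).1
        have := (abs_le.1 (not_lt.1 h2)).2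
        linarith
      have h5 : ∑ ω with tv (P ω) Q < ε, w ω ≤ ∑ ω with tv (P ω) R < t / 2, w ω := by
        refine Finset.sum_le_sum_of_subset_of_nonneg ?_ fun ω _ _ => hw ω
        intro ω' h
        rw [Finset.mem_filter] at h ⊢
        refine ⟨h.1, ?_⟩
        have := tv_triangle (P ω') Q R
        linarith [h.2]
      linarith
    · push Not at hclose
      have hφ := Classical.choose_spec (exists_expect_sub_eq Q R)
      have h5 : ∑ ω with tv (P ω) Q < ε, w ω ≤ v / τ ^ 2 := by
        refine le_trans ?_ (hdev _ hφ.1)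
        refine Finset.sum_le_sum_of_subset_of_nonneg ?_ fun ω _ _ => hw ω
        intro ω' h
        rw [Finset.mem_filter] at h ⊢
        exact ⟨h.1, hclose ω' h.2⟩
      have h6 : t ≤ 1 := htv.trans (by
        rw [← hw1]
        exact Finset.sum_le_sum fun ω _ => mul_le_of_le_one_right (hw ω) (tv_le_one _ _))
      linarith
  let S : Ω → Set Rep := fun ω => {r | ∃ Q, Represents r Q ∧ tv (P ω) Q < ε}
  have hsum0 : 0 ≤ v / τ ^ 2 + (1 - t / 2) :=
    le_trans (Finset.sum_nonneg fun ω _ => hw ω) (hgood R)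
  have key := SQAlgorithm.sum_prob_le O V S (fun ω => ENNReal.ofReal (w ω))
    (ENNReal.ofReal (v / τ ^ 2)) (ENNReal.ofReal (v / τ ^ 2 + (1 - t / 2)))
    (fun φ => by
      rw [← ENNReal.ofReal_sum_of_nonneg fun ω _ => hw ω]
      refine ENNReal.ofReal_le_ofReal (le_trans ?_ (hdev (fun x => (φ x : ℝ)) (hqabs φ)))
      refine Finset.sum_le_sum_of_subset_of_nonneg ?_ fun ω _ _ => hw ω
      intro ω h
      rw [Finset.mem_filter] at h ⊢
      refine ⟨h.1, ?_⟩
      by_contra h'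
      exact h.2 (if_neg h'))
    (fun r => by
      rw [← ENNReal.ofReal_sum_of_nonneg fun ω _ => hw ω]
      -- An output determines at most one distribution by `huniq`; one that represents nothing
      -- succeeds for no member.
      by_cases hr : ∃ Q, Represents r Q
      · obtain ⟨Q, hQ⟩ := hr
        refine ENNReal.ofReal_le_ofReal (le_trans ?_ (hgood Q))
        refine Finset.sum_le_sum_of_subset_of_nonneg ?_ fun ω _ _ => hw ω
        intro ω h
        rw [Finset.mem_filter] at h ⊢
        obtain ⟨Q', hQ', h'⟩ := h.2
        rw [huniq r Q Q' hQ hQ']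
        exact ⟨h.1, h'⟩
      · rw [Finset.filter_false_of_mem]
        · simp
        · rintro ω - ⟨Q, hQ, -⟩
          exact hr ⟨Q, hQ⟩)
    A q Finset.univ (fun ω _ => (hA (P ω) (hPD ω) (O ω) (hO ω)).1)
  have low : ENNReal.ofReal (1 - δ) ≤
      ∑ ω, ENNReal.ofReal (w ω) * A.prob (O ω) (S ω) := by
    calc ENNReal.ofReal (1 - δ) = ∑ ω, ENNReal.ofReal (w ω) * ENNReal.ofReal (1 - δ) := by
          rw [← Finset.sum_mul, ← ENNReal.ofReal_sum_of_nonneg fun ω _ => hw ω, hw1]; simp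
      _ ≤ _ := Finset.sum_le_sum fun ω _ =>
          mul_le_mul_right (hA (P ω) (hPD ω) (O ω) (hO ω)).2 _
  have fin := low.trans key
  rw [← ENNReal.ofReal_natCast, ← ENNReal.ofReal_mul (Nat.cast_nonneg q),
    ← ENNReal.ofReal_add (by positivity) hsum0,
    ENNReal.ofReal_le_ofReal_iff (by positivity)] at fin
  linarith

end HardFamily

lemma IsStatOracle.mono {n : ℕ} {τ τ' : ℝ} (h : τ ≤ τ') {P : ProbDist n} {O : Query n → ℝ}
    (hO : IsStatOracle τ P O) : IsStatOracle τ' P O := fun φ => (hO φ).trans h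

/-- Classes that contain hard families of inverse superpolynomial variance are not query-efficiently
learnable, whatever the representation. -/
lemma not_learnable_of_hardFamily {D : (n : ℕ) → Set (ProbDist n)} {t : ℝ} (ht : 0 < t)
    (H : ∀ A : ℕ, ∀ᶠ n : ℕ in atTop, HardFamily (D n) (1 / (n : ℝ) ^ A) t)
    {τ : ℕ → ℝ} (hτ : InversePolynomial τ) {Rep : ℕ → Type}
    {Represents : (n : ℕ) → Rep n → ProbDist n → Prop}
    (huniq : ∀ n r Q Q', Represents n r Q → Represents n r Q' → Q = Q') :
    ¬ QueryEfficientlyLearnable D τ Rep Represents := by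
  rintro ⟨C, c, n₀, hL⟩
  obtain ⟨c', a, ha, hτ⟩ := hτ
  -- The cap at `1` keeps `ε` and `δ` below `1`. The choices below give `4 * ε = t' / 2` and leave
  -- the gap `t' / 2 - δ = t' / 4`.
  set t' := min t 1 with ht'
  have ht'0 : 0 < t' := lt_min ht one_pos
  have ht'1 : t' ≤ 1 := min_le_right _ _
  set ε := t' / 8 with hε
  set δ := t' / 4 with hδ
  -- The smaller tolerance `b / n ^ c'` lies below both `τ n` and `ε`; answers valid for it are
  -- valid for `τ n`.
  set b := min a ε with hb
  have hε0 : 0 < ε := by positivity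
  have hb0 : 0 < b := lt_min ha hε0
  set K := 1 + 1 / ε + 1 / δ with hK
  have hK0 : 0 < K := by positivity
  have hlim : Tendsto (fun n : ℕ => ((C * K ^ c + 1) / b ^ 2) / (n : ℝ)) atTop (nhds 0) :=
    tendsto_const_div_atTop_nhds_zero_nat _
  have hev : ∀ᶠ n : ℕ in atTop, ((C * K ^ c + 1) / b ^ 2) / (n : ℝ) < t' / 4 :=
    hlim.eventually_lt_const (by positivity)
  -- In the exponent, `c` pays for the number of queries, `2 * c'` for the squared tolerance, and
  -- the extra `1` leaves a bound that tends to zero.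
  obtain ⟨n, h1, h2, h3, h4, h5⟩ := ((H (c + 2 * c' + 1)).and (hτ.and (hev.and
    ((eventually_ge_atTop n₀).and (eventually_ge_atTop 1))))).exists
  have hn1 : (1 : ℝ) ≤ n := by exact_mod_cast h5
  have hn0 : (0 : ℝ) < n := by linarith
  obtain ⟨A, q, hq, hA⟩ := hL n h4 ε δ hε0 (by rw [hε]; linarith) (by positivity)
    (by rw [hδ]; linarith)
  have hτ0 : 0 < b / (n : ℝ) ^ c' := by positivity
  have hτε : b / (n : ℝ) ^ c' ≤ ε :=
    (div_le_self hb0.le (one_le_pow₀ hn1)).trans (min_le_right _ _)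
  have hττ : b / (n : ℝ) ^ c' ≤ τ n := by
    refine le_trans ?_ h2
    gcongr
    exact min_le_left _ _
  obtain ⟨Ω, hΩ, w, P, R, g1, g2, g3, g4, g5⟩ := h1
  have h1' : HardFamily (D n) (1 / (n : ℝ) ^ (c + 2 * c' + 1)) t' :=
    ⟨Ω, hΩ, w, P, R, g1, g2, g3, g4, (min_le_left _ _).trans g5⟩
  have key := h1'.query_bound (huniq n) hτ0 hε0 hτε (by rw [hε]; linarith) A
    (fun P hP O hO => hA P hP O (hO.mono hττ))
  have hq' : (q : ℝ) + 1 ≤ (C * K ^ c + 1) * (n : ℝ) ^ c := by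
    have e1 : (n : ℝ) + 1 / ε + 1 / δ ≤ n * K := by
      rw [hK]
      have : 0 < 1 / ε := by positivity
      have : 0 < 1 / δ := by positivity
      nlinarith
    have e2 : ((n : ℝ) + 1 / ε + 1 / δ) ^ c ≤ (n * K) ^ c :=
      pow_le_pow_left₀ (by positivity) e1 c
    have e3 : (1 : ℝ) ≤ (n : ℝ) ^ c := one_le_pow₀ hn1
    calc (q : ℝ) + 1 ≤ C * (n * K) ^ c + (n : ℝ) ^ c :=
          add_le_add (hq.trans (mul_le_mul_of_nonneg_left e2 (Nat.cast_nonneg C))) e3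
      _ = (C * K ^ c + 1) * (n : ℝ) ^ c := by rw [mul_pow]; ring
  have hfin : ((q : ℝ) + 1) * (1 / (n : ℝ) ^ (c + 2 * c' + 1) / (b / (n : ℝ) ^ c') ^ 2)
      ≤ ((C * K ^ c + 1) / b ^ 2) / (n : ℝ) := by
    calc _ ≤ (C * K ^ c + 1) * (n : ℝ) ^ c *
          (1 / (n : ℝ) ^ (c + 2 * c' + 1) / (b / (n : ℝ) ^ c') ^ 2) := by
          gcongr
      _ = ((C * K ^ c + 1) / b ^ 2) / (n : ℝ) := by
          field_simp
          ring
  have : t' / 2 - δ = t' / 4 := by rw [hδ]; ring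
  linarith

/-- Generators and evaluators enter only through the fact that each determines its distribution, so
one argument covers both. -/
theorem sqHard_of_hardFamily {D : (n : ℕ) → Set (ProbDist n)} {t : ℝ} (ht : 0 < t)
    (H : ∀ A : ℕ, ∀ᶠ n : ℕ in atTop, HardFamily (D n) (1 / (n : ℝ) ^ A) t) : SQHard D := by
  intro τ hτ
  refine ⟨not_learnable_of_hardFamily ht H hτ fun n r Q Q' h h' => ?_,
    not_learnable_of_hardFamily ht H hτ fun n r Q Q' h h' => ?_⟩
  · exact Subtype.ext (funext fun x => (h x).symm.trans (h' x))
  · exact Subtype.ext (funext fun x => (h x).symm.trans (h' x))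

/-! ### Output distributions of unitaries -/

section BornDist

variable {n : ℕ}

lemma sum_norm_sq_col {ι : Type*} [Fintype ι] [DecidableEq ι] {U : Matrix ι ι ℂ}
    (hU : U ∈ Matrix.unitaryGroup ι ℂ) (b : ι) : ∑ a, ‖U a b‖ ^ 2 = 1 := by
  have h := congrFun (congrFun (Matrix.mem_unitaryGroup_iff'.1 hU) b) b
  rw [Matrix.mul_apply, Matrix.one_apply_eq] at h
  have : ((∑ a, ‖U a b‖ ^ 2 : ℝ) : ℂ) = 1 := by
    rw [← h]
    push_cast
    refine Finset.sum_congr rfl fun a _ => ?_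
    rw [Matrix.star_apply, ← Complex.conj_mul']
    rfl
  exact_mod_cast this

/-- The output distribution of a unitary applied to the all-zeros state. -/
def bornDist (U : Op n) (hU : U ∈ Matrix.unitaryGroup (BitString n) ℂ) : ProbDist n :=
  ⟨fun x => ‖U x (fun _ => false)‖ ^ 2, fun _ => sq_nonneg _, sum_norm_sq_col hU _⟩

lemma bornDist_mem {G : GateSet} {d : ℕ} {U : Op n} (hU : IsCircuit G n d U) :
    bornDist U hU.mem_unitary ∈ outputDistributions G n d := ⟨U, hU, fun _ => rfl⟩

lemma card_bitString (n : ℕ) : Fintype.card (BitString n) = 2 ^ n := by simp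

/-- The uniform distribution. -/
def uniformDist (n : ℕ) : ProbDist n :=
  ⟨fun _ => (2 ^ n : ℝ)⁻¹, fun _ => by positivity, by simp⟩

lemma embedOp_eq_self (g : Op n) {e : Fin n → Fin n} (he : ∀ i, e i = i) : embedOp e g = g := by
  have he : e = id := funext he
  subst he
  ext a b
  simp [embedOp]

lemma isCircuit_of_two_mem {G : GateSet} {g : Matrix.unitaryGroup (BitString 2) ℂ}
    (hg : g ∈ G.two) : IsCircuit G 2 1 (g : Op 2) := by
  have := (isLayer_toOp (G := G) (n := 2) (.two g hg 0 1 (by simp))).isCircuit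
  rwa [PlacedGate.toOp, embedOp_eq_self] at this
  intro i; fin_cases i <;> rfl

end BornDist

/-! ### Parity distributions -/

section ParityGate

/-- An integer multiple of `parityGate`. -/
def parityGateInt (s : Bool) : Matrix (BitString 2) (BitString 2) ℤ :=
  fun a b => if b 0 = xor (a 1) (s && a 0) then (if a 0 && b 1 then -1 else 1) else 0

/-- The Pauli operators with integer entries. -/
def pauliInt (x z : BitString 2) : Matrix (BitString 2) (BitString 2) ℤ :=
  fun a b => if a = (fun i => xor (b i) (x i)) then
    ∏ i, (if z i && b i then (-1 : ℤ) else 1) else 0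

/-- Scaled by `√2`, the gate has entries `0` and `±1`, so unitarity becomes a finite integer
computation. -/
lemma parityGateInt_mul_transpose (s : Bool) :
    parityGateInt s * (parityGateInt s)ᵀ = (2 : ℤ) • (1 : Matrix (BitString 2) (BitString 2) ℤ) := by
  revert s; decide

/-- This is the conjugation rule for Pauli operators, with the gate moved to the other side so that
it stays an identity of integer matrices. The sign arises because the Hadamard gate on the second
qubit turns `X Z` into `Z X = -X Z`. -/
lemma parityGateInt_mul_pauliInt (s x₀ x₁ z₀ z₁ : Bool) :
    parityGateInt s * pauliInt ![x₀, x₁] ![z₀, z₁] =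
      (if z₁ && x₁ then (-1 : ℤ) else 1) •
        (pauliInt ![z₁, xor x₀ (s && z₁)] ![xor x₁ (s && z₀), z₀] * parityGateInt s) := by
  revert s x₀ x₁ z₀ z₁
  decide

lemma sqrt_two_inv_sq : ((√2 : ℝ) : ℂ)⁻¹ * ((√2 : ℝ) : ℂ)⁻¹ = 2⁻¹ := by
  rw [← mul_inv, ← Complex.ofReal_mul, Real.mul_self_sqrt (by norm_num)]
  norm_num

/-- A two-qubit Clifford gate: a Hadamard gate on the second qubit, followed by a controlled NOT
onto the first qubit if `s` holds, followed by a swap. -/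
def parityGateOp (s : Bool) : Op 2 :=
  ((√2 : ℝ) : ℂ)⁻¹ • (parityGateInt s).map (Int.castRingHom ℂ)

lemma parityGateOp_apply (s : Bool) (a b : BitString 2) :
    parityGateOp s a b = if b 0 = xor (a 1) (s && a 0) then
      (if a 0 && b 1 then -1 else 1) * ((√2 : ℝ) : ℂ)⁻¹ else 0 := by
  simp only [parityGateOp, Matrix.smul_apply, Matrix.map_apply, parityGateInt, smul_eq_mul]
  split_ifs <;> simp

lemma parityGateOp_conjTranspose (s : Bool) :
    (parityGateOp s)ᴴ = ((√2 : ℝ) : ℂ)⁻¹ • (parityGateInt s)ᵀ.map (Int.castRingHom ℂ) := by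
  ext a b
  simp [parityGateOp, Matrix.conjTranspose_apply]

lemma parityGateOp_mem (s : Bool) : parityGateOp s ∈ Matrix.unitaryGroup (BitString 2) ℂ := by
  rw [Matrix.mem_unitaryGroup_iff, Matrix.star_eq_conjTranspose, parityGateOp_conjTranspose,
    parityGateOp, Matrix.smul_mul, Matrix.mul_smul, ← Matrix.map_mul,
    parityGateInt_mul_transpose, smul_smul, sqrt_two_inv_sq]
  ext a b
  simp only [Matrix.smul_apply, Matrix.map_apply, Matrix.one_apply, smul_eq_mul]
  split_ifs <;> simp

/-- `parityGateOp` as a unitary. -/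
def parityGate (s : Bool) : Matrix.unitaryGroup (BitString 2) ℂ :=
  ⟨parityGateOp s, parityGateOp_mem s⟩

lemma pauli_eq_map (x z : BitString 2) :
    pauli x z = (pauliInt x z).map (Int.castRingHom ℂ) := by
  ext a b
  simp only [pauli, pauliInt, Matrix.map_apply]
  split_ifs
  · rw [map_prod]
    refine Finset.prod_congr rfl fun i _ => ?_
    split_ifs <;> simp
  · simp

lemma isClifford_parityGate (s : Bool) : IsClifford (parityGate s) := by
  intro x z
  -- The exponent `2` encodes the sign `-1` as `I ^ 2`.
  refine ⟨if z 1 && x 1 then 2 else 0, ![z 1, xor (x 0) (s && z 1)],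
    ![xor (x 1) (s && z 0), z 0], ?_⟩
  have h := congrArg (fun M => M.map (Int.castRingHom ℂ))
    (parityGateInt_mul_pauliInt s (x 0) (x 1) (z 0) (z 1))
  have hx : ![x 0, x 1] = x := by funext i; fin_cases i <;> rfl
  have hz : ![z 0, z 1] = z := by funext i; fin_cases i <;> rfl
  rw [hx, hz] at h
  simp only [Matrix.map_mul] at h
  have h2 : (parityGate s : Op 2) * pauli x z =
      (if z 1 && x 1 then (-1 : ℂ) else 1) •
        (pauli ![z 1, xor (x 0) (s && z 1)] ![xor (x 1) (s && z 0), z 0] * parityGateOp s) := by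
    change parityGateOp s * _ = _
    rw [parityGateOp, Matrix.smul_mul, pauli_eq_map, h, pauli_eq_map, Matrix.mul_smul,
      smul_comm]
    congr 1
    rw [← Matrix.map_mul]
    ext a b
    simp only [Matrix.map_apply, Matrix.smul_apply, smul_eq_mul, map_mul]
    split_ifs <;> simp
  have h3 : parityGateOp s * (parityGateOp s)ᴴ = 1 :=
    Matrix.mem_unitaryGroup_iff.1 (parityGateOp_mem s)
  rw [h2, Matrix.smul_mul, Matrix.mul_assoc]
  change _ • (_ * (parityGateOp s * (parityGateOp s)ᴴ)) = _
  rw [h3, Matrix.mul_one]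
  congr 1
  split_ifs <;> simp

end ParityGate

/-! ### The parity family and its variance. -/

section ParityFamily

variable {M : ℕ}

/-- The bit in position `j`, or `false` if there is no such position. -/
def bitAt {k : ℕ} (y : BitString k) (j : ℕ) : Bool := if h : j < k then y ⟨j, h⟩ else false

/-- The parity of the first `j` bits of `x` selected by `s`. -/
def prefixParity {k l : ℕ} (s : BitString k) (x : BitString l) : ℕ → Bool
  | 0 => false
  | j + 1 => xor (prefixParity s x j) (bitAt s j && bitAt x j)

lemma prefixParity_congr {k l : ℕ} (s : BitString k) {x y : BitString l} {j : ℕ}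
    (h : ∀ i < j, bitAt x i = bitAt y i) : prefixParity s x j = prefixParity s y j := by
  induction j with
  | zero => rfl
  | succ j ih =>
    simp only [prefixParity]
    rw [ih fun i hi => h i (by omega), h j (by omega)]

lemma bitAt_extend_shiftFin {m n : ℕ} {a : ℕ} (h : a + m ≤ n) (x : BitString n) (y : BitString m)
    (j : ℕ) : bitAt (Function.extend (shiftFin a h) y x) j =
      if a ≤ j ∧ j < a + m then bitAt y (j - a) else bitAt x j := by
  unfold bitAt
  by_cases hj : j < n
  · simp only [hj, dif_pos]
    split_ifs with h1 h2
    · have : (⟨j, hj⟩ : Fin n) = shiftFin a h ⟨j - a, h2⟩ := by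
        simp only [shiftFin, Fin.ext_iff]; omega
      rw [this, (shiftFin_injective a h).extend_apply]
    · omega
    · refine extend_apply_off x y fun i hi => h1 ?_
      simp only [shiftFin, Fin.ext_iff] at hi
      omega
  · simp only [hj, dif_neg, not_false_iff]
    split_ifs <;> first | rfl | omega

-- Invariant of the construction: after `j` gates qubit `j` carries the parity, the earlier qubits
-- are uniformly random bits, and the later ones are still zero. The next gate makes qubit `j + 1`
-- random, adds it to the parity if `s` selects it, and swaps the two.
open Classical in
lemma exists_parity_circuit {G : GateSet} (hG : ∀ s, parityGate s ∈ G.two) (s : BitString M)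
    (j : ℕ) (hj : j ≤ M) : ∃ U : Op (M + 1), IsCircuit G (M + 1) j U ∧
      ∀ x, U x (fun _ => false) =
        if bitAt x j = prefixParity s x j ∧ ∀ i, j < i → bitAt x i = false
        then (((√2 : ℝ) : ℂ)⁻¹) ^ j else 0 := by
  induction j with
  | zero =>
    refine ⟨1, rfl, fun x => ?_⟩
    rw [Matrix.one_apply]
    congr 1
    simp only [prefixParity, eq_iff_iff]
    constructor
    · rintro rfl
      simp [bitAt]
    · rintro ⟨h0, h1⟩
      funext i
      have : bitAt x i = false := by
        rcases Nat.eq_zero_or_pos i.val with h | h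
        · rw [h]; exact h0
        · exact h1 _ h
      simpa only [bitAt, i.2, dif_pos] using this
  | succ j ih =>
    obtain ⟨U, hU, hx⟩ := ih (by omega)
    have he : j + 2 ≤ M + 1 := by omega
    have hinj := shiftFin_injective j he
    refine ⟨embedOp (shiftFin j he) (parityGate (bitAt s j) : Op 2) * U, ?_, fun x => ?_⟩
    · rw [add_comm j 1]
      exact ((isCircuit_of_two_mem (hG _)).shift j he).mul hU
    · rw [Matrix.mul_apply, sum_embedOp_mul hinj _ x (fun b => U b fun _ => false)]
      have hb0 : (x ∘ shiftFin j he) 0 = bitAt x j := by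
        simp [bitAt, shiftFin, show j < M + 1 by omega]
      have hb1 : (x ∘ shiftFin j he) 1 = bitAt x (j + 1) := by
        simp [bitAt, shiftFin, show j < M by omega]
      -- Qubit `j + 1` was zero before the gate, and the output bits determine the previous parity
      -- bit, so only one path contributes to each amplitude.
      rw [Finset.sum_eq_single ![xor (bitAt x (j + 1)) (bitAt s j && bitAt x j), false]]
      · change parityGateOp _ _ _ * _ = _
        rw [parityGateOp_apply, hx, hb0, hb1]
        simp only [Matrix.cons_val_zero, Matrix.cons_val_one, if_true, Bool.and_false,
          Bool.false_eq_true, if_false, one_mul]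
        have hpar : prefixParity s (Function.extend (shiftFin j he)
            ![xor (bitAt x (j + 1)) (bitAt s j && bitAt x j), false] x) j =
            prefixParity s x j := by
          refine prefixParity_congr s fun i hi => ?_
          rw [bitAt_extend_shiftFin, if_neg (by omega)]
        rw [hpar, mul_ite, mul_zero, ← pow_succ']
        congr 1
        rw [eq_iff_iff]
        simp only [prefixParity]
        refine and_congr ?_ ?_
        · rw [bitAt_extend_shiftFin, if_pos (by omega), Nat.sub_self]
          change xor _ _ = _ ↔ _
          generalize prefixParity s x j = p
          generalize bitAt x (j + 1) = u
          generalize (bitAt s j && bitAt x j) = v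
          revert p u v; decide
        · constructor
          · intro h i hi
            have := h i (by omega)
            rwa [bitAt_extend_shiftFin, if_neg (by omega)] at this
          · intro h i hi
            rw [bitAt_extend_shiftFin]
            split_ifs with h1
            · have : i - j = 1 := by omega
              rw [this]; rfl
            · exact h i (by omega)
      · intro y _ hy
        change parityGateOp _ _ _ * _ = _
        rw [parityGateOp_apply, hx, hb0, hb1]
        by_cases h0 : y 0 = xor (bitAt x (j + 1)) (bitAt s j && bitAt x j)
        · have h1 : y 1 ≠ false := fun h1 => hy (by
            funext i; fin_cases i
            · exact h0
            · exact h1)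
          rw [if_neg (c := _ ∧ _), mul_zero]
          rintro ⟨-, h⟩
          have := h (j + 1) (by omega)
          rw [bitAt_extend_shiftFin, if_pos (by omega)] at this
          apply h1
          simpa [bitAt] using this
        · rw [if_neg h0, zero_mul]
      · simp

/-- The sign of a bit. -/
def bitSign (b : Bool) : ℝ := if b then -1 else 1

lemma bitSign_xor (a b : Bool) : bitSign (xor a b) = bitSign a * bitSign b := by
  cases a <;> cases b <;> simp [bitSign]

lemma abs_bitSign (a : Bool) : |bitSign a| = 1 := by cases a <;> simp [bitSign]

lemma bitSign_prefixParity (s : BitString M) (x : BitString (M + 1)) :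
    bitSign (prefixParity s x M) = ∏ i : Fin M, bitSign (s i && x i.castSucc) := by
  have : ∀ j, bitSign (prefixParity s x j) =
      ∏ i ∈ Finset.range j, bitSign (bitAt s i && bitAt x i) := by
    intro j
    induction j with
    | zero => simp [prefixParity, bitSign]
    | succ j ih => rw [prefixParity, bitSign_xor, ih, Finset.prod_range_succ]
  rw [this, Finset.prod_range]
  refine Finset.prod_congr rfl fun i _ => ?_
  congr 2
  · simp [bitAt]
  · simp [bitAt, show (i : ℕ) < M + 1 by omega]; rfl

/-- The character that tests whether the last bit is the parity of the bits selected by `s`. -/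
def parityChar (s : BitString M) (x : BitString (M + 1)) : ℝ :=
  bitSign (x (Fin.last M)) * ∏ i : Fin M, bitSign (s i && x i.castSucc)

lemma parityChar_eq (s : BitString M) (x : BitString (M + 1)) :
    parityChar s x = if bitAt x M = prefixParity s x M then 1 else -1 := by
  rw [parityChar, ← bitSign_prefixParity, ← bitSign_xor]
  have : x (Fin.last M) = bitAt x M := by simp [bitAt]; rfl
  rw [this]
  generalize bitAt x M = a
  generalize prefixParity s x M = b
  cases a <;> cases b <;> simp [bitSign]

/-- The sum over `s` factors over the positions. The product vanishes unless `x` and `y` agree on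
the first `M` bits, which is the orthogonality of the characters. -/
lemma sum_parityChar_mul (x y : BitString (M + 1)) :
    ∑ s : BitString M, parityChar s x * parityChar s y =
      bitSign (x (Fin.last M)) * bitSign (y (Fin.last M)) *
        ∏ i : Fin M, (1 + bitSign (x i.castSucc) * bitSign (y i.castSucc)) := by
  have h : ∀ s : BitString M, parityChar s x * parityChar s y =
      bitSign (x (Fin.last M)) * bitSign (y (Fin.last M)) *
        ∏ i : Fin M, bitSign (s i && x i.castSucc) * bitSign (s i && y i.castSucc) := fun s => by
    rw [parityChar, parityChar, Finset.prod_mul_distrib]; ring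
  simp only [h]
  rw [← Finset.mul_sum]
  congr 1
  have := Finset.prod_univ_sum (fun _ : Fin M => (Finset.univ : Finset Bool))
    (fun i b => bitSign (b && x i.castSucc) * bitSign (b && y i.castSucc))
  rw [Fintype.piFinset_univ] at this
  rw [← this]
  refine Finset.prod_congr rfl fun i _ => ?_
  rw [Fintype.sum_bool]
  simp [bitSign, add_comm]

lemma sum_prod_bitSign (x : BitString (M + 1)) :
    ∑ y : BitString (M + 1), ∏ i : Fin M, (1 + bitSign (x i.castSucc) * bitSign (y i.castSucc)) =
      2 ^ (M + 1) := by
  have h := Finset.prod_univ_sum (fun _ : Fin (M + 1) => (Finset.univ : Finset Bool))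
    (fun i b => if i = Fin.last M then (1 : ℝ) else 1 + bitSign (x i) * bitSign b)
  rw [Fintype.piFinset_univ] at h
  have h1 : ∀ y : BitString (M + 1),
      ∏ i : Fin M, (1 + bitSign (x i.castSucc) * bitSign (y i.castSucc)) =
      ∏ i : Fin (M + 1), (if i = Fin.last M then (1 : ℝ) else 1 + bitSign (x i) * bitSign (y i)) := by
    intro y
    rw [Fin.prod_univ_castSucc]
    simp [Fin.castSucc_ne_last]
  simp only [h1]
  rw [← h]
  have h2 : ∀ i : Fin (M + 1), ∑ b : Bool,
      (if i = Fin.last M then (1 : ℝ) else 1 + bitSign (x i) * bitSign b) = 2 := by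
    intro i
    rw [Fintype.sum_bool]
    split_ifs
    · norm_num
    · simp [bitSign]; ring
  rw [Finset.prod_congr rfl fun i _ => h2 i]
  simp

/-- After expanding the square and summing over `s` first, the kernel is, up to sign, a nonnegative
product, so bounding `φ` by `1` costs nothing. Each `x` then contributes `2 ^ (M + 1)`. -/
lemma sum_sq_parityChar_le {φ : BitString (M + 1) → ℝ} (hφ : ∀ x, |φ x| ≤ 1) :
    ∑ s : BitString M, (∑ x, φ x * parityChar s x) ^ 2 ≤ 4 ^ (M + 1) := by
  have h1 : ∑ s : BitString M, (∑ x, φ x * parityChar s x) ^ 2 =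
      ∑ x, ∑ y, φ x * φ y * ∑ s : BitString M, parityChar s x * parityChar s y := by
    simp only [sq, Finset.sum_mul_sum]
    simp only [Finset.mul_sum]
    rw [Finset.sum_comm]
    refine Finset.sum_congr rfl fun x _ => ?_
    rw [Finset.sum_comm]
    exact Finset.sum_congr rfl fun y _ => Finset.sum_congr rfl fun s _ => by ring
  rw [h1]
  calc _ ≤ ∑ x : BitString (M + 1), ∑ y : BitString (M + 1),
        ∏ i : Fin M, (1 + bitSign (x i.castSucc) * bitSign (y i.castSucc)) := by
        refine Finset.sum_le_sum fun x _ => Finset.sum_le_sum fun y _ => ?_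
        rw [sum_parityChar_mul]
        have hp : 0 ≤ ∏ i : Fin M, (1 + bitSign (x i.castSucc) * bitSign (y i.castSucc)) := by
          refine Finset.prod_nonneg fun i _ => ?_
          generalize x i.castSucc = a
          generalize y i.castSucc = b
          cases a <;> cases b <;> norm_num [bitSign]
        refine (le_abs_self _).trans ?_
        rw [abs_mul, abs_mul, abs_mul, abs_mul, abs_bitSign, abs_bitSign, abs_of_nonneg hp, one_mul,
          one_mul]
        refine mul_le_of_le_one_left hp ?_
        exact mul_le_one₀ (hφ x) (abs_nonneg _) (hφ y)
    _ = 4 ^ (M + 1) := by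
        simp only [sum_prod_bitSign]
        simp only [Finset.sum_const, Finset.card_univ, card_bitString, nsmul_eq_mul]
        push_cast
        rw [← mul_pow]; norm_num

/-- Each member is the uniform distribution times `1 + parityChar s`. Its deviation from uniform on
a test is thus a normalized character coefficient of the test, and its distance from uniform is
exactly `1 / 2`. -/
lemma hardFamily_parity {G : GateSet} (hG : ∀ s, parityGate s ∈ G.two) (M : ℕ) :
    HardFamily (outputDistributions G (M + 1) M) (2 ^ M)⁻¹ (1 / 2) := by
  choose U hU hUx using fun s : BitString M => exists_parity_circuit hG s M le_rfl
  have hP : ∀ s x, (bornDist (U s) (hU s).mem_unitary).1 x =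
      (2 ^ (M + 1) : ℝ)⁻¹ * (1 + parityChar s x) := by
    intro s x
    change ‖U s x fun _ => false‖ ^ 2 = _
    rw [hUx, parityChar_eq]
    have hlast : ∀ i, M < i → bitAt x i = false := fun i hi => by
      simp [bitAt, show ¬ i < M + 1 by omega]
    by_cases h : bitAt x M = prefixParity s x M
    · rw [if_pos ⟨h, hlast⟩, if_pos h, norm_pow, norm_inv, Complex.norm_real,
        Real.norm_of_nonneg (Real.sqrt_nonneg _), ← pow_mul, mul_comm M 2, pow_mul, inv_pow,
        Real.sq_sqrt (by norm_num), pow_succ, inv_pow]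
      field_simp; norm_num
    · rw [if_neg fun h' => h h'.1, if_neg h]; simp
  refine ⟨BitString M, inferInstance, fun _ => (2 ^ M)⁻¹, fun s => bornDist (U s)
    (hU s).mem_unitary, uniformDist (M + 1), fun _ => by positivity, by simp,
    fun s => bornDist_mem (hU s), fun φ hφ => ?_, ?_⟩
  · have h1 : ∀ s, expect (bornDist (U s) (hU s).mem_unitary) φ - expect (uniformDist (M + 1)) φ =
        (2 ^ (M + 1) : ℝ)⁻¹ * ∑ x, φ x * parityChar s x := by
      intro s
      unfold expect
      rw [← Finset.sum_sub_distrib, Finset.mul_sum]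
      refine Finset.sum_congr rfl fun x _ => ?_
      rw [hP]
      simp only [uniformDist]
      ring
    simp only [h1, mul_pow]
    rw [← Finset.mul_sum, ← Finset.mul_sum]
    have h2 := sum_sq_parityChar_le hφ
    refine mul_le_of_le_one_right (by positivity) ?_
    rw [inv_pow, inv_mul_le_iff₀ (by positivity), mul_one, ← pow_mul, mul_comm (M + 1) 2, pow_mul]
    norm_num at h2 ⊢
    exact h2
  · have h1 : ∀ s, tv (bornDist (U s) (hU s).mem_unitary) (uniformDist (M + 1)) = 1 / 2 := by
      intro s
      unfold tv
      have : ∀ x, |(bornDist (U s) (hU s).mem_unitary).1 x - (uniformDist (M + 1)).1 x| =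
          (2 ^ (M + 1) : ℝ)⁻¹ := by
        intro x
        rw [hP]
        simp only [uniformDist]
        rw [mul_add, mul_one, add_sub_cancel_left, abs_mul, abs_of_pos (by positivity),
          parityChar_eq]
        split_ifs <;> simp
      simp only [this]
      simp
    simp only [h1]
    simp

/-- `log n ^ k = o(d n)` allows for circuits of depth `C (A log₂ n) ^ k + B`. -/
lemma eventually_log_pow_le {k : ℕ} {d : ℕ → ℕ}
    (hd : (fun n : ℕ => Real.log n ^ k) =o[atTop] (fun n : ℕ => (d n : ℝ)))
    (A B C : ℕ) : ∀ᶠ n : ℕ in atTop, C * (A * Nat.log 2 n) ^ k + B ≤ d n := by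
  -- The factor `2` covers the change from the binary to the natural logarithm, and `B` is absorbed
  -- because `log n ≥ 1` for `n ≥ 3`.
  set c : ℝ := C * (A * 2) ^ k + B + 1 with hc
  have hc0 : 0 < c := by positivity
  have h1 := hd.def (c := 1 / c) (by positivity)
  filter_upwards [h1, eventually_ge_atTop 3] with n hn hn3
  have hn3' : (3 : ℝ) ≤ n := by exact_mod_cast hn3
  have hlog1 : 1 ≤ Real.log n := by
    rw [Real.le_log_iff_exp_le (by linarith)]
    linarith [Real.exp_one_lt_d9]
  have hlog2 : (Nat.log 2 n : ℝ) ≤ 2 * Real.log n := by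
    have h := Real.natLog_le_logb n 2
    rw [Real.logb, le_div_iff₀ (Real.log_pos (by norm_num))] at h
    have h2 := Real.log_two_gt_d9
    push_cast at h
    have h0 : (0 : ℝ) ≤ Nat.log 2 n := Nat.cast_nonneg _
    nlinarith
  rw [Real.norm_of_nonneg (by positivity), Real.norm_of_nonneg (by positivity), one_div,
    inv_mul_eq_div, le_div_iff₀ hc0] at hn
  have hpow : 1 ≤ Real.log n ^ k := one_le_pow₀ hlog1
  have h2 : (C : ℝ) * (A * Nat.log 2 n) ^ k + B ≤ Real.log n ^ k * c := by
    have h3 : (C : ℝ) * (A * Nat.log 2 n) ^ k ≤ C * (A * (2 * Real.log n)) ^ k := by gcongr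
    have h4 : (C : ℝ) * (A * (2 * Real.log n)) ^ k = C * (A * 2) ^ k * Real.log n ^ k := by
      rw [← mul_assoc, mul_pow]; ring
    have h5 : (B : ℝ) ≤ B * Real.log n ^ k := le_mul_of_one_le_right (Nat.cast_nonneg B) hpow
    rw [hc]
    nlinarith
  exact_mod_cast h2.trans hn

lemma eventually_mul_log_le (A : ℕ) : ∀ᶠ n : ℕ in atTop, A * Nat.log 2 n + 2 ≤ n := by
  have h : (fun n : ℕ => Real.log n ^ 1) =o[atTop] (fun n : ℕ => ((id n : ℕ) : ℝ)) := by
    simpa [Function.comp_def] using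
      Real.isLittleO_log_id_atTop.comp_tendsto tendsto_natCast_atTop_atTop
  simpa using eventually_log_pow_le h A 2 1

/-- Rounding down `log₂ n` loses less than a factor of two, hence the exponent `2 * A`. -/
lemma inv_two_pow_log_le {n : ℕ} (hn : 4 ≤ n) (A : ℕ) :
    ((2 : ℝ) ^ (2 * A * Nat.log 2 n))⁻¹ ≤ 1 / (n : ℝ) ^ A := by
  have hn0 : (0 : ℝ) < n := by positivity
  rw [one_div]
  refine inv_anti₀ (by positivity) ?_
  have h1 : n ≤ 2 ^ (2 * Nat.log 2 n) := by
    have h2 : n < 2 ^ (Nat.log 2 n + 1) := Nat.lt_pow_succ_log_self (by norm_num) n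
    have h3 : 1 ≤ Nat.log 2 n := Nat.log_pos (by norm_num) (by omega)
    exact h2.le.trans (Nat.pow_le_pow_right (by norm_num) (by omega))
  have h2 : n ^ A ≤ 2 ^ (2 * A * Nat.log 2 n) := by
    calc n ^ A ≤ (2 ^ (2 * Nat.log 2 n)) ^ A := Nat.pow_le_pow_left h1 A
      _ = 2 ^ (2 * A * Nat.log 2 n) := by rw [← pow_mul]; ring_nf
  exact_mod_cast h2

/-- With `M = 2 * A * Nat.log 2 n` the variance `2 ^ (-M)` is at most `n ^ (-A)`, and the depth `M`
is a constant multiple of `log n`. -/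
theorem sqHard_of_parityGate_mem {G : GateSet} (hG : ∀ s, parityGate s ∈ G.two) {d : ℕ → ℕ}
    (hd : (fun n : ℕ => Real.log n) =o[atTop] (fun n : ℕ => (d n : ℝ))) :
    SQHard (fun n => outputDistributions G n (d n)) := by
  refine sqHard_of_hardFamily (t := 1 / 2) (by norm_num) fun A => ?_
  filter_upwards [eventually_log_pow_le (k := 1) (by simpa using hd) (2 * A) 0 1,
    eventually_mul_log_le (2 * A), eventually_ge_atTop 4] with n h1 h2 h3
  exact ((hardFamily_parity hG (2 * A * Nat.log 2 n)).pad (by omega : _ + 1 ≤ n)).mono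
    (outputDistributions_mono (by simpa using h1)) (inv_two_pow_log_le h3 A)

theorem sqHard_cliffordGates {d : ℕ → ℕ}
    (hd : (fun n : ℕ => Real.log n) =o[atTop] (fun n : ℕ => (d n : ℝ))) :
    SQHard (fun n => outputDistributions cliffordGates n (d n)) :=
  sqHard_of_parityGate_mem (G := cliffordGates) (fun s => isClifford_parityGate s) hd

end ParityFamily

/-! ### Generating the unitary group by phases and plane rotations -/

section Elimination

variable {ι : Type*} [Fintype ι] [DecidableEq ι]

/-- The diagonal unitary that multiplies the basis vector `a` by `z`. -/
def phaseMat (a : ι) (z : Circle) : Matrix ι ι ℂ :=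
  Matrix.diagonal (Function.update 1 a (z : ℂ))

/-- The rotation in the plane of the basis vectors `a` and `c`. -/
def planeRot (a c : ι) (z : Circle) : Matrix ι ι ℂ := fun i j =>
  if i = a then (if j = a then ((z : ℂ).re : ℂ) else if j = c then (-(z : ℂ).im : ℂ) else 0)
  else if i = c then (if j = a then ((z : ℂ).im : ℂ) else if j = c then ((z : ℂ).re : ℂ) else 0)
  else if i = j then 1 else 0

lemma phaseMat_mul (a : ι) (z w : Circle) : phaseMat a (z * w) = phaseMat a z * phaseMat a w := by
  rw [phaseMat, phaseMat, phaseMat, Matrix.diagonal_mul_diagonal]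
  congr 1
  funext i
  by_cases h : i = a
  · subst h; simp
  · simp [h]

lemma phaseMat_one (a : ι) : phaseMat a 1 = 1 := by
  simp [phaseMat]

lemma phaseMat_conjTranspose (a : ι) (z : Circle) : (phaseMat a z)ᴴ = phaseMat a z⁻¹ := by
  rw [phaseMat, phaseMat, Matrix.diagonal_conjTranspose]
  congr 1
  funext i
  by_cases h : i = a
  · subst h
    simpa using (Circle.coe_inv_eq_conj z).symm
  · simp [h]

lemma phaseMat_mulVec (a : ι) (z : Circle) (v : ι → ℂ) :
    phaseMat a z *ᵥ v = Function.update v a (z * v a) := by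
  funext i
  rw [phaseMat, Matrix.mulVec_diagonal]
  by_cases h : i = a
  · subst h; simp
  · simp [h]

lemma planeRot_mulVec {a c : ι} (hac : a ≠ c) (z : Circle) (v : ι → ℂ) (i : ι) :
    (planeRot a c z *ᵥ v) i = if i = a then (z : ℂ).re * v a - (z : ℂ).im * v c
      else if i = c then (z : ℂ).im * v a + (z : ℂ).re * v c else v i := by
  simp only [Matrix.mulVec, dotProduct, planeRot]
  split_ifs with h1 h2
  · rw [Finset.sum_eq_add a c hac]
    · simp [hac.symm]; ring
    · intro j _ hj; simp [hj.1, hj.2]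
    · simp
    · simp
  · rw [Finset.sum_eq_add a c hac]
    · simp [hac.symm]
    · intro j _ hj; simp [hj.1, hj.2]
    · simp
    · simp
  · simp

lemma planeRot_one (a c : ι) (hac : a ≠ c) : planeRot a c 1 = 1 := by
  ext i j
  simp only [planeRot, Matrix.one_apply, Circle.coe_one, Complex.one_re, Complex.one_im]
  split_ifs <;> simp_all

lemma planeRot_mul {a c : ι} (hac : a ≠ c) (z w : Circle) :
    planeRot a c (z * w) = planeRot a c z * planeRot a c w := by
  ext i j
  have : (planeRot a c z * planeRot a c w) i j =
      (planeRot a c z *ᵥ fun k => planeRot a c w k j) i := rfl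
  rw [this, planeRot_mulVec hac]
  simp only [planeRot, Circle.coe_mul, Complex.mul_re, Complex.mul_im, if_true, hac.symm, if_false]
  split_ifs <;> push_cast <;> ring

lemma planeRot_conjTranspose {a c : ι} (hac : a ≠ c) (z : Circle) :
    (planeRot a c z)ᴴ = planeRot a c z⁻¹ := by
  ext i j
  have e : (j = i) = (i = j) := propext eq_comm
  simp only [Matrix.conjTranspose_apply, planeRot, Circle.coe_inv_eq_conj, Complex.conj_re,
    Complex.conj_im, e]
  by_cases h1 : i = a <;> by_cases h2 : i = c <;> by_cases h3 : j = a <;> by_cases h4 : j = c <;>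
    by_cases h5 : i = j <;> (subst_vars; first | contradiction | simp [*])

lemma phaseMat_mem (a : ι) (z : Circle) : phaseMat a z ∈ Matrix.unitaryGroup ι ℂ := by
  rw [Matrix.mem_unitaryGroup_iff, Matrix.star_eq_conjTranspose, phaseMat_conjTranspose,
    ← phaseMat_mul, mul_inv_cancel, phaseMat_one]

lemma planeRot_mem {a c : ι} (hac : a ≠ c) (z : Circle) :
    planeRot a c z ∈ Matrix.unitaryGroup ι ℂ := by
  rw [Matrix.mem_unitaryGroup_iff, Matrix.star_eq_conjTranspose, planeRot_conjTranspose hac,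
    ← planeRot_mul hac, mul_inv_cancel, planeRot_one a c hac]

lemma continuous_phaseMat (a : ι) : Continuous (phaseMat a) := by
  refine Continuous.matrix_diagonal (continuous_pi fun i => ?_)
  by_cases h : i = a
  · subst h; simp only [Function.update_self]; fun_prop
  · simpa [h] using continuous_const

lemma continuous_planeRot (a c : ι) : Continuous (planeRot a c) := by
  have h1 : Continuous fun z : Circle => (((z : ℂ).re : ℝ) : ℂ) := by fun_prop
  have h2 : Continuous fun z : Circle => (((z : ℂ).im : ℝ) : ℂ) := by fun_prop
  refine continuous_matrix fun i j => ?_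
  unfold planeRot
  split_ifs
  · exact h1
  · exact h2.neg
  · exact continuous_const
  · exact h2
  · exact h1
  · exact continuous_const
  · exact continuous_const
  · exact continuous_const

lemma exists_circle_mul_eq_norm (u : ℂ) : ∃ z : Circle, (z : ℂ) * u = ‖u‖ := by
  refine ⟨(Circle.exp (Complex.arg u))⁻¹, ?_⟩
  rw [Circle.coe_inv, Circle.coe_exp, inv_mul_eq_iff_eq_mul₀ (Complex.exp_ne_zero _), mul_comm,
    Complex.norm_mul_exp_arg_mul_I]

/-- The submonoid of the elements of `H` whose adjoint is also in `H`. -/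
def starCore (H : Submonoid (Matrix ι ι ℂ)) : Submonoid (Matrix ι ι ℂ) where
  carrier := {W | W ∈ H ∧ Wᴴ ∈ H ∧ W ∈ Matrix.unitaryGroup ι ℂ}
  mul_mem' := by
    rintro V W ⟨h1, h2, h3⟩ ⟨g1, g2, g3⟩
    refine ⟨mul_mem h1 g1, ?_, mul_mem h3 g3⟩
    rw [Matrix.conjTranspose_mul]
    exact mul_mem g2 h2
  one_mem' := ⟨one_mem _, by rw [Matrix.conjTranspose_one]; exact one_mem _, one_mem _⟩

/-- The submonoid `H` contains all phases and all plane rotations. -/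
structure HasRotations (H : Submonoid (Matrix ι ι ℂ)) : Prop where
  phase : ∀ a z, phaseMat a z ∈ H
  rot : ∀ a c, a ≠ c → ∀ z, planeRot a c z ∈ H

variable {H : Submonoid (Matrix ι ι ℂ)}

lemma HasRotations.phase_mem (hH : HasRotations H) (a : ι) (z : Circle) :
    phaseMat a z ∈ starCore H :=
  ⟨hH.phase a z, by rw [phaseMat_conjTranspose]; exact hH.phase a _, phaseMat_mem a z⟩

lemma HasRotations.rot_mem (hH : HasRotations H) {a c : ι} (hac : a ≠ c) (z : Circle) :
    planeRot a c z ∈ starCore H :=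
  ⟨hH.rot a c hac z, by rw [planeRot_conjTranspose hac]; exact hH.rot a c hac _,
    planeRot_mem hac z⟩

/-- Givens elimination: for each `c ∈ S` two phases make the entries at `b` and `c` nonnegative, and
a rotation in their plane clears the entry at `c`. Only coordinates in `S` and `b` are touched, so
vectors vanishing there stay fixed; this protects columns already reduced. -/
lemma HasRotations.exists_mulVec_eq_single (hH : HasRotations H) (b : ι) (S : Finset ι)
    (hb : b ∉ S) (u : ι → ℂ) (hu : ∀ i, i ≠ b → i ∉ S → u i = 0) :
    ∃ W ∈ starCore H, (∃ r : ℝ, 0 ≤ r ∧ W *ᵥ u = Pi.single b (r : ℂ)) ∧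
      ∀ v : ι → ℂ, v b = 0 → (∀ i ∈ S, v i = 0) → W *ᵥ v = v := by
  induction S using Finset.induction_on generalizing u with
  | empty =>
    obtain ⟨z, hz⟩ := exists_circle_mul_eq_norm (u b)
    refine ⟨phaseMat b z, hH.phase_mem b z, ⟨‖u b‖, norm_nonneg _, ?_⟩, fun v hv _ => ?_⟩
    · rw [phaseMat_mulVec, hz]
      funext i
      by_cases h : i = b
      · subst h; simp
      · simp [h, hu i h]
    · rw [phaseMat_mulVec, hv, mul_zero, ← hv, Function.update_eq_self]
  | insert c S hc ih =>
    have hcb : c ≠ b := by rintro rfl; simp at hb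
    have hbS : b ∉ S := fun h => hb (Finset.mem_insert_of_mem h)
    obtain ⟨z₁, hz₁⟩ := exists_circle_mul_eq_norm (u b)
    obtain ⟨z₂, hz₂⟩ := exists_circle_mul_eq_norm (u c)
    -- Rotation by the argument of `w` sends the pair `(‖u b‖, ‖u c‖)` to one with vanishing second
    -- entry.
    set w : ℂ := ⟨‖u b‖, -‖u c‖⟩ with hw
    set u' := planeRot b c (Circle.exp (Complex.arg w)) *ᵥ (phaseMat c z₂ *ᵥ (phaseMat b z₁ *ᵥ u))
      with hu'
    have hu'v : ∀ i, u' i = if i = b then u' b else if i = c then 0 else u i := by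
      intro i
      split_ifs with h1 h2
      · rw [h1]
      · rw [hu', planeRot_mulVec hcb.symm, if_neg h1, if_pos h2, phaseMat_mulVec, phaseMat_mulVec]
        rw [Function.update_of_ne hcb.symm, Function.update_self, Function.update_self,
          Function.update_of_ne hcb, hz₁, hz₂, Circle.coe_exp, Complex.exp_ofReal_mul_I_re,
          Complex.exp_ofReal_mul_I_im]
        have e1 := Complex.norm_mul_cos_arg w
        have e2 := Complex.norm_mul_sin_arg w
        have e3 : ‖u b‖ = ‖w‖ * Real.cos (Complex.arg w) := by rw [e1]
        have e4 : ‖u c‖ = -(‖w‖ * Real.sin (Complex.arg w)) := by rw [e2]; simp [hw]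
        rw [e3, e4]
        push_cast; ring
      · rw [hu', planeRot_mulVec hcb.symm, if_neg h1, if_neg h2, phaseMat_mulVec, phaseMat_mulVec,
          Function.update_of_ne h2, Function.update_of_ne h1]
    obtain ⟨W, hW, ⟨r, hr, hWu⟩, hfix⟩ := ih hbS u' fun i hib hiS => by
      rw [hu'v, if_neg hib]
      split_ifs with h
      · rfl
      · exact hu i hib (by simp [h, hiS])
    refine ⟨W * (planeRot b c (Circle.exp (Complex.arg w)) * (phaseMat c z₂ * phaseMat b z₁)),
      mul_mem hW (mul_mem (hH.rot_mem hcb.symm _) (mul_mem (hH.phase_mem _ _) (hH.phase_mem _ _))),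
      ⟨r, hr, ?_⟩, fun v hv hvS => ?_⟩
    · rw [← hWu, hu']
      simp only [Matrix.mulVec_mulVec]
    · have hvc : v c = 0 := hvS c (by simp)
      simp only [← Matrix.mulVec_mulVec]
      have h1 : phaseMat b z₁ *ᵥ v = v := by
        rw [phaseMat_mulVec, hv, mul_zero, ← hv, Function.update_eq_self]
      have h2 : phaseMat c z₂ *ᵥ v = v := by
        rw [phaseMat_mulVec, hvc, mul_zero, ← hvc, Function.update_eq_self]
      have h3 : planeRot b c (Circle.exp (Complex.arg w)) *ᵥ v = v := by
        funext i
        rw [planeRot_mulVec hcb.symm, hv, hvc]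
        split_ifs with g1 g2
        · simp [g1, hv]
        · simp [g2, hvc]
        · rfl
      rw [h1, h2, h3]
      exact hfix v hv fun i hi => hvS i (Finset.mem_insert_of_mem hi)

/-- Phases and plane rotations generate the unitary group. -/
theorem HasRotations.unitary_mem (hH : HasRotations H) {U : Matrix ι ι ℂ}
    (hU : U ∈ Matrix.unitaryGroup ι ℂ) : U ∈ H := by
  have key : ∀ T : Finset ι, ∃ W ∈ starCore H,
      ∀ k ∈ T, (W * U) *ᵥ Pi.single k 1 = Pi.single k 1 := by
    intro T
    induction T using Finset.induction_on with
    | empty => exact ⟨1, one_mem _, by simp⟩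
    | insert b T hb ih =>
      obtain ⟨W, hW, hWT⟩ := ih
      have hWU : W * U ∈ Matrix.unitaryGroup ι ℂ := mul_mem hW.2.2 hU
      set u := (W * U) *ᵥ Pi.single b 1 with hu
      -- The columns of a unitary are orthogonal and those in `T` are already basis vectors, so the
      -- new column has no entries there.
      have hdot : ∀ k ∈ T, u k = 0 := by
        intro k hk
        have h1 : star ((W * U) *ᵥ Pi.single k 1) ⬝ᵥ u = 0 := by
          rw [hu, Matrix.star_mulVec, ← Matrix.dotProduct_mulVec, Matrix.mulVec_mulVec]
          have : (W * U)ᴴ * (W * U) = 1 := Matrix.mem_unitaryGroup_iff'.1 hWU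
          rw [this, Matrix.one_mulVec]
          have hkb : k ≠ b := fun h => hb (h ▸ hk)
          simp [hkb.symm, Pi.single_apply, dotProduct]
        rw [hWT k hk] at h1
        simpa [dotProduct, Pi.single_apply] using h1
      obtain ⟨V, hV, ⟨r, hr, hVu⟩, hfix⟩ := hH.exists_mulVec_eq_single b
        ((Finset.univ \ T).erase b) (by simp) u (fun i h1 h2 => hdot i (by
          by_contra h3; exact h2 (by simp [h1, h3])))
      refine ⟨V * W, mul_mem hV hW, fun k hk => ?_⟩
      rw [Matrix.mul_assoc, ← Matrix.mulVec_mulVec]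
      rcases Finset.mem_insert.1 hk with rfl | hk
      · rw [← hu, hVu]
        have hcol := sum_norm_sq_col (mul_mem hV.2.2 hWU) k
        have h2 : ∀ a, (V * (W * U)) a k = Pi.single (M := fun _ => ℂ) k (r : ℂ) a := by
          intro a
          rw [← hVu, hu, Matrix.mulVec_mulVec, Matrix.mulVec_single_one]
          rfl
        simp only [h2] at hcol
        rw [Finset.sum_eq_single k (fun a _ ha => by simp [ha]) (by simp)] at hcol
        simp only [Pi.single_eq_same, Complex.norm_real, Real.norm_of_nonneg hr] at hcol
        have : r = 1 := by nlinarith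
        rw [this]; simp
      · rw [hWT k hk]
        have hkb : b ≠ k := fun h => hb (h ▸ hk)
        refine hfix _ (by simp [hkb]) fun i hi => ?_
        have : i ∉ T := by
          have := (Finset.mem_erase.1 hi).2
          simpa using this
        have : i ≠ k := fun h => this (h ▸ hk)
        simp [this]
  obtain ⟨W, hW, hWU⟩ := key Finset.univ
  have h1 : W * U = 1 := by
    ext i k
    have := congrFun (hWU k (Finset.mem_univ k)) i
    rw [Matrix.mulVec_single_one] at this
    simpa [Matrix.one_apply, Pi.single_apply] using this
  -- The elimination produces the inverse of `U`. Since `H` is only a monoid, `starCore` has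
  -- recorded that the adjoint also lies in `H`.
  have h2 : U = Wᴴ := by
    have : Wᴴ * W = 1 := Matrix.mem_unitaryGroup_iff'.1 hW.2.2
    calc U = (Wᴴ * W) * U := by rw [this, Matrix.one_mul]
      _ = Wᴴ := by rw [Matrix.mul_assoc, h1, Matrix.mul_one]
  rw [h2]
  exact hW.2.1

lemma hasRotations_unitary : HasRotations (Matrix.unitaryGroup ι ℂ) :=
  ⟨phaseMat_mem, fun _ _ h z => planeRot_mem h z⟩

/-- Some unitary maps `u` to a nonnegative multiple of the basis vector `b`. -/
lemma exists_unitary_mulVec_eq_single (b : ι) (u : ι → ℂ) :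
    ∃ W ∈ Matrix.unitaryGroup ι ℂ, ∃ r : ℝ, 0 ≤ r ∧ W *ᵥ u = Pi.single b (r : ℂ) := by
  obtain ⟨W, hW, h, -⟩ := hasRotations_unitary.exists_mulVec_eq_single b (Finset.univ.erase b)
    (by simp) u (fun i h1 h2 => absurd (by simp [h1]) h2)
  exact ⟨W, hW.2.2, h⟩

end Elimination

/-! ### A finite universal gate set -/

section FiniteGateSet

/-- Since `π` is irrational, the multiples of `1` are dense modulo `2π`, and nonnegative multiples
already suffice. -/
lemma denseRange_circle_exp_one_pow : DenseRange fun k : ℕ => Circle.exp 1 ^ k := by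
  have hirr : Irrational (1 / (2 * Real.pi)) := by
    rw [one_div, irrational_inv_iff]
    simpa using irrational_pi.ratCast_mul (q := 2) (by norm_num)
  have : Fact (0 < 2 * Real.pi) := ⟨Real.two_pi_pos⟩
  have h1 : DenseRange (fun k : ℕ => k • ((1 : ℝ) : AddCircle (2 * Real.pi))) :=
    denseRange_zsmul_iff_nsmul.1 (AddCircle.denseRange_zsmul_coe_iff.2 hirr)
  have hs : Function.Surjective (Real.Angle.toCircle) := fun z =>
    ⟨((Complex.arg z : ℝ) : Real.Angle), by rw [Real.Angle.toCircle_coe, Circle.exp_arg]⟩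
  have hc : Continuous Real.Angle.toCircle :=
    continuous_quot_lift _ Circle.exp.continuous
  have h2 := hs.denseRange.comp h1 hc
  refine h2.mono (Set.range_subset_iff.2 fun k => ⟨k, ?_⟩)
  have : ∀ k : ℕ, Real.Angle.toCircle (k • ((1 : ℝ) : Real.Angle)) = Circle.exp 1 ^ k := by
    intro k
    induction k with
    | zero => simp
    | succ k ih => rw [succ_nsmul, Real.Angle.toCircle_add, ih, pow_succ, Real.Angle.toCircle_coe]
  exact (this k).symm

lemma mem_of_circle_exp_one_mem {X : Type*} [Monoid X] [TopologicalSpace X] {f : Circle → X}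
    (hf : Continuous f) (h1 : f 1 = 1) (hmul : ∀ z w, f (z * w) = f z * f w) {C : Submonoid X}
    (hC : IsClosed (C : Set X)) (h : f (Circle.exp 1) ∈ C) (z : Circle) : f z ∈ C := by
  have hpow : ∀ k : ℕ, f (Circle.exp 1 ^ k) ∈ C := by
    intro k
    induction k with
    | zero => rw [pow_zero, h1]; exact one_mem _
    | succ k ih => rw [pow_succ, hmul]; exact mul_mem ih h
  have : Set.univ ⊆ f ⁻¹' (C : Set X) := by
    rw [← denseRange_circle_exp_one_pow.closure_range]
    exact closure_minimal (Set.range_subset_iff.2 hpow) (hC.preimage hf)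
  exact this (Set.mem_univ z)

/-- A finite universal gate set. -/
def finiteGates : GateSet where
  one := ∅
  two := Set.range parityGate ∪
    (Set.range fun a : BitString 2 =>
      (⟨phaseMat a (Circle.exp 1), phaseMat_mem _ _⟩ : Matrix.unitaryGroup (BitString 2) ℂ)) ∪
    (Set.range fun p : {p : BitString 2 × BitString 2 // p.1 ≠ p.2} =>
      (⟨planeRot p.1.1 p.1.2 (Circle.exp 1), planeRot_mem p.2 _⟩ :
        Matrix.unitaryGroup (BitString 2) ℂ))

lemma finiteGates_two_finite : finiteGates.two.Finite :=
  ((Set.finite_range _).union (Set.finite_range _)).union (Set.finite_range _)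

/-- The monoid of the operators realized by circuits. -/
def circuitMonoid (G : GateSet) (n : ℕ) : Submonoid (Op n) where
  carrier := {V | ∃ d, IsCircuit G n d V}
  mul_mem' := by
    rintro V W ⟨d, h⟩ ⟨d', h'⟩
    exact ⟨d + d', h.mul h'⟩
  one_mem' := ⟨0, rfl⟩

/-- The closure of the circuits is a closed monoid. It contains the element of angle `1` of each
phase and rotation subgroup, hence the whole subgroups, hence all unitaries. -/
lemma finiteGates_universal : finiteGates.Universal := by
  intro U hU η hη
  set C := (circuitMonoid finiteGates 2).topologicalClosure with hC
  have hclosed : IsClosed (C : Set (Op 2)) := Submonoid.isClosed_topologicalClosure _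
  have hle := Submonoid.le_topologicalClosure (circuitMonoid finiteGates 2)
  have hrot : HasRotations C := by
    refine ⟨fun a => ?_, fun a c hac => ?_⟩
    · refine mem_of_circle_exp_one_mem (continuous_phaseMat a) (phaseMat_one a) (phaseMat_mul a)
        hclosed (hle ?_)
      have : (⟨phaseMat a (Circle.exp 1), phaseMat_mem _ _⟩ : Matrix.unitaryGroup (BitString 2) ℂ)
        ∈ finiteGates.two := Or.inl (Or.inr ⟨a, rfl⟩)
      exact ⟨1, isCircuit_of_two_mem this⟩
    · refine mem_of_circle_exp_one_mem (continuous_planeRot a c) (planeRot_one a c hac)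
        (planeRot_mul hac) hclosed (hle ?_)
      have : (⟨planeRot a c (Circle.exp 1), planeRot_mem hac _⟩ :
        Matrix.unitaryGroup (BitString 2) ℂ) ∈ finiteGates.two := Or.inr ⟨⟨(a, c), hac⟩, rfl⟩
      exact ⟨1, isCircuit_of_two_mem this⟩
  have hmem : U ∈ closure ((circuitMonoid finiteGates 2 : Submonoid (Op 2)) : Set (Op 2)) :=
    hrot.unitary_mem hU
  have hopen : IsOpen {V : Op 2 | ∀ a b, ‖V a b - U a b‖ < η} := by
    simp only [Set.ofPred_forall]
    refine isOpen_iInter_of_finite fun a => isOpen_iInter_of_finite fun b => ?_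
    exact isOpen_lt (by fun_prop) continuous_const
  obtain ⟨V, hV, d, hd⟩ := mem_closure_iff.1 hmem _ hopen (by intro a b; simpa using hη)
  exact ⟨d, V, 1, hd, by simp, by simpa using hV⟩

/-- The parity gates belong to the gate set, so depth superlinear in `log n` is enough, and `log n ≤
log n ^ 2` for `n ≥ 3`. -/
theorem sqHard_finiteGates {d : ℕ → ℕ}
    (hd : (fun n : ℕ => Real.log n ^ 2) =o[atTop] (fun n : ℕ => (d n : ℝ))) :
    SQHard (fun n => outputDistributions finiteGates n (d n)) := by
  refine sqHard_of_parityGate_mem (G := finiteGates) (fun s => Or.inl (Or.inl ⟨s, rfl⟩)) ?_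
  refine IsBigO.trans_isLittleO ?_ hd
  refine IsBigO.of_bound 1 ?_
  filter_upwards [eventually_ge_atTop 3] with n hn
  have hn3' : (3 : ℝ) ≤ n := by exact_mod_cast hn
  have hlog1 : 1 ≤ Real.log n := by
    rw [Real.le_log_iff_exp_le (by linarith)]
    linarith [Real.exp_one_lt_d9]
  rw [Real.norm_of_nonneg (by positivity), Real.norm_of_nonneg (by positivity)]
  nlinarith

end FiniteGateSet

/-! ### Averages of isometries -/

section Averages

open scoped InnerProductSpace

variable {E : Type*} [NormedAddCommGroup E] [InnerProductSpace ℂ E]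

/-- Equality case of the triangle inequality, from the parallelogram law. -/
lemma eq_of_norm_add_ge {v w : E} (hw : ‖w‖ = ‖v‖) (h : 2 * ‖v‖ ≤ ‖v + w‖) : v = w := by
  have h1 := parallelogram_law_with_norm ℂ v w
  have h2 : 0 ≤ ‖v‖ := norm_nonneg v
  have h3 : ‖v - w‖ * ‖v - w‖ ≤ 0 := by
    rw [hw] at h1
    nlinarith [mul_self_le_mul_self (by positivity) h]
  have h4 : ‖v - w‖ = 0 := by nlinarith [norm_nonneg (v - w)]
  exact sub_eq_zero.1 (norm_eq_zero.1 h4)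

variable {J : Type*}

/-- The vectors fixed by all operators of a family. -/
def commonFixed (A : J → E →L[ℂ] E) : Submodule ℂ E where
  carrier := {v | ∀ j, A j v = v}
  add_mem' := by intro v w hv hw j; rw [map_add, hv j, hw j]
  zero_mem' := by intro j; simp
  smul_mem' := by intro c v hv j; rw [map_smul, hv j]

/-- The average of the operators with indices in a finite set. -/
def averageOp (A : J → E →L[ℂ] E) (s : Finset J) : E →L[ℂ] E :=
  ((s.card : ℂ)⁻¹) • ∑ j ∈ s, A j

/-- Since the identity takes part in the average, `v` itself is a summand. If nothing is lost in
norm, nothing is lost in `v + A j v` either, which forces `A j v = v`. The identity excludes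
eigenvalues of modulus one other than `1`. -/
lemma fixed_of_norm_averageOp_ge {A : J → E →L[ℂ] E} (hA : ∀ j v, ‖A j v‖ = ‖v‖) {s : Finset J}
    {j₀ : J} (hj₀ : j₀ ∈ s) (h1 : A j₀ = 1) {v : E} (hv : ‖v‖ ≤ ‖averageOp A s v‖) :
    ∀ j ∈ s, A j v = v := by
  classical
  intro j hj
  by_cases hjj : j = j₀
  · rw [hjj, h1]; rfl
  have hc : (0 : ℝ) < s.card := by exact_mod_cast Finset.card_pos.2 ⟨j, hj⟩
  have hsum : (s.card : ℝ) * ‖v‖ ≤ ‖∑ i ∈ s, A i v‖ := by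
    simp only [averageOp, _root_.smul_apply, _root_.sum_apply, norm_smul,
      norm_inv, Complex.norm_natCast] at hv
    rwa [← div_eq_inv_mul, le_div_iff₀ hc, mul_comm] at hv
  have hsplit : ∑ i ∈ s, A i v = (v + A j v) + ∑ i ∈ (s.erase j₀).erase j, A i v := by
    rw [← Finset.add_sum_erase s (fun i => A i v) hj₀,
      ← Finset.add_sum_erase (s.erase j₀) (fun i => A i v) (Finset.mem_erase.2 ⟨hjj, hj⟩), h1,
      add_assoc]
    rfl
  have hcard : (((s.erase j₀).erase j).card : ℝ) = s.card - 2 := by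
    have h2 : 2 ≤ s.card := by
      have := Finset.card_le_card (s := {j₀, j}) (t := s) (by
        intro x; simp only [Finset.mem_insert, Finset.mem_singleton]
        rintro (rfl | rfl) <;> assumption)
      rwa [Finset.card_pair (Ne.symm hjj)] at this
    rw [Finset.card_erase_of_mem (Finset.mem_erase.2 ⟨hjj, hj⟩), Finset.card_erase_of_mem hj₀,
      Nat.sub_sub, Nat.cast_sub h2]
    norm_num
  have hrest : ‖∑ i ∈ (s.erase j₀).erase j, A i v‖ ≤ (s.card - 2) * ‖v‖ := by
    refine (norm_sum_le _ _).trans ?_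
    simp only [hA, Finset.sum_const, nsmul_eq_mul, hcard]
    exact le_rfl
  refine (eq_of_norm_add_ge (hA j v) ?_).symm
  have := (hsum.trans (hsplit ▸ norm_add_le _ _)).trans (add_le_add_right hrest _)
  linarith

variable [FiniteDimensional ℂ E]

/-- In finite dimension an intersection of subspaces is attained by finitely many: a minimal fixed
space over finite index sets cannot shrink further. -/
lemma exists_finset_commonFixed (A : J → E →L[ℂ] E) (j₀ : J) :
    ∃ s : Finset J, j₀ ∈ s ∧ ∀ v, (∀ j ∈ s, A j v = v) → v ∈ commonFixed A := by
  classical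
  let F : Finset J → Submodule ℂ E := fun s => commonFixed (fun j : s => A j)
  obtain ⟨_, ⟨s, rfl⟩, hs⟩ := (wellFounded_lt (α := Submodule ℂ E)).has_min (Set.range F)
    ⟨_, ∅, rfl⟩
  refine ⟨insert j₀ s, Finset.mem_insert_self _ _, fun v hv j => ?_⟩
  have hle : F (insert j s) ≤ F s := fun w hw i => hw ⟨i.1, Finset.mem_insert_of_mem i.2⟩
  have heq : F (insert j s) = F s := by
    by_contra hne
    exact hs _ ⟨_, rfl⟩ (lt_of_le_of_ne hle hne)
  have : v ∈ F (insert j s) := by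
    rw [heq]
    exact fun i => hv i.1 (Finset.mem_insert_of_mem i.2)
  exact this ⟨j, Finset.mem_insert_self _ _⟩

/-- Powers of an average of finitely many isometries converge exponentially to the projection onto
the common fixed vectors. -/
lemma exists_average_pow_tendsto [Nontrivial E] (A : J → E →L[ℂ] E)
    (hA : ∀ j u v, ⟪A j u, A j v⟫_ℂ = ⟪u, v⟫_ℂ) (j₀ : J) (h1 : A j₀ = 1) :
    ∃ (s : Finset J) (r : ℝ), s.Nonempty ∧ 0 ≤ r ∧ r < 1 ∧
      ∀ L : ℕ, ‖averageOp A s ^ (L + 1) - (commonFixed A).starProjection‖ ≤ r ^ (L + 1) := by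
  obtain ⟨s, hj₀, hs⟩ := exists_finset_commonFixed A j₀
  set F := commonFixed A with hF
  set T := averageOp A s with hT
  set P := F.starProjection with hP
  have hnorm : ∀ j v, ‖A j v‖ = ‖v‖ := fun j v => by
    rw [@norm_eq_sqrt_re_inner ℂ, @norm_eq_sqrt_re_inner ℂ, hA]
  have hc : (s.card : ℂ) ≠ 0 := by
    exact_mod_cast (Finset.card_pos.2 ⟨j₀, hj₀⟩).ne'
  have hTv : ∀ v, T v = (s.card : ℂ)⁻¹ • ∑ j ∈ s, A j v := fun v => by
    simp [hT, averageOp]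
  have hTF : ∀ v ∈ F, T v = v := by
    intro v hv
    rw [hTv, Finset.sum_congr rfl fun j _ => hv j, Finset.sum_const, ← Nat.cast_smul_eq_nsmul ℂ,
      smul_smul, inv_mul_cancel₀ hc, one_smul]
  have hTn : ∀ v, ‖T v‖ ≤ ‖v‖ := by
    intro v
    rw [hTv, norm_smul, norm_inv, Complex.norm_natCast, ← div_eq_inv_mul,
      div_le_iff₀ (by exact_mod_cast Finset.card_pos.2 ⟨j₀, hj₀⟩)]
    refine (norm_sum_le _ _).trans ?_
    simp only [hnorm, Finset.sum_const, nsmul_eq_mul]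
    rw [mul_comm]
  have hTP : T * P = P := by
    ext v; exact hTF _ (Submodule.starProjection_apply_mem _ _)
  -- For `w` in `F`, `⟪w, A j v⟫ = ⟪A j w, A j v⟫ = ⟪w, v⟫`, so averaging changes `v` only by a
  -- vector orthogonal to `F`.
  have hPT : P * T = P := by
    ext v
    change P (T v) = P v
    rw [← sub_eq_zero, ← map_sub, hP, Submodule.starProjection_apply_eq_zero_iff,
      Submodule.mem_orthogonal]
    intro w hw
    rw [inner_sub_right, hTv, inner_smul_right, inner_sum]
    have : ∀ j ∈ s, ⟪w, A j v⟫_ℂ = ⟪w, v⟫_ℂ := fun j _ => by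
      conv_lhs => rw [← hw j]
      exact hA j w v
    rw [Finset.sum_congr rfl this, Finset.sum_const, nsmul_eq_mul, ← mul_assoc,
      inv_mul_cancel₀ hc, one_mul, sub_self]
  have hPP : P * P = P := by
    ext v
    exact Submodule.starProjection_eq_self_iff.2 (Submodule.starProjection_apply_mem _ _)
  -- If no norm is lost, `u - P u` is fixed by the family and hence lies both in `F` and in its
  -- orthogonal complement; then it is zero. Compactness of the unit sphere turns strictness into a
  -- rate below `1`.
  have hlt : ∀ u, u ≠ 0 → ‖(T - P) u‖ < ‖u‖ := by
    intro u hu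
    have e1 : (T - P) u = T (u - P u) := by
      have : T (P u) = P u := congrArg (fun B => B u) hTP
      rw [map_sub, this]; rfl
    have e2 : ‖u - P u‖ ≤ ‖u‖ := by
      have h := Submodule.norm_sq_eq_add_norm_sq_starProjection u F
      rw [Submodule.starProjection_orthogonal_val] at h
      have h0 : 0 ≤ ‖u‖ := norm_nonneg u
      nlinarith [norm_nonneg (u - P u), sq_nonneg ‖P u‖]
    rw [e1]
    by_contra! hcon
    have e3 : ‖u - P u‖ ≤ ‖T (u - P u)‖ := e2.trans hcon
    have e4 : u - P u ∈ F := hs _ (fixed_of_norm_averageOp_ge hnorm hj₀ h1 e3)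
    have e5 : u - P u ∈ Fᗮ := Submodule.sub_starProjection_mem_orthogonal u
    have e6 : u - P u = 0 := by
      have := Submodule.inner_right_of_mem_orthogonal e4 e5
      exact inner_self_eq_zero.1 this
    rw [e6, map_zero, norm_zero] at hcon
    exact hu (norm_eq_zero.1 (le_antisymm hcon (norm_nonneg _)))
  obtain ⟨u, hu, hmax⟩ := (isCompact_sphere (0 : E) 1).exists_isMaxOn
    ((NormedSpace.sphere_nonempty (E := E)).2 zero_le_one)
    (f := fun u => ‖(T - P) u‖) (by fun_prop)
  have hu1 : ‖u‖ = 1 := by simpa using hu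
  refine ⟨s, ‖(T - P) u‖, ⟨j₀, hj₀⟩, norm_nonneg _, ?_, fun L => ?_⟩
  · rw [← hu1]
    exact hlt u (by rintro rfl; simp at hu1)
  · have hle : ‖T - P‖ ≤ ‖(T - P) u‖ := by
      refine ContinuousLinearMap.opNorm_le_of_unit_norm (norm_nonneg _) fun v hv => ?_
      exact hmax (by simpa using hv)
    -- This uses `T * P = P * T = P * P = P`; the exponent must be positive, as the identity fails
    -- at exponent zero unless `P = 0`.
    have hpow : T ^ (L + 1) - P = (T - P) ^ (L + 1) := by
      induction L with
      | zero => simp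
      | succ L ih =>
        have hTLP : ∀ k : ℕ, T ^ k * P = P := by
          intro k
          induction k with
          | zero => simp
          | succ k ih => rw [pow_succ, mul_assoc, hTP, ih]
        rw [pow_succ (T - P), ← ih, sub_mul, mul_sub, mul_sub, hTLP, hPT, hPP, ← pow_succ]
        simp
    rw [hpow]
    exact (norm_pow_le _ _).trans (pow_le_pow_left₀ (norm_nonneg _) hle _)

end Averages

/-! ### Second moments of gates -/

section Moments

variable {ι : Type*} [Fintype ι] [DecidableEq ι]

/-- The four tensor legs carry alternately an operator and its complex conjugate. -/
def legHom (s : Fin 4) : ℂ →+* ℂ := if s = 0 ∨ s = 2 then RingHom.id ℂ else starRingEnd ℂ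

lemma legHom_zero (z : ℂ) : legHom 0 z = z := by simp [legHom]
lemma legHom_one (z : ℂ) : legHom 1 z = star z := by simp [legHom]
lemma legHom_two (z : ℂ) : legHom 2 z = z := by simp [legHom]
lemma legHom_three (z : ℂ) : legHom 3 z = star z := by
  simp [legHom]

lemma legHom_star (s : Fin 4) (z : ℂ) : legHom s (star z) = star (legHom s z) := by
  unfold legHom; split_ifs <;> simp

lemma norm_legHom (s : Fin 4) (z : ℂ) : ‖legHom s z‖ = ‖z‖ := by
  unfold legHom; split_ifs <;> simp

lemma continuous_legHom (s : Fin 4) : Continuous (legHom s) := by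
  unfold legHom
  split_ifs
  · exact continuous_id
  · exact Complex.continuous_conj

/-- The second moment operator `g ⊗ ḡ ⊗ g ⊗ ḡ`. -/
def moment (g : Matrix ι ι ℂ) : Matrix (Fin 4 → ι) (Fin 4 → ι) ℂ :=
  fun X Y => ∏ s, legHom s (g (X s) (Y s))

/-- The second moment tensor `ψ ⊗ ψ̄ ⊗ ψ ⊗ ψ̄` of a vector. -/
def vecMoment (ψ : ι → ℂ) : (Fin 4 → ι) → ℂ := fun X => ∏ s, legHom s (ψ (X s))

lemma prod_sum_legs {β : Type*} [Fintype β] [DecidableEq β] (f : Fin 4 → β → ℂ) :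
    ∏ s, ∑ b, f s b = ∑ Y : Fin 4 → β, ∏ s, f s (Y s) := by
  have := Finset.prod_univ_sum (fun _ : Fin 4 => (Finset.univ : Finset β)) f
  rwa [Fintype.piFinset_univ] at this

lemma moment_mul (g h : Matrix ι ι ℂ) : moment (g * h) = moment g * moment h := by
  ext X Y
  simp only [moment, Matrix.mul_apply, map_sum, map_mul]
  rw [prod_sum_legs (fun s b => legHom s (g (X s) b) * legHom s (h b (Y s)))]
  simp only [Finset.prod_mul_distrib]

lemma moment_one : moment (1 : Matrix ι ι ℂ) = 1 := by
  ext X Y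
  simp only [moment, Matrix.one_apply]
  by_cases h : X = Y
  · subst h; simp
  · rw [if_neg h]
    obtain ⟨s, hs⟩ := Function.ne_iff.1 h
    exact Finset.prod_eq_zero (Finset.mem_univ s) (by simp [hs])

lemma moment_conjTranspose (g : Matrix ι ι ℂ) : moment gᴴ = (moment g)ᴴ := by
  ext X Y
  simp only [moment, Matrix.conjTranspose_apply, legHom_star, star_prod]

/-- Two factors `z` meet two factors `z̄`. Hence approximation up to a global phase is good enough
for second moments. -/
lemma moment_smul {z : ℂ} (hz : ‖z‖ = 1) (g : Matrix ι ι ℂ) : moment (z • g) = moment g := by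
  ext X Y
  simp only [moment, Matrix.smul_apply, smul_eq_mul, map_mul, Finset.prod_mul_distrib]
  have : ∏ s : Fin 4, legHom s z = 1 := by
    rw [Fin.prod_univ_four, legHom_zero, legHom_one, legHom_two, legHom_three]
    have h : z * star z = 1 := by
      have := Complex.mul_conj' z
      rw [hz] at this
      simpa using this
    rw [h, one_mul, h]
  rw [this, one_mul]

lemma continuous_moment : Continuous (moment : Matrix ι ι ℂ → _) := by
  refine continuous_matrix fun X Y => continuous_finsetProd _ fun s _ => ?_
  exact (continuous_legHom s).comp (by fun_prop)

lemma moment_mem {U : Matrix ι ι ℂ} (hU : U ∈ Matrix.unitaryGroup ι ℂ) :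
    moment U ∈ Matrix.unitaryGroup (Fin 4 → ι) ℂ := by
  rw [Matrix.mem_unitaryGroup_iff, Matrix.star_eq_conjTranspose] at hU ⊢
  rw [← moment_conjTranspose, ← moment_mul, hU, moment_one]

end Moments

/-! ### Second moments over a universal gate set. -/

section UniversalMoments

open scoped InnerProductSpace Topology

lemma GateSet.Universal.exists_tendsto {G : GateSet} (hG : G.Universal) {U : Op 2}
    (hU : U ∈ Matrix.unitaryGroup (BitString 2) ℂ) :
    ∃ g : ℕ → Op 2, Tendsto g atTop (𝓝 U) ∧
      ∀ k, ∃ (z : ℂ) (V : Op 2), ‖z‖ = 1 ∧ V ∈ circuitMonoid G 2 ∧ g k = z • V := by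
  choose d V z hV hz hVU using fun k : ℕ => hG U hU (1 / ((k : ℝ) + 1)) (by positivity)
  refine ⟨fun k => star (z k) • V k, ?_, fun k => ⟨_, _, by simp [hz], ⟨d k, hV k⟩, rfl⟩⟩
  refine tendsto_pi_nhds.2 fun a => tendsto_pi_nhds.2 fun b => ?_
  rw [tendsto_iff_norm_sub_tendsto_zero]
  refine squeeze_zero (fun _ => norm_nonneg _) (fun k => ?_)
    tendsto_one_div_add_atTop_nhds_zero_nat
  have h1 : star (z k) * z k = 1 := by
    have := Complex.conj_mul' (z k)
    rw [hz] at this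
    simpa using this
  have h2 : (star (z k) • V k) a b - U a b = star (z k) * (V k a b - z k * U a b) := by
    rw [mul_sub, ← mul_assoc, h1, one_mul]; rfl
  rw [h2, norm_mul, norm_star, hz, one_mul]
  exact (hVU k a b).le

/-- Fixing `v` is a closed condition insensitive to global phases, so it passes from the circuits to
all unitaries. -/
lemma GateSet.Universal.moment_mulVec_eq {G : GateSet} (hG : G.Universal)
    {v : (Fin 4 → BitString 2) → ℂ} (hv : ∀ V ∈ circuitMonoid G 2, moment V *ᵥ v = v) {U : Op 2}
    (hU : U ∈ Matrix.unitaryGroup (BitString 2) ℂ) : moment U *ᵥ v = v := by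
  obtain ⟨g, hg, hgV⟩ := hG.exists_tendsto hU
  have hcl : IsClosed {W : Op 2 | moment W *ᵥ v = v} :=
    isClosed_eq (continuous_moment.matrix_mulVec continuous_const) continuous_const
  refine hcl.mem_of_tendsto hg (Eventually.of_forall fun k => ?_)
  obtain ⟨z, V, hz, hV, hk⟩ := hgV k
  rw [Set.mem_ofPred_eq, hk, moment_smul hz]
  exact hv V hV

lemma norm_apply_le_norm_toEuclideanCLM {n : Type*} [Fintype n] [DecidableEq n] (M : Matrix n n ℂ)
    (X Y : n) : ‖M X Y‖ ≤ ‖Matrix.toEuclideanCLM (n := n) (𝕜 := ℂ) M‖ := by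
  have h1 := (Matrix.toEuclideanCLM (n := n) (𝕜 := ℂ) M).le_opNorm (EuclideanSpace.single Y 1)
  rw [PiLp.norm_single, norm_one, mul_one] at h1
  refine le_trans ?_ h1
  refine le_trans (le_of_eq ?_) (PiLp.norm_apply_le _ X)
  rw [Matrix.ofLp_toEuclideanCLM]
  simp

/-- The average second moment of finitely many circuits over a universal gate set approaches
exponentially fast, under iteration, the projection onto the tensors that are invariant under all
unitaries. -/
theorem GateSet.Universal.exists_moment_average {G : GateSet} (hG : G.Universal) :
    ∃ (s : Finset (Op 2)) (d : ℕ) (P : Matrix (Fin 4 → BitString 2) (Fin 4 → BitString 2) ℂ)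
      (r : ℝ), s.Nonempty ∧ (∀ V ∈ s, IsCircuit G 2 d V) ∧ 0 ≤ r ∧ r < 1 ∧
      (∀ (L : ℕ) X Y, ‖(((s.card : ℂ)⁻¹ • ∑ V ∈ s, moment V) ^ (L + 1) - P) X Y‖ ≤ r ^ (L + 1)) ∧
      (∀ X Y, ‖P X Y‖ ≤ 1) ∧
      (∀ v, ∀ U ∈ Matrix.unitaryGroup (BitString 2) ℂ, moment U *ᵥ (P *ᵥ v) = P *ᵥ v) ∧
      (∀ w, (∀ U ∈ Matrix.unitaryGroup (BitString 2) ℂ, moment U *ᵥ w = w) →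
        ∀ v, star w ⬝ᵥ (P *ᵥ v) = star w ⬝ᵥ v) := by
  classical
  let κ := Fin 4 → BitString 2
  let Φ := Matrix.toEuclideanCLM (n := κ) (𝕜 := ℂ)
  let A : circuitMonoid G 2 → EuclideanSpace ℂ κ →L[ℂ] EuclideanSpace ℂ κ :=
    fun V => Φ (moment (V : Op 2))
  have hunit : ∀ V : circuitMonoid G 2, (V : Op 2) ∈ Matrix.unitaryGroup (BitString 2) ℂ :=
    fun V => V.2.choose_spec.mem_unitary
  have hA : ∀ j u v, ⟪A j u, A j v⟫_ℂ = ⟪u, v⟫_ℂ := by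
    intro j u v
    rw [← ContinuousLinearMap.adjoint_inner_right, ← ContinuousLinearMap.star_eq_adjoint,
      ← mul_apply_eq_comp, ← map_star, ← map_mul,
      Matrix.mem_unitaryGroup_iff'.1 (moment_mem (hunit j)), map_one]
    rfl
  obtain ⟨s, r, hs, hr0, hr1, hL⟩ := exists_average_pow_tendsto A hA 1 (by
    change Φ (moment ((1 : circuitMonoid G 2) : Op 2)) = 1
    rw [OneMemClass.coe_one, moment_one, map_one])
  set F := commonFixed A
  -- The vectors fixed by all circuits are the invariants of the full unitary group, so the limit
  -- projection does not depend on the gate set.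
  have hfix : ∀ v : κ → ℂ, WithLp.toLp 2 v ∈ F ↔
      ∀ U ∈ Matrix.unitaryGroup (BitString 2) ℂ, moment U *ᵥ v = v := by
    intro v
    constructor
    · intro hv U hU
      refine hG.moment_mulVec_eq (fun V hV => ?_) hU
      have := congrArg WithLp.ofLp (hv ⟨V, hV⟩)
      exact this
    · intro hv V
      have := hv V (hunit V)
      exact congrArg (WithLp.toLp 2) this
  let P : Matrix κ κ ℂ := Φ.symm F.starProjection
  have hP : Φ P = F.starProjection := Φ.apply_symm_apply _
  have hPv : ∀ v : κ → ℂ, WithLp.toLp 2 (P *ᵥ v) = F.starProjection (WithLp.toLp 2 v) := by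
    intro v; rw [← hP]; rfl
  choose dep hdep using fun V : circuitMonoid G 2 => V.2
  have hinj : Function.Injective (Subtype.val : circuitMonoid G 2 → Op 2) :=
    Subtype.val_injective
  have hsum : ((s.image Subtype.val).card : ℂ)⁻¹ • ∑ V ∈ s.image Subtype.val, moment V =
      Φ.symm (averageOp A s) := by
    rw [Finset.card_image_of_injective _ hinj, Finset.sum_image fun _ _ _ _ h => hinj h]
    rw [averageOp, map_smul, map_sum]
    simp only [A, StarAlgEquiv.symm_apply_apply]
  -- Idle layers bring the finitely many circuits to a common depth.
  refine ⟨s.image Subtype.val, s.sup dep, P, r, hs.image _, ?_, hr0, hr1, ?_, ?_, ?_, ?_⟩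
  · intro V hV
    obtain ⟨V, hVs, rfl⟩ := Finset.mem_image.1 hV
    exact (hdep V).mono (Finset.le_sup hVs)
  · intro L X Y
    refine (norm_apply_le_norm_toEuclideanCLM _ X Y).trans ?_
    refine le_trans (le_of_eq ?_) (hL L)
    congr 1
    change Φ _ = _
    rw [map_sub, hP, map_pow, hsum, StarAlgEquiv.apply_symm_apply]
  · intro X Y
    refine (norm_apply_le_norm_toEuclideanCLM _ X Y).trans ?_
    change ‖Φ P‖ ≤ 1
    rw [hP]
    exact Submodule.starProjection_norm_le F
  · intro v
    rw [← hfix, hPv]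
    exact Submodule.starProjection_apply_mem _ _
  · intro w hw v
    rw [← hfix] at hw
    have h1 : ∀ x y : κ → ℂ, star x ⬝ᵥ y = ⟪WithLp.toLp 2 x, WithLp.toLp 2 y⟫_ℂ := by
      intro x y
      rw [EuclideanSpace.inner_eq_star_dotProduct, dotProduct_comm]
    rw [h1, h1, hPv, ← Submodule.inner_starProjection_left_eq_right,
      Submodule.starProjection_eq_self_iff.2 hw]

end UniversalMoments

/-! ### Tensors that are invariant under all unitaries -/

section Invariants

variable {ι : Type*} [Fintype ι] [DecidableEq ι]

/-- The tensor of the identity permutation. -/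
def idTensor (ι : Type*) [DecidableEq ι] : (Fin 4 → ι) → ℂ :=
  fun X => if X 0 = X 1 ∧ X 2 = X 3 then 1 else 0

/-- The tensor of the transposition. -/
def swapTensor (ι : Type*) [DecidableEq ι] : (Fin 4 → ι) → ℂ :=
  fun X => if X 0 = X 3 ∧ X 2 = X 1 then 1 else 0

/-- The tensor that detects four equal indices. -/
def diagTensor (ι : Type*) [DecidableEq ι] : (Fin 4 → ι) → ℂ :=
  fun X => if X 0 = X 1 ∧ X 2 = X 3 ∧ X 0 = X 2 then 1 else 0

lemma sum_fin_four {β : Type*} [Fintype β] {R : Type*} [AddCommMonoid R] (F : (Fin 4 → β) → R) :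
    ∑ X, F X = ∑ a, ∑ b, ∑ c, ∑ d, F ![a, b, c, d] := by
  let e : (Fin 4 → β) ≃ β × β × β × β :=
    { toFun := fun X => (X 0, X 1, X 2, X 3)
      invFun := fun p => ![p.1, p.2.1, p.2.2.1, p.2.2.2]
      left_inv := fun X => by funext s; fin_cases s <;> rfl
      right_inv := fun p => rfl }
  rw [← e.symm.sum_comp F]
  simp only [Fintype.sum_prod_type]
  rfl

lemma moment_apply (U : Matrix ι ι ℂ) (X : Fin 4 → ι) (a b c d : ι) :
    moment U X ![a, b, c, d] = U (X 0) a * star (U (X 1) b) * U (X 2) c * star (U (X 3) d) := by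
  simp only [moment, Fin.prod_univ_four, legHom_zero, legHom_one, legHom_two, legHom_three]
  rfl

lemma sum_mul_star_of_unitary {U : Matrix ι ι ℂ} (hU : U ∈ Matrix.unitaryGroup ι ℂ) (i j : ι) :
    ∑ a, U i a * star (U j a) = if i = j then 1 else 0 := by
  have h := congrFun (congrFun (Matrix.mem_unitaryGroup_iff.1 hU) i) j
  rw [Matrix.mul_apply, Matrix.one_apply] at h
  exact h

lemma moment_mulVec_idTensor {U : Matrix ι ι ℂ} (hU : U ∈ Matrix.unitaryGroup ι ℂ) :
    moment U *ᵥ idTensor ι = idTensor ι := by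
  funext X
  simp only [Matrix.mulVec, dotProduct]
  rw [sum_fin_four]
  have h1 : ∀ a b c d, moment U X ![a, b, c, d] * idTensor ι ![a, b, c, d] =
      if b = a then (if d = c then U (X 0) a * star (U (X 1) b) * (U (X 2) c * star (U (X 3) d))
        else 0) else 0 := by
    intro a b c d
    rw [moment_apply, idTensor]
    simp only [Matrix.cons_val_zero, Matrix.cons_val_one, Matrix.cons_val]
    by_cases h1 : a = b <;> by_cases h2 : c = d <;>
      simp [h1, h2, Ne.symm, mul_assoc]
  simp only [h1, Finset.sum_ite_irrel, Finset.sum_const_zero, Finset.sum_ite_eq', Finset.mem_univ,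
    if_true]
  simp only [← Finset.mul_sum, sum_mul_star_of_unitary hU, ← Finset.sum_mul, idTensor]
  split_ifs <;> simp_all

/-- The swap is the identity tensor with the two conjugated legs exchanged, and the moment operator
is symmetric under this exchange. -/
lemma moment_mulVec_swapTensor {U : Matrix ι ι ℂ} (hU : U ∈ Matrix.unitaryGroup ι ℂ) :
    moment U *ᵥ swapTensor ι = swapTensor ι := by
  funext X
  have h := congrFun (moment_mulVec_idTensor hU) ![X 0, X 3, X 2, X 1]
  have h2 : idTensor ι ![X 0, X 3, X 2, X 1] = swapTensor ι X := rfl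
  rw [h2] at h
  rw [← h]
  simp only [Matrix.mulVec, dotProduct]
  rw [sum_fin_four, sum_fin_four]
  refine Finset.sum_congr rfl fun a _ => ?_
  rw [Finset.sum_comm]
  conv_lhs => enter [2, c]; rw [Finset.sum_comm]
  conv_rhs => rw [Finset.sum_comm]
  refine Finset.sum_congr rfl fun c _ => Finset.sum_congr rfl fun d _ =>
    Finset.sum_congr rfl fun b _ => ?_
  rw [moment_apply, moment_apply]
  have h3 : swapTensor ι ![a, b, c, d] = idTensor ι ![a, d, c, b] := rfl
  rw [h3]
  simp only [Matrix.cons_val_zero, Matrix.cons_val_one, Matrix.cons_val]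
  ring

/-- The permutation matrix that maps the index `σ i` to `i`. -/
def permMat (σ : Equiv.Perm ι) : Matrix ι ι ℂ := fun i j => if σ i = j then 1 else 0

lemma permMat_mem (σ : Equiv.Perm ι) : permMat σ ∈ Matrix.unitaryGroup ι ℂ := by
  rw [Matrix.mem_unitaryGroup_iff]
  ext i j
  rw [Matrix.mul_apply, Matrix.one_apply]
  simp [permMat, Matrix.star_apply, eq_comm]

lemma moment_permMat_mulVec (σ : Equiv.Perm ι) (v : (Fin 4 → ι) → ℂ) (X : Fin 4 → ι) :
    (moment (permMat σ) *ᵥ v) X = v (σ ∘ X) := by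
  simp only [Matrix.mulVec, dotProduct]
  rw [Finset.sum_eq_single (σ ∘ X)]
  · have : moment (permMat σ) X (σ ∘ X) = 1 := by simp [moment, permMat]
    rw [this, one_mul]
  · intro Y _ hY
    obtain ⟨s, hs⟩ := Function.ne_iff.1 hY
    have : moment (permMat σ) X Y = 0 :=
      Finset.prod_eq_zero (Finset.mem_univ s) (by
        rw [permMat, if_neg (fun h => hs h.symm), map_zero])
    rw [this, zero_mul]
  · simp

lemma moment_diagonal_mulVec (u : ι → ℂ) (v : (Fin 4 → ι) → ℂ) (X : Fin 4 → ι) :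
    (moment (Matrix.diagonal u) *ᵥ v) X =
      u (X 0) * star (u (X 1)) * u (X 2) * star (u (X 3)) * v X := by
  simp only [Matrix.mulVec, dotProduct]
  rw [Finset.sum_eq_single X]
  · congr 1
    simp only [moment, Fin.prod_univ_four, legHom_zero, legHom_one, legHom_two, legHom_three,
      Matrix.diagonal_apply_eq]
  · intro Y _ hY
    obtain ⟨s, hs⟩ := Function.ne_iff.1 hY
    have : moment (Matrix.diagonal u) X Y = 0 :=
      Finset.prod_eq_zero (Finset.mem_univ s) (by
        rw [Matrix.diagonal_apply_ne _ (fun h => hs h.symm), map_zero])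
    rw [this, zero_mul]
  · simp

lemma exists_perm_pair {x y a c : ι} (hxy : x ≠ y) (hac : a ≠ c) :
    ∃ σ : Equiv.Perm ι, σ x = a ∧ σ y = c := by
  refine ⟨Equiv.swap (Equiv.swap x a y) c * Equiv.swap x a, ?_, ?_⟩
  · rw [Equiv.Perm.mul_apply, Equiv.swap_apply_left]
    refine Equiv.swap_apply_of_ne_of_ne ?_ hac
    intro h
    have : Equiv.swap x a x = Equiv.swap x a y := by rw [Equiv.swap_apply_left]; exact h
    exact hxy ((Equiv.swap x a).injective this)
  · rw [Equiv.Perm.mul_apply, Equiv.swap_apply_left]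

/-- A phase `i` at the index `a` multiplies the entry by `i` to the number of plain legs equal to
`a` minus the number of conjugated ones. This difference lies between `-2` and `2`, so a phase of
order four forces it to vanish; a sign would not distinguish `0` from `2`. The choices `a = X 0` and
`a = X 2` suffice. -/
lemma eq_zero_of_invariant {v : (Fin 4 → ι) → ℂ}
    (hv : ∀ U ∈ Matrix.unitaryGroup ι ℂ, moment U *ᵥ v = v) {X : Fin 4 → ι}
    (h1 : ¬ (X 0 = X 1 ∧ X 2 = X 3)) (h2 : ¬ (X 0 = X 3 ∧ X 2 = X 1)) : v X = 0 := by
  by_contra hX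
  have key : ∀ a, Function.update (1 : ι → ℂ) a Complex.I (X 0) *
      star (Function.update (1 : ι → ℂ) a Complex.I (X 1)) *
      Function.update (1 : ι → ℂ) a Complex.I (X 2) *
      star (Function.update (1 : ι → ℂ) a Complex.I (X 3)) = 1 := by
    intro a
    have h := congrFun (hv _ (phaseMat_mem a (Circle.exp (Real.pi / 2)))) X
    rw [phaseMat, moment_diagonal_mulVec] at h
    have hI : ((Circle.exp (Real.pi / 2) : Circle) : ℂ) = Complex.I := by
      rw [Circle.coe_exp]
      push_cast
      exact Complex.exp_pi_div_two_mul_I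
    rw [hI] at h
    exact mul_right_cancel₀ hX (h.trans (one_mul _).symm)
  have hI1 : Complex.I ≠ 1 := fun h => by simpa using congrArg Complex.re h
  have hI2 : Complex.I * Complex.I ≠ 1 := by rw [Complex.I_mul_I]; norm_num
  have k0 := key (X 0)
  have k2 := key (X 2)
  simp only [Function.update_apply, Pi.one_apply, if_true] at k0 k2
  have hII : Complex.I * -Complex.I = 1 := by simp
  by_cases e1 : X 1 = X 0 <;> by_cases e3 : X 3 = X 0 <;> by_cases e2 : X 2 = X 0 <;>
    by_cases e4 : X 3 = X 2 <;> by_cases e5 : X 1 = X 2 <;> simp_all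

/-- The tensors that are invariant under all unitaries are spanned by the two permutations. -/
theorem eq_add_of_invariant [Nontrivial ι] {v : (Fin 4 → ι) → ℂ}
    (hv : ∀ U ∈ Matrix.unitaryGroup ι ℂ, moment U *ᵥ v = v) :
    ∃ p q : ℂ, v = p • idTensor ι + q • swapTensor ι := by
  obtain ⟨a, c, hac⟩ := exists_pair_ne ι
  have hperm : ∀ (σ : Equiv.Perm ι) X, v (σ ∘ X) = v X := fun σ X => by
    rw [← moment_permMat_mulVec σ v X, hv _ (permMat_mem σ)]
  set p := v ![a, a, c, c] with hp
  set q := v ![a, c, c, a] with hq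
  set r := v ![a, a, a, a] with hr
  -- Phases leave only paired indices, and permutation matrices make the entry depend on the pairing
  -- pattern alone. Three constants remain.
  have hdecomp : v = p • idTensor ι + q • swapTensor ι + (r - p - q) • diagTensor ι := by
    funext X
    simp only [Pi.add_apply, Pi.smul_apply, smul_eq_mul, idTensor, swapTensor, diagTensor]
    by_cases h1 : X 0 = X 1 ∧ X 2 = X 3
    · by_cases h02 : X 0 = X 2
      · have h3 : v X = r := by
          rw [← hperm (Equiv.swap (X 0) a), hr]
          congr 1
          funext s
          have : X s = X 0 := by
            obtain ⟨e1, e2⟩ := h1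
            fin_cases s <;> simp [← e2, ← e1, ← h02]
          rw [Function.comp_apply, this, Equiv.swap_apply_left]
          fin_cases s <;> rfl
        rw [h3, if_pos h1, if_pos ⟨h02.trans h1.2, h02.symm.trans h1.1⟩,
          if_pos ⟨h1.1, h1.2, h02⟩]
        ring
      · obtain ⟨σ, hσ1, hσ2⟩ := exists_perm_pair h02 hac
        have h3 : v X = p := by
          rw [← hperm σ, hp]
          congr 1
          funext s
          fin_cases s
          · exact hσ1
          · change σ (X 1) = a; rw [← h1.1]; exact hσ1
          · exact hσ2
          · change σ (X 3) = c; rw [← h1.2]; exact hσ2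
        rw [h3, if_pos h1, if_neg (fun h => h02 (h.1.trans h1.2.symm)), if_neg (fun h => h02 h.2.2)]
        ring
    · by_cases h2 : X 0 = X 3 ∧ X 2 = X 1
      · have h02 : X 0 ≠ X 2 := fun h => h1 ⟨h.trans h2.2, h.symm.trans h2.1⟩
        obtain ⟨σ, hσ1, hσ2⟩ := exists_perm_pair h02 hac
        have h3 : v X = q := by
          rw [← hperm σ, hq]
          congr 1
          funext s
          fin_cases s
          · exact hσ1
          · change σ (X 1) = c; rw [← h2.2]; exact hσ2
          · exact hσ2
          · change σ (X 3) = a; rw [← h2.1]; exact hσ1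
        rw [h3, if_neg h1, if_pos h2, if_neg (fun h => h1 ⟨h.1, h.2.1⟩)]
        ring
      · rw [eq_zero_of_invariant hv h1 h2, if_neg h1, if_neg h2,
          if_neg (fun h => h1 ⟨h.1, h.2.1⟩)]
        ring
  -- The diagonal tensor is not invariant: under a rotation by `π / 4` its entry at four equal
  -- indices drops from `1` to `cos⁴ + sin⁴ = 1 / 2`.
  have hrpq : r - p - q = 0 := by
    set z : Circle := Circle.exp (Real.pi / 4) with hz
    have hR := planeRot_mem hac z
    have h1 := hv _ hR
    rw [hdecomp, Matrix.mulVec_add, Matrix.mulVec_add, Matrix.mulVec_smul, Matrix.mulVec_smul,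
      moment_mulVec_idTensor hR, moment_mulVec_swapTensor hR, add_right_inj,
      Matrix.mulVec_smul] at h1
    have h2 := congrFun h1 ![a, a, a, a]
    simp only [Pi.smul_apply, smul_eq_mul] at h2
    by_contra hne
    have h3 := mul_left_cancel₀ hne h2
    have h4 : diagTensor ι ![a, a, a, a] = 1 := by simp [diagTensor]
    rw [h4] at h3
    simp only [Matrix.mulVec, dotProduct] at h3
    rw [sum_fin_four] at h3
    have h5 : ∀ x y t w, moment (planeRot a c z) ![a, a, a, a] ![x, y, t, w] *
        diagTensor ι ![x, y, t, w] =
        if y = x then (if t = x then (if w = x then (planeRot a c z a x * star (planeRot a c z a x))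
          * (planeRot a c z a x * star (planeRot a c z a x)) else 0) else 0) else 0 := by
      intro x y t w
      rw [moment_apply, diagTensor]
      simp only [Matrix.cons_val_zero, Matrix.cons_val_one, Matrix.cons_val]
      by_cases g : x = y ∧ t = w ∧ x = t
      · obtain ⟨rfl, rfl, rfl⟩ := g
        simp; ring
      · have g' : ¬ (y = x ∧ t = x ∧ w = x) := fun h =>
          g ⟨h.1.symm, h.2.1.trans h.2.2.symm, h.2.1.symm⟩
        simp only [g, if_false, mul_zero]
        split_ifs with g1 g2 g3
        · exact absurd ⟨g1, g2, g3⟩ g'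
        all_goals rfl
    simp only [h5, Finset.sum_ite_irrel, Finset.sum_const_zero, Finset.sum_ite_eq',
      Finset.mem_univ, if_true] at h3
    have hre : (z : ℂ).re = √2 / 2 := by
      rw [hz, Circle.coe_exp, Complex.exp_ofReal_mul_I_re, Real.cos_pi_div_four]
    have him : (z : ℂ).im = √2 / 2 := by
      rw [hz, Circle.coe_exp, Complex.exp_ofReal_mul_I_im, Real.sin_pi_div_four]
    have hs2 : ((√2 : ℝ) : ℂ) ^ 2 = 2 := by
      rw [← Complex.ofReal_pow, Real.sq_sqrt (by norm_num)]; norm_num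
    have hs4 : ((√2 : ℝ) : ℂ) ^ 4 = 4 := by
      rw [show ((√2 : ℝ) : ℂ) ^ 4 = (((√2 : ℝ) : ℂ) ^ 2) ^ 2 by ring, hs2]; norm_num
    rw [Finset.sum_eq_add a c hac] at h3
    · simp only [planeRot, if_true, hac.symm, if_false, hre, him] at h3
      simp only [← Complex.ofReal_neg, Complex.star_def, Complex.conj_ofReal] at h3
      push_cast at h3
      ring_nf at h3
      rw [hs4] at h3
      norm_num at h3
    · intro j _ hj; simp [planeRot, hj.1, hj.2]
    · simp
    · simp
  rw [hrpq, zero_smul, add_zero] at hdecomp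
  exact ⟨p, q, hdecomp⟩

end Invariants

/-! ### The random circuit as a Markov chain on labels -/

section Labels

/-- The labels of a site: the initial state, or one of the two permutations. -/
abbrev SiteLabel : Type := Option Bool

/-- The second moment tensor of a site with a given label: `|0⟩⟨0|`, the normalized identity or the
normalized swap. -/
def siteTensor : SiteLabel → (Fin 4 → Bool) → ℂ
  | none => fun k => if k = (fun _ => false) then 1 else 0
  | some true => (4 : ℂ)⁻¹ • idTensor Bool
  | some false => (2 : ℂ)⁻¹ • swapTensor Bool

/-- The overlap of a site tensor with the swap. -/
def swapValue : SiteLabel → ℝ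
  | none => 1
  | some true => 1 / 2
  | some false => 2

/-- The weight of the identity after a random gate on two sites. -/
def idWeight (l l' : SiteLabel) : ℝ := (16 - 4 * (swapValue l * swapValue l')) / 15

lemma idWeight_nonneg (l l' : SiteLabel) : 0 ≤ idWeight l l' := by
  unfold idWeight
  rcases l with _ | _ | _ <;> rcases l' with _ | _ | _ <;> norm_num [swapValue]

lemma idWeight_le_one (l l' : SiteLabel) : idWeight l l' ≤ 1 := by
  unfold idWeight
  rcases l with _ | _ | _ <;> rcases l' with _ | _ | _ <;> norm_num [swapValue]

lemma norm_siteTensor_le (l : SiteLabel) (k : Fin 4 → Bool) : ‖siteTensor l k‖ ≤ 1 := by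
  rcases l with _ | _ | _ <;> simp only [siteTensor, Pi.smul_apply, idTensor, swapTensor] <;>
    split_ifs <;> norm_num

/-- The normalization of the site tensors: since this overlap is conserved by every unitary, the
weights after a gate sum to one. -/
lemma sum_idTensor_mul_siteTensor (l : SiteLabel) :
    ∑ k, idTensor Bool k * siteTensor l k = 1 := by
  rw [sum_fin_four]
  rcases l with _ | _ | _ <;> simp only [siteTensor, Pi.smul_apply, idTensor, swapTensor] <;>
    simp [funext_iff, Fin.forall_fin_succ] <;> norm_num

lemma sum_swapTensor_mul_siteTensor (l : SiteLabel) :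
    ∑ k, swapTensor Bool k * siteTensor l k = swapValue l := by
  rw [sum_fin_four]
  rcases l with _ | _ | _ <;> simp only [siteTensor, Pi.smul_apply, idTensor, swapTensor,
    swapValue] <;> simp [funext_iff, Fin.forall_fin_succ] <;> norm_num

/-- The tensor of two sites with given labels. -/
def pairTensor (l l' : SiteLabel) : (Fin 4 → BitString 2) → ℂ :=
  fun Y => siteTensor l (fun s => Y s 0) * siteTensor l' (fun s => Y s 1)

lemma bitString_two_ext {x y : BitString 2} : x = y ↔ x 0 = y 0 ∧ x 1 = y 1 := by
  constructor
  · rintro rfl; exact ⟨rfl, rfl⟩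
  · rintro ⟨h0, h1⟩; funext i; fin_cases i <;> assumption

lemma idTensor_two (Y : Fin 4 → BitString 2) : idTensor (BitString 2) Y =
    idTensor Bool (fun s => Y s 0) * idTensor Bool (fun s => Y s 1) := by
  simp only [idTensor, ← ite_and, mul_ite, mul_one, mul_zero]
  congr 1
  rw [bitString_two_ext, bitString_two_ext, eq_iff_iff]
  tauto

lemma swapTensor_two (Y : Fin 4 → BitString 2) : swapTensor (BitString 2) Y =
    swapTensor Bool (fun s => Y s 0) * swapTensor Bool (fun s => Y s 1) := by
  simp only [swapTensor, ← ite_and, mul_ite, mul_one, mul_zero]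
  congr 1
  rw [bitString_two_ext, bitString_two_ext, eq_iff_iff]
  tauto

lemma pairTensor_id : pairTensor (some true) (some true) = (16 : ℂ)⁻¹ • idTensor (BitString 2) := by
  funext Y
  simp only [pairTensor, siteTensor, Pi.smul_apply, smul_eq_mul, idTensor_two]
  ring

lemma pairTensor_swap :
    pairTensor (some false) (some false) = (4 : ℂ)⁻¹ • swapTensor (BitString 2) := by
  funext Y
  simp only [pairTensor, siteTensor, Pi.smul_apply, smul_eq_mul, swapTensor_two]
  ring

lemma sum_two_sites (f g : (Fin 4 → Bool) → ℂ) :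
    ∑ Y : Fin 4 → BitString 2, f (fun s => Y s 0) * g (fun s => Y s 1) = (∑ k, f k) * ∑ k, g k := by
  let e : (Fin 4 → BitString 2) ≃ (Fin 4 → Bool) × (Fin 4 → Bool) :=
    { toFun := fun Y => (fun s => Y s 0, fun s => Y s 1)
      invFun := fun p s => ![p.1 s, p.2 s]
      left_inv := fun Y => by funext s i; fin_cases i <;> rfl
      right_inv := fun p => rfl }
  rw [Fintype.sum_mul_sum, ← Fintype.sum_prod_type', ← e.sum_comp]
  rfl

lemma star_idTensor (ι : Type*) [DecidableEq ι] : star (idTensor ι) = idTensor ι := by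
  funext X
  simp only [idTensor, Pi.star_apply]
  split_ifs <;> simp

lemma star_swapTensor (ι : Type*) [DecidableEq ι] : star (swapTensor ι) = swapTensor ι := by
  funext X
  simp only [swapTensor, Pi.star_apply]
  split_ifs <;> simp

lemma idTensor_dotProduct_pairTensor (l l' : SiteLabel) :
    star (idTensor (BitString 2)) ⬝ᵥ pairTensor l l' = 1 := by
  rw [star_idTensor]
  have h : ∀ Y, idTensor (BitString 2) Y * pairTensor l l' Y =
      (fun k => idTensor Bool k * siteTensor l k) (fun s => Y s 0) *
      (fun k => idTensor Bool k * siteTensor l' k) (fun s => Y s 1) := by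
    intro Y; rw [idTensor_two]; simp only [pairTensor]; ring
  refine (Finset.sum_congr rfl fun Y _ => h Y).trans ((sum_two_sites
    (fun k => idTensor Bool k * siteTensor l k) fun k => idTensor Bool k * siteTensor l' k).trans ?_)
  rw [sum_idTensor_mul_siteTensor, sum_idTensor_mul_siteTensor, one_mul]

lemma swapTensor_dotProduct_pairTensor (l l' : SiteLabel) :
    star (swapTensor (BitString 2)) ⬝ᵥ pairTensor l l' = (swapValue l * swapValue l' : ℝ) := by
  rw [star_swapTensor]
  have h : ∀ Y, swapTensor (BitString 2) Y * pairTensor l l' Y =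
      (fun k => swapTensor Bool k * siteTensor l k) (fun s => Y s 0) *
      (fun k => swapTensor Bool k * siteTensor l' k) (fun s => Y s 1) := by
    intro Y; rw [swapTensor_two]; simp only [pairTensor]; ring
  refine (Finset.sum_congr rfl fun Y _ => h Y).trans ((sum_two_sites
    (fun k => swapTensor Bool k * siteTensor l k) fun k => swapTensor Bool k * siteTensor l' k).trans ?_)
  rw [sum_swapTensor_mul_siteTensor, sum_swapTensor_mul_siteTensor]
  push_cast; ring

/-- A projection onto the tensors invariant under all unitaries maps each pair of labels to a mixture
of two equal permutations. -/
lemma mulVec_pairTensor {P : Matrix (Fin 4 → BitString 2) (Fin 4 → BitString 2) ℂ}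
    (h1 : ∀ v, ∀ U ∈ Matrix.unitaryGroup (BitString 2) ℂ, moment U *ᵥ (P *ᵥ v) = P *ᵥ v)
    (h2 : ∀ w, (∀ U ∈ Matrix.unitaryGroup (BitString 2) ℂ, moment U *ᵥ w = w) →
      ∀ v, star w ⬝ᵥ (P *ᵥ v) = star w ⬝ᵥ v) (l l' : SiteLabel) :
    P *ᵥ pairTensor l l' = (idWeight l l' : ℂ) • pairTensor (some true) (some true) +
      (1 - idWeight l l' : ℂ) • pairTensor (some false) (some false) := by
  -- The overlaps with identity and swap determine `p` and `q`. The Gram matrix in dimension four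
  -- has diagonal entries `16` and off-diagonal entries `4`.
  obtain ⟨p, q, hpq⟩ := eq_add_of_invariant (h1 (pairTensor l l'))
  have hI := h2 _ (fun U hU => moment_mulVec_idTensor hU) (pairTensor l l')
  have hS := h2 _ (fun U hU => moment_mulVec_swapTensor hU) (pairTensor l l')
  have e1 : idTensor (BitString 2) = (16 : ℂ) • pairTensor (some true) (some true) := by
    rw [pairTensor_id, smul_smul]; norm_num
  have e2 : swapTensor (BitString 2) = (4 : ℂ) • pairTensor (some false) (some false) := by
    rw [pairTensor_swap, smul_smul]; norm_num
  rw [hpq, dotProduct_add, dotProduct_smul, dotProduct_smul] at hI hS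
  conv at hI => enter [1, 1, 2, 2]; rw [e1]
  conv at hI => enter [1, 2, 2, 2]; rw [e2]
  conv at hS => enter [1, 1, 2, 2]; rw [e1]
  conv at hS => enter [1, 2, 2, 2]; rw [e2]
  rw [dotProduct_smul, dotProduct_smul] at hI hS
  have s1 : swapValue (some true) = 1 / 2 := rfl
  have s2 : swapValue (some false) = 2 := rfl
  simp only [idTensor_dotProduct_pairTensor, swapTensor_dotProduct_pairTensor, smul_eq_mul,
    s1, s2] at hI hS
  push_cast at hI hS
  have hp : p = idWeight l l' / 16 := by
    unfold idWeight; push_cast; linear_combination (4 / 60 : ℂ) * hI - (1 / 60 : ℂ) * hS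
  have hq : q = (1 - idWeight l l') / 4 := by
    unfold idWeight; push_cast; linear_combination (4 / 60 : ℂ) * hS - (1 / 60 : ℂ) * hI
  rw [hpq, pairTensor_id, pairTensor_swap, smul_smul, smul_smul, hp, hq]
  congr 1

end Labels

/-! ### The Markov chain on labellings: conserved quantity and potential. -/

section LabelChain

variable {m : ℕ}

/-- Set two sites to the same permutation. -/
def setPair (e : Fin 2 → Fin m) (b : Bool) (μ : Fin m → SiteLabel) : Fin m → SiteLabel :=
  Function.extend e (fun _ => some b) μ

/-- One step of the chain: a random gate on the sites `e 0` and `e 1`. -/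
def gateStep (e : Fin 2 → Fin m) (F : (Fin m → SiteLabel) → ℝ) (μ : Fin m → SiteLabel) : ℝ :=
  idWeight (μ (e 0)) (μ (e 1)) * F (setPair e true μ) +
    (1 - idWeight (μ (e 0)) (μ (e 1))) * F (setPair e false μ)

/-- The expectation of a function of the labels after a sequence of gates. -/
def chainStep : List (Fin 2 → Fin m) → ((Fin m → SiteLabel) → ℝ) → (Fin m → SiteLabel) → ℝ
  | [], F => F
  | e :: es, F => gateStep e (chainStep es F)

lemma gateStep_mono (e : Fin 2 → Fin m) {F F' : (Fin m → SiteLabel) → ℝ} (h : ∀ μ, F μ ≤ F' μ)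
    (μ : Fin m → SiteLabel) : gateStep e F μ ≤ gateStep e F' μ := by
  unfold gateStep
  have h1 := idWeight_nonneg (μ (e 0)) (μ (e 1))
  have h2 := idWeight_le_one (μ (e 0)) (μ (e 1))
  exact add_le_add (mul_le_mul_of_nonneg_left (h _) h1)
    (mul_le_mul_of_nonneg_left (h _) (by linarith))

lemma gateStep_add_mul (e : Fin 2 → Fin m) (F F' : (Fin m → SiteLabel) → ℝ) (c : ℝ)
    (μ : Fin m → SiteLabel) :
    gateStep e (fun ν => F ν + c * F' ν) μ = gateStep e F μ + c * gateStep e F' μ := by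
  unfold gateStep; ring

lemma chainStep_mono (es : List (Fin 2 → Fin m)) {F F' : (Fin m → SiteLabel) → ℝ}
    (h : ∀ μ, F μ ≤ F' μ) (μ : Fin m → SiteLabel) : chainStep es F μ ≤ chainStep es F' μ := by
  induction es generalizing μ with
  | nil => exact h μ
  | cons e es ih => exact gateStep_mono e ih μ

lemma chainStep_add_mul (es : List (Fin 2 → Fin m)) (F F' : (Fin m → SiteLabel) → ℝ) (c : ℝ)
    (μ : Fin m → SiteLabel) :
    chainStep es (fun ν => F ν + c * F' ν) μ = chainStep es F μ + c * chainStep es F' μ := by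
  induction es generalizing μ with
  | nil => rfl
  | cons e es ih =>
    simp only [chainStep]
    rw [← gateStep_add_mul]
    congr 1
    funext ν; exact ih ν

lemma chainStep_mul (es : List (Fin 2 → Fin m)) (F : (Fin m → SiteLabel) → ℝ) (c : ℝ)
    (μ : Fin m → SiteLabel) : chainStep es (fun ν => c * F ν) μ = c * chainStep es F μ := by
  induction es generalizing μ with
  | nil => rfl
  | cons e es ih =>
    simp only [chainStep, gateStep, ih]
    ring

lemma chainStep_append (es es' : List (Fin 2 → Fin m)) (F : (Fin m → SiteLabel) → ℝ) :
    chainStep (es ++ es') F = chainStep es (chainStep es' F) := by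
  induction es with
  | nil => rfl
  | cons e es ih => simp only [List.cons_append, chainStep, ih]

/-- A product of functions of the labels of the sites. -/
def prodFun (f : SiteLabel → ℝ) (μ : Fin m → SiteLabel) : ℝ := ∏ i, f (μ i)

open Classical in
lemma prod_split {R : Type*} [CommMonoid R] {e : Fin 2 → Fin m} (he : Function.Injective e)
    (f : Fin m → R) :
    ∏ i, f i = f (e 0) * f (e 1) * ∏ i with ∀ j, e j ≠ i, f i := by
  rw [← Finset.prod_filter_mul_prod_filter_not Finset.univ (fun i => ∃ j, e j = i) f]
  congr 1
  · have : (Finset.univ.filter fun i => ∃ j, e j = i) = Finset.univ.image e := by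
      ext i; simp
    rw [this, Finset.prod_image fun _ _ _ _ h => he h, Fin.prod_univ_two]
  · congr 1; ext i; simp

open Classical in
lemma prodFun_eq {e : Fin 2 → Fin m} (he : Function.Injective e) (f : SiteLabel → ℝ)
    (μ : Fin m → SiteLabel) : prodFun f μ =
      f (μ (e 0)) * f (μ (e 1)) * ∏ i with ∀ j, e j ≠ i, f (μ i) :=
  prod_split he fun i => f (μ i)

lemma setPair_apply {e : Fin 2 → Fin m} (he : Function.Injective e) (b : Bool)
    (μ : Fin m → SiteLabel) (j : Fin 2) : setPair e b μ (e j) = some b :=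
  he.extend_apply _ _ _

lemma setPair_apply_off {e : Fin 2 → Fin m} (b : Bool) (μ : Fin m → SiteLabel) {i : Fin m}
    (hi : ∀ j, e j ≠ i) : setPair e b μ i = μ i :=
  Function.extend_apply' _ _ _ (fun ⟨j, hj⟩ => hi j hj)

open Classical in
lemma prodFun_setPair {e : Fin 2 → Fin m} (he : Function.Injective e) (f : SiteLabel → ℝ)
    (b : Bool) (μ : Fin m → SiteLabel) : prodFun f (setPair e b μ) =
      f (some b) * f (some b) * ∏ i with ∀ j, e j ≠ i, f (μ i) := by
  rw [prodFun_eq he, setPair_apply he, setPair_apply he]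
  congr 1
  refine Finset.prod_congr rfl fun i hi => ?_
  rw [setPair_apply_off b μ (Finset.mem_filter.1 hi).2]

lemma prodFun_nonneg {f : SiteLabel → ℝ} (hf : ∀ l, 0 ≤ f l) (μ : Fin m → SiteLabel) :
    0 ≤ prodFun f μ := Finset.prod_nonneg fun _ _ => hf _

lemma gateStep_prodFun_le {e : Fin 2 → Fin m} (he : Function.Injective e) {f : SiteLabel → ℝ}
    (hf : ∀ l, 0 ≤ f l) {c : ℝ} (μ : Fin m → SiteLabel)
    (h : idWeight (μ (e 0)) (μ (e 1)) * (f (some true) * f (some true)) +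
      (1 - idWeight (μ (e 0)) (μ (e 1))) * (f (some false) * f (some false)) ≤
      c * (f (μ (e 0)) * f (μ (e 1)))) :
    gateStep e (prodFun f) μ ≤ c * prodFun f μ := by
  classical
  rw [gateStep, prodFun_setPair he, prodFun_setPair he, prodFun_eq he f μ]
  have h0 : 0 ≤ ∏ i with ∀ j, e j ≠ i, f (μ i) := Finset.prod_nonneg fun _ _ => hf _
  have := mul_le_mul_of_nonneg_right h h0
  linarith

/-- A gate is active unless its two sites carry the same permutation. -/
def IsActive (e : Fin 2 → Fin m) (μ : Fin m → SiteLabel) : Prop :=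
  ¬ ∃ b : Bool, μ (e 0) = some b ∧ μ (e 1) = some b

/-- Two equal permutations form an invariant tensor of the pair: the identity weight is `1` for two
identities and `0` for two swaps. -/
lemma gateStep_of_not_isActive {e : Fin 2 → Fin m} (he : Function.Injective e)
    {μ : Fin m → SiteLabel} (h : ¬ IsActive e μ) (F : (Fin m → SiteLabel) → ℝ) :
    gateStep e F μ = F μ := by
  obtain ⟨b, h0, h1⟩ := not_not.1 h
  have hset : setPair e b μ = μ := by
    funext i
    by_cases hi : ∃ j, e j = i
    · obtain ⟨j, rfl⟩ := hi
      rw [setPair_apply he]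
      fin_cases j
      · exact h0.symm
      · exact h1.symm
    · exact setPair_apply_off b μ fun j hj => hi ⟨j, hj⟩
  rw [gateStep, h0, h1]
  cases b
  · rw [hset]; norm_num [idWeight, swapValue]
  · rw [hset]; norm_num [idWeight, swapValue]

/-- The conserved quantity of the chain, at a site. -/
def conservedValue (l : SiteLabel) : ℝ := swapValue l / 2

/-- The potential of the chain, at a site. -/
def potentialValue : SiteLabel → ℝ
  | none => 2 / 3
  | some true => 1 / 2
  | some false => 1

lemma potentialValue_nonneg (l : SiteLabel) : 0 ≤ potentialValue l := by
  rcases l with _ | _ | _ <;> norm_num [potentialValue]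

/-- The swap is invariant, so a gate preserves the swap overlap of its pair. For any two labels
`idWeight / 16 + (1 - idWeight)` equals the product of the conserved values. The values are scaled
so that the all-swap labelling has value `1`. -/
lemma chainStep_conserved_le (es : List (Fin 2 → Fin m)) (hes : ∀ e ∈ es, Function.Injective e)
    (μ : Fin m → SiteLabel) :
    chainStep es (prodFun conservedValue) μ ≤ prodFun conservedValue μ := by
  induction es generalizing μ with
  | nil => exact le_rfl
  | cons e es ih =>
    refine (gateStep_mono e (ih fun e' h => hes e' (List.mem_cons_of_mem _ h)) μ).trans ?_
    have := gateStep_prodFun_le (hes e List.mem_cons_self) (f := conservedValue) (c := 1)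
      (fun l => by rcases l with _ | _ | _ <;> norm_num [conservedValue, swapValue]) μ (by
        unfold idWeight conservedValue
        generalize μ (e 0) = l
        generalize μ (e 1) = l'
        rcases l with _ | _ | _ <;> rcases l' with _ | _ | _ <;> norm_num [swapValue])
    rwa [one_mul] at this

/-- All sites carry the same permutation. -/
def IsTrivialLabel (μ : Fin m → SiteLabel) : Prop := ∃ b : Bool, ∀ i, μ i = some b

open Classical in
/-- The potential of the nontrivial labellings. -/
def potential (μ : Fin m → SiteLabel) : ℝ :=
  if IsTrivialLabel μ then 0 else prodFun potentialValue μ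

lemma potential_nonneg (μ : Fin m → SiteLabel) : 0 ≤ potential μ := by
  unfold potential
  split_ifs
  · exact le_rfl
  · exact prodFun_nonneg potentialValue_nonneg μ

lemma potential_le (μ : Fin m → SiteLabel) : potential μ ≤ prodFun potentialValue μ := by
  unfold potential
  split_ifs
  · exact prodFun_nonneg potentialValue_nonneg μ
  · exact le_rfl

/-- The site values `2 / 3`, `1 / 2` and `1` are tuned: every pair with an initial site shrinks by
exactly `9 / 10`, and a mixed identity-swap pair by `4 / 5`. Labellings that become trivial drop to
zero, which only helps. -/
lemma gateStep_potential_of_isActive {e : Fin 2 → Fin m} (he : Function.Injective e)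
    {μ : Fin m → SiteLabel} (h : IsActive e μ) :
    gateStep e potential μ ≤ 9 / 10 * potential μ := by
  have hnt : ¬ IsTrivialLabel μ := fun ⟨b, hb⟩ => h ⟨b, hb _, hb _⟩
  rw [potential, if_neg hnt]
  refine (gateStep_mono e potential_le μ).trans
    (gateStep_prodFun_le he potentialValue_nonneg μ ?_)
  unfold IsActive at h
  revert h
  unfold idWeight
  generalize μ (e 0) = l
  generalize μ (e 1) = l'
  rcases l with _ | _ | _ <;> rcases l' with _ | _ | _ <;>
    norm_num [swapValue, potentialValue]

-- Inactive gates leave the labelling alone, so the first gate active for the starting labelling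
-- still meets it unchanged and contracts the potential; later gates do not increase it.
open Classical in
lemma chainStep_potential_le (es : List (Fin 2 → Fin m)) (hes : ∀ e ∈ es, Function.Injective e)
    (μ : Fin m → SiteLabel) : chainStep es potential μ ≤
      (if ∃ e ∈ es, IsActive e μ then 9 / 10 else 1) * potential μ := by
  induction es generalizing μ with
  | nil => simp [chainStep]
  | cons e es ih =>
    have hes' : ∀ e ∈ es, Function.Injective e := fun e' h => hes e' (List.mem_cons_of_mem _ h)
    have he := hes e List.mem_cons_self
    simp only [chainStep]
    by_cases h : IsActive e μ
    · rw [if_pos ⟨e, List.mem_cons_self, h⟩]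
      refine le_trans (gateStep_mono e (fun ν => ?_) μ) (gateStep_potential_of_isActive he h)
      refine (ih hes' ν).trans (mul_le_of_le_one_left (potential_nonneg ν) ?_)
      split_ifs <;> norm_num
    · rw [gateStep_of_not_isActive he h]
      refine (ih hes' μ).trans (le_of_eq ?_)
      congr 2
      rw [eq_iff_iff]
      simp [h]

end LabelChain

/-! ### Sweeps over the line contract the potential. -/

section Sweep

variable {M : ℕ}

/-- The pair of the neighbouring sites `i` and `i + 1`. -/
def edgeMap (i : Fin (M + 1)) : Fin 2 → Fin (M + 2) :=
  shiftFin i.val (by omega)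

lemma edgeMap_injective (i : Fin (M + 1)) : Function.Injective (edgeMap i) :=
  shiftFin_injective _ _

/-- The neighbouring pairs, from left to right. -/
def sweep (M : ℕ) : List (Fin 2 → Fin (M + 2)) := (List.finRange (M + 1)).map edgeMap

/-- Repeated sweeps. -/
def sweeps (M : ℕ) : ℕ → List (Fin 2 → Fin (M + 2))
  | 0 => []
  | t + 1 => sweep M ++ sweeps M t

lemma length_sweeps (M t : ℕ) : (sweeps M t).length = t * (M + 1) := by
  induction t with
  | zero => simp [sweeps]
  | succ t ih => simp [sweeps, sweep, ih]; ring

lemma exists_of_mem_sweeps {t : ℕ} {e : Fin 2 → Fin (M + 2)} (he : e ∈ sweeps M t) :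
    ∃ i, e = edgeMap i := by
  induction t with
  | zero => simp [sweeps] at he
  | succ t ih =>
    rcases List.mem_append.1 he with h | h
    · obtain ⟨i, -, rfl⟩ := List.mem_map.1 h
      exact ⟨i, rfl⟩
    · exact ih h

lemma isTrivialLabel_of_not_isActive {μ : Fin (M + 2) → SiteLabel}
    (h : ∀ i : Fin (M + 1), ¬ IsActive (edgeMap i) μ) : IsTrivialLabel μ := by
  have h' : ∀ i : Fin (M + 1), ∃ b : Bool, μ i.castSucc = some b ∧ μ i.succ = some b := by
    intro i
    obtain ⟨b, h0, h1⟩ := not_not.1 (h i)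
    have e0 : edgeMap i 0 = i.castSucc := by ext; simp [edgeMap, shiftFin]
    have e1 : edgeMap i 1 = i.succ := by ext; simp [edgeMap, shiftFin]
    exact ⟨b, e0 ▸ h0, e1 ▸ h1⟩
  obtain ⟨b, hb, -⟩ := h' 0
  refine ⟨b, fun i => ?_⟩
  induction i using Fin.induction with
  | zero => exact hb
  | succ i ih =>
    obtain ⟨b', h1, h2⟩ := h' i
    rw [h2, ← h1, ih]

/-- A sweep visits every edge, and by connectedness of the line a nontrivial labelling has an active
one. For a trivial labelling the potential is already zero. -/
lemma chainStep_sweep_potential_le (μ : Fin (M + 2) → SiteLabel) :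
    chainStep (sweep M) potential μ ≤ 9 / 10 * potential μ := by
  classical
  have hes : ∀ e ∈ sweep M, Function.Injective e := by
    intro e he
    obtain ⟨i, -, rfl⟩ := List.mem_map.1 he
    exact edgeMap_injective i
  have h := chainStep_potential_le (sweep M) hes μ
  split_ifs at h with hact
  · exact h
  · have htriv : IsTrivialLabel μ := isTrivialLabel_of_not_isActive fun i hi =>
      hact ⟨edgeMap i, List.mem_map.2 ⟨i, List.mem_finRange i, rfl⟩, hi⟩
    have h0 : potential μ = 0 := if_pos htriv
    rw [h0] at h ⊢
    simpa using h

lemma chainStep_sweeps_potential_le (t : ℕ) (μ : Fin (M + 2) → SiteLabel) :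
    chainStep (sweeps M t) potential μ ≤ (9 / 10) ^ t * potential μ := by
  induction t generalizing μ with
  | zero => simp [sweeps, chainStep]
  | succ t ih =>
    rw [sweeps, chainStep_append]
    refine (chainStep_mono _ ih μ).trans ?_
    rw [chainStep_mul, pow_succ, mul_assoc]
    exact mul_le_mul_of_nonneg_left (chainStep_sweep_potential_le μ) (by positivity)

end Sweep

/-! ### Gates acting on second moment tensors -/

section Tensors

variable {m : ℕ}

/-- Tensors with four legs, each of them a register of `m` qubits. -/
abbrev Tensor (m : ℕ) : Type := (Fin 4 → BitString m) → ℂ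

/-- Apply an operator to the qubits `e 0` and `e 1` of each leg. -/
def act (e : Fin 2 → Fin m) (R : Matrix (Fin 4 → BitString 2) (Fin 4 → BitString 2) ℂ) :
    Tensor m →ₗ[ℂ] Tensor m where
  toFun M := fun X => ∑ Y, R (fun s => X s ∘ e) Y * M (fun s => Function.extend e (Y s) (X s))
  map_add' M N := by
    funext X
    simp only [Pi.add_apply, mul_add, Finset.sum_add_distrib]
  map_smul' c M := by
    funext X
    simp only [Pi.smul_apply, smul_eq_mul, RingHom.id_apply, Finset.mul_sum]
    exact Finset.sum_congr rfl fun Y _ => by ring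

lemma act_apply (e : Fin 2 → Fin m) (R : Matrix (Fin 4 → BitString 2) (Fin 4 → BitString 2) ℂ)
    (M : Tensor m) (X : Fin 4 → BitString m) : act e R M X =
      ∑ Y, R (fun s => X s ∘ e) Y * M (fun s => Function.extend e (Y s) (X s)) := rfl

variable {e : Fin 2 → Fin m} {A B R : Matrix (Fin 4 → BitString 2) (Fin 4 → BitString 2) ℂ}

lemma act_sub_left (e : Fin 2 → Fin m) (M : Tensor m) : act e (A - B) M = act e A M - act e B M := by
  funext X
  simp only [act_apply, Pi.sub_apply, Matrix.sub_apply, sub_mul, Finset.sum_sub_distrib]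

lemma act_smul_sum_left (e : Fin 2 → Fin m) (c : ℂ) {J : Type*} (s : Finset J)
    (F : J → Matrix (Fin 4 → BitString 2) (Fin 4 → BitString 2) ℂ) (M : Tensor m) :
    act e (c • ∑ j ∈ s, F j) M = ∑ j ∈ s, c • act e (F j) M := by
  funext X
  simp only [act_apply, Finset.sum_apply, Pi.smul_apply, Matrix.smul_apply, Matrix.sum_apply,
    smul_eq_mul, Finset.mul_sum, Finset.sum_mul]
  rw [Finset.sum_comm]
  exact Finset.sum_congr rfl fun j _ => Finset.sum_congr rfl fun Y _ => by ring

lemma extend_extend (he : Function.Injective e) (x : BitString m) (y z : BitString 2) :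
    Function.extend e y (Function.extend e z x) = Function.extend e y x := by
  funext i
  by_cases hi : ∃ j, e j = i
  · obtain ⟨j, rfl⟩ := hi
    rw [he.extend_apply, he.extend_apply]
  · have hi' : ∀ j, e j ≠ i := fun j hj => hi ⟨j, hj⟩
    rw [extend_apply_off _ _ hi', extend_apply_off _ _ hi', extend_apply_off _ _ hi']

lemma act_mul (he : Function.Injective e) (M : Tensor m) :
    act e (A * B) M = act e A (act e B M) := by
  funext X
  simp only [act_apply, Matrix.mul_apply, extend_comp_self he, extend_extend he, Finset.sum_mul,
    Finset.mul_sum]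
  rw [Finset.sum_comm]
  exact Finset.sum_congr rfl fun Y _ => Finset.sum_congr rfl fun Z _ => by ring

lemma act_one (he : Function.Injective e) (M : Tensor m) : act e 1 M = M := by
  funext X
  rw [act_apply, Finset.sum_eq_single (fun s => X s ∘ e)]
  · rw [Matrix.one_apply_eq, one_mul]
    congr 1
    funext s
    exact extend_eq_of_agree he fun _ _ => rfl
  · intro Y _ hY
    rw [Matrix.one_apply_ne hY.symm, zero_mul]
  · simp

/-- Each leg evolves separately, so a product of four sums over inputs becomes one sum over
quadruples. -/
lemma act_moment (he : Function.Injective e) (g : Op 2) (ψ : BitString m → ℂ) :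
    act e (moment g) (vecMoment ψ) = vecMoment (embedOp e g *ᵥ ψ) := by
  funext X
  simp only [act_apply, vecMoment, moment, embedOp_mulVec he, map_sum, map_mul]
  rw [prod_sum_legs]
  simp only [Finset.prod_mul_distrib]

lemma norm_act_le (e : Fin 2 → Fin m) {M : Tensor m} {ρ b : ℝ} (hR : ∀ X Y, ‖R X Y‖ ≤ ρ)
    (hM : ∀ X, ‖M X‖ ≤ b) (X : Fin 4 → BitString m) : ‖act e R M X‖ ≤ 256 * (ρ * b) := by
  rw [act_apply]
  refine (norm_sum_le _ _).trans ?_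
  have hρ : 0 ≤ ρ := (norm_nonneg _).trans (hR (fun s => X s ∘ e) (fun s => X s ∘ e))
  calc _ ≤ ∑ _Y : Fin 4 → BitString 2, ρ * b := by
        refine Finset.sum_le_sum fun Y _ => ?_
        rw [norm_mul]
        exact mul_le_mul (hR _ _) (hM _) (norm_nonneg _) hρ
    _ = 256 * (ρ * b) := by
        rw [Finset.sum_const, nsmul_eq_mul, Finset.card_univ, Fintype.card_fun, card_bitString]
        norm_num

/-- Apply an operator to a sequence of pairs of qubits. -/
def runGates (R : Matrix (Fin 4 → BitString 2) (Fin 4 → BitString 2) ℂ) :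
    List (Fin 2 → Fin m) → Tensor m →ₗ[ℂ] Tensor m
  | [] => LinearMap.id
  | e :: es => runGates R es ∘ₗ act e R

lemma runGates_cons (e : Fin 2 → Fin m) (es : List (Fin 2 → Fin m)) (M : Tensor m) :
    runGates R (e :: es) M = runGates R es (act e R M) := rfl

/-- The tensor of a labelling. -/
def labelTensor (μ : Fin m → SiteLabel) : Tensor m :=
  fun X => ∏ i, siteTensor (μ i) (fun s => X s i)

lemma norm_labelTensor_le (μ : Fin m → SiteLabel) (X : Fin 4 → BitString m) :
    ‖labelTensor μ X‖ ≤ 1 := by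
  rw [labelTensor, norm_prod]
  exact Finset.prod_le_one (fun _ _ => norm_nonneg _) fun _ _ => norm_siteTensor_le _ _

open Classical in
lemma labelTensor_split (he : Function.Injective e) (μ : Fin m → SiteLabel)
    (X : Fin 4 → BitString m) : labelTensor μ X =
      pairTensor (μ (e 0)) (μ (e 1)) (fun s => X s ∘ e) *
        ∏ i with ∀ j, e j ≠ i, siteTensor (μ i) (fun s => X s i) :=
  prod_split he fun i => siteTensor (μ i) (fun s => X s i)

/-- Only the factor of the two acted sites changes. Hence an ideal random gate keeps mixtures of
label tensors and performs one step of the chain. -/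
lemma act_labelTensor (he : Function.Injective e) (μ : Fin m → SiteLabel)
    (hR : ∀ l l', R *ᵥ pairTensor l l' = (idWeight l l' : ℂ) • pairTensor (some true) (some true) +
      (1 - idWeight l l' : ℂ) • pairTensor (some false) (some false)) :
    act e R (labelTensor μ) =
      (idWeight (μ (e 0)) (μ (e 1)) : ℂ) • labelTensor (setPair e true μ) +
      (1 - idWeight (μ (e 0)) (μ (e 1)) : ℂ) • labelTensor (setPair e false μ) := by
  classical
  funext X
  have hset : ∀ b : Bool, labelTensor (setPair e b μ) X =
      pairTensor (some b) (some b) (fun s => X s ∘ e) *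
        ∏ i with ∀ j, e j ≠ i, siteTensor (μ i) (fun s => X s i) := by
    intro b
    rw [labelTensor_split he, setPair_apply he, setPair_apply he]
    congr 1
    refine Finset.prod_congr rfl fun i hi => ?_
    rw [setPair_apply_off b μ (Finset.mem_filter.1 hi).2]
  have hext : ∀ Y : Fin 4 → BitString 2,
      labelTensor μ (fun s => Function.extend e (Y s) (X s)) =
      pairTensor (μ (e 0)) (μ (e 1)) Y *
        ∏ i with ∀ j, e j ≠ i, siteTensor (μ i) (fun s => X s i) := by
    intro Y
    rw [labelTensor_split he]
    simp only [extend_comp_self he]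
    congr 1
    refine Finset.prod_congr rfl fun i hi => ?_
    congr 1
    funext s
    exact extend_apply_off _ _ (Finset.mem_filter.1 hi).2
  simp only [act_apply, hext, Pi.add_apply, Pi.smul_apply, smul_eq_mul, hset, ← mul_assoc]
  rw [← Finset.sum_mul]
  have h := congrFun (hR (μ (e 0)) (μ (e 1))) (fun s => X s ∘ e)
  simp only [Matrix.mulVec, dotProduct, Pi.add_apply, Pi.smul_apply, smul_eq_mul] at h
  rw [h]
  ring

/-- A linear functional is at most, after ideal random gates, the expectation of a bound on its
values on labellings. -/
lemma norm_runGates_labelTensor_le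
    (hR : ∀ l l', R *ᵥ pairTensor l l' = (idWeight l l' : ℂ) • pairTensor (some true) (some true) +
      (1 - idWeight l l' : ℂ) • pairTensor (some false) (some false))
    (f : Tensor m →ₗ[ℂ] ℂ) (F : (Fin m → SiteLabel) → ℝ) (hF : ∀ μ, ‖f (labelTensor μ)‖ ≤ F μ)
    (es : List (Fin 2 → Fin m)) (hes : ∀ e ∈ es, Function.Injective e) (μ : Fin m → SiteLabel) :
    ‖f (runGates R es (labelTensor μ))‖ ≤ chainStep es F μ := by
  induction es generalizing μ with
  | nil => exact hF μ
  | cons e es ih =>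
    have ih' := ih fun e' h => hes e' (List.mem_cons_of_mem _ h)
    rw [runGates_cons, act_labelTensor (hes e List.mem_cons_self) μ hR]
    simp only [map_add, map_smul, smul_eq_mul, chainStep, gateStep]
    have h0 := idWeight_nonneg (μ (e 0)) (μ (e 1))
    have h1 := idWeight_le_one (μ (e 0)) (μ (e 1))
    refine (norm_add_le _ _).trans (add_le_add ?_ ?_)
    · rw [norm_mul, Complex.norm_real, Real.norm_of_nonneg h0]
      exact mul_le_mul_of_nonneg_left (ih' _) h0
    · rw [norm_mul, ← Complex.ofReal_one, ← Complex.ofReal_sub, Complex.norm_real,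
        Real.norm_of_nonneg (by linarith)]
      exact mul_le_mul_of_nonneg_left (ih' _) (by linarith)

end Tensors

/-! ### Moment tensors of circuits -/

section CircuitTensors

variable {G : GateSet} {m : ℕ}

/-- The second moment tensors of the states prepared by circuits of depth `d`. -/
def circuitTensors (G : GateSet) (m d : ℕ) : Set (Tensor m) :=
  {M | ∃ U, IsCircuit G m d U ∧ M = vecMoment (fun x => U x (fun _ => false))}

/-- Amplitudes of a state have modulus at most `1`, and the bound survives mixing. It keeps the
approximation error from being multiplied by a growing tensor. -/
lemma norm_le_one_of_mem_convexHull {d : ℕ} {M : Tensor m}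
    (hM : M ∈ convexHull ℝ (circuitTensors G m d)) (X : Fin 4 → BitString m) : ‖M X‖ ≤ 1 := by
  have hconv : Convex ℝ {M : Tensor m | ‖M X‖ ≤ 1} := by
    have := (convex_closedBall (0 : ℂ) 1).is_linear_preimage
      (f := fun M : Tensor m => M X) ⟨fun _ _ => rfl, fun _ _ => rfl⟩
    simpa [Set.preimage] using this
  refine convexHull_min ?_ hconv hM
  rintro _ ⟨U, hU, rfl⟩
  change ‖vecMoment _ X‖ ≤ 1
  rw [vecMoment, norm_prod]
  refine Finset.prod_le_one (fun _ _ => norm_nonneg _) fun s _ => ?_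
  rw [norm_legHom]
  have h := sum_norm_sq_col hU.mem_unitary (fun _ => false)
  have h2 := Finset.single_le_sum (f := fun a => ‖U a (fun _ => false)‖ ^ 2)
    (fun a _ => sq_nonneg _) (Finset.mem_univ (X s))
  rw [h] at h2
  exact (sq_le_one_iff₀ (norm_nonneg _)).1 h2

/-- The average of the moments of a finite set of two-qubit operators. -/
def averageMoment (s : Finset (Op 2)) : Matrix (Fin 4 → BitString 2) (Fin 4 → BitString 2) ℂ :=
  (s.card : ℂ)⁻¹ • ∑ V ∈ s, moment V

/-- Averaging moments means drawing the next two-qubit circuit at random. The hull keeps track of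
the fact that the tensor comes from a finite distribution over actual circuits. -/
lemma act_averageMoment_mem {s : Finset (Op 2)} (hs : s.Nonempty) {d₀ d : ℕ}
    (hV : ∀ V ∈ s, IsCircuit G 2 d₀ V) (a : ℕ) (h : a + 2 ≤ m) {M : Tensor m}
    (hM : M ∈ convexHull ℝ (circuitTensors G m d)) :
    act (shiftFin a h) (averageMoment s) M ∈ convexHull ℝ (circuitTensors G m (d₀ + d)) := by
  have hconv : Convex ℝ {M : Tensor m | act (shiftFin a h) (averageMoment s) M ∈
      convexHull ℝ (circuitTensors G m (d₀ + d))} :=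
    (convex_convexHull ℝ _).linear_preimage
      ((act (shiftFin a h) (averageMoment s)).restrictScalars ℝ)
  refine convexHull_min ?_ hconv hM
  rintro _ ⟨U, hU, rfl⟩
  have hcard : (0 : ℝ) < s.card := by exact_mod_cast hs.card_pos
  have h1 : act (shiftFin a h) (averageMoment s) (vecMoment fun x => U x fun _ => false) =
      ∑ V ∈ s, ((s.card : ℝ)⁻¹) •
        vecMoment (fun x => (embedOp (shiftFin a h) V * U) x fun _ => false) := by
    rw [averageMoment, act_smul_sum_left]
    refine Finset.sum_congr rfl fun V _ => ?_
    rw [act_moment (shiftFin_injective a h)]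
    funext X
    simp only [Pi.smul_apply, smul_eq_mul, Complex.real_smul]
    push_cast
    rfl
  rw [Set.mem_ofPred_eq, h1]
  refine (convex_convexHull ℝ _).sum_mem (fun _ _ => by positivity) ?_ fun V hVs =>
    subset_convexHull ℝ _ ⟨_, ((hV V hVs).shift a h).mul hU, rfl⟩
  rw [Finset.sum_const, nsmul_eq_mul, mul_inv_cancel₀ hcard.ne']

lemma act_averageMoment_pow_mem {s : Finset (Op 2)} (hs : s.Nonempty) {d₀ d : ℕ}
    (hV : ∀ V ∈ s, IsCircuit G 2 d₀ V) (a : ℕ) (h : a + 2 ≤ m) (k : ℕ) {M : Tensor m}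
    (hM : M ∈ convexHull ℝ (circuitTensors G m d)) :
    act (shiftFin a h) (averageMoment s ^ k) M ∈
      convexHull ℝ (circuitTensors G m (k * d₀ + d)) := by
  induction k with
  | zero => simpa [act_one (shiftFin_injective a h)] using hM
  | succ k ih =>
    rw [pow_succ', act_mul (shiftFin_injective a h)]
    have := act_averageMoment_mem hs hV a h ih
    rwa [show (k + 1) * d₀ + d = d₀ + (k * d₀ + d) by ring]

lemma runGates_mem {s : Finset (Op 2)} (hs : s.Nonempty) {d₀ d : ℕ}
    (hV : ∀ V ∈ s, IsCircuit G 2 d₀ V) (k : ℕ) (es : List (Fin 2 → Fin m))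
    (hes : ∀ e ∈ es, ∃ (a : ℕ) (h : a + 2 ≤ m), e = shiftFin a h) {M : Tensor m}
    (hM : M ∈ convexHull ℝ (circuitTensors G m d)) :
    runGates (averageMoment s ^ k) es M ∈
      convexHull ℝ (circuitTensors G m (es.length * (k * d₀) + d)) := by
  induction es generalizing M d with
  | nil => simpa [runGates] using hM
  | cons e es ih =>
    obtain ⟨a, h, rfl⟩ := hes e List.mem_cons_self
    have h1 := ih (fun e' he' => hes e' (List.mem_cons_of_mem _ he'))
      (act_averageMoment_pow_mem hs hV a h k hM)
    rw [runGates_cons, List.length_cons,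
      show (es.length + 1) * (k * d₀) + d = es.length * (k * d₀) + (k * d₀ + d) by ring]
    exact h1

/-- The difference between real and ideal random gates. -/
lemma norm_runGates_sub_le {s : Finset (Op 2)} (hs : s.Nonempty) {d₀ d : ℕ}
    (hV : ∀ V ∈ s, IsCircuit G 2 d₀ V) (k : ℕ)
    {P : Matrix (Fin 4 → BitString 2) (Fin 4 → BitString 2) ℂ} (hP : ∀ X Y, ‖P X Y‖ ≤ 1)
    {η : ℝ} (hη : ∀ X Y, ‖(averageMoment s ^ k - P) X Y‖ ≤ η) (es : List (Fin 2 → Fin m))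
    (hes : ∀ e ∈ es, ∃ (a : ℕ) (h : a + 2 ≤ m), e = shiftFin a h) {M N : Tensor m}
    (hM : M ∈ convexHull ℝ (circuitTensors G m d)) {ε : ℝ} (hMN : ∀ X, ‖(M - N) X‖ ≤ ε)
    (X : Fin 4 → BitString m) :
    ‖(runGates (averageMoment s ^ k) es M - runGates P es N) X‖ ≤
      512 ^ es.length * (ε + η) := by
  have hη0 : 0 ≤ η := (norm_nonneg _).trans (hη (fun _ _ => false) (fun _ _ => false))
  induction es generalizing M N d ε with
  | nil =>
    have := hMN X
    simp only [runGates, LinearMap.id_apply, List.length_nil, pow_zero, one_mul]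
    linarith
  | cons e es ih =>
    have hε0 : 0 ≤ ε := (norm_nonneg _).trans (hMN X)
    have hes' := fun e' he' => hes e' (List.mem_cons_of_mem e he')
    obtain ⟨a, h, rfl⟩ := hes e List.mem_cons_self
    rw [runGates_cons, runGates_cons]
    have hstep : ∀ X, ‖(act (shiftFin a h) (averageMoment s ^ k) M -
        act (shiftFin a h) P N) X‖ ≤ 256 * η + 256 * ε := by
      intro X
      -- The defect of the real gate acts on the bounded tensor `M`, while the ideal gate magnifies
      -- the earlier error by at most `256`, the number of its columns. Both contributions fit into
      -- the factor `512` per gate.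
      have heq : act (shiftFin a h) (averageMoment s ^ k) M - act (shiftFin a h) P N =
          act (shiftFin a h) (averageMoment s ^ k - P) M + act (shiftFin a h) P (M - N) := by
        rw [act_sub_left, map_sub]; abel
      rw [heq, Pi.add_apply]
      refine (norm_add_le _ _).trans (add_le_add ?_ ?_)
      · simpa using norm_act_le (shiftFin a h) hη (norm_le_one_of_mem_convexHull hM) X
      · simpa using norm_act_le (shiftFin a h) hP hMN X
    refine (ih hes' (act_averageMoment_pow_mem hs hV a h k hM) hstep).trans ?_
    rw [List.length_cons, pow_succ, mul_assoc]
    refine mul_le_mul_of_nonneg_left ?_ (by positivity)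
    linarith

end CircuitTensors

/-! ### Variances of observables -/

section QuadForm

variable {m : ℕ}

/-- The functional on second moment tensors which returns the squared expectation of `D`. -/
def quadForm (D : Op m) : Tensor m →ₗ[ℂ] ℂ where
  toFun M := ∑ X, M X * (D (X 1) (X 0) * D (X 3) (X 2))
  map_add' M N := by simp only [Pi.add_apply, add_mul, Finset.sum_add_distrib]
  map_smul' c M := by
    simp only [Pi.smul_apply, smul_eq_mul, RingHom.id_apply, Finset.mul_sum, mul_assoc]

lemma quadForm_apply (D : Op m) (M : Tensor m) :
    quadForm D M = ∑ X, M X * (D (X 1) (X 0) * D (X 3) (X 2)) := rfl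

lemma quadForm_vecMoment (D : Op m) (ψ : BitString m → ℂ) :
    quadForm D (vecMoment ψ) = (star ψ ⬝ᵥ D *ᵥ ψ) ^ 2 := by
  rw [quadForm_apply, sum_fin_four, sq]
  simp only [vecMoment, Fin.prod_univ_four, legHom_zero, legHom_one, legHom_two, legHom_three,
    Matrix.cons_val_zero, Matrix.cons_val_one, Matrix.cons_val]
  have h : star ψ ⬝ᵥ D *ᵥ ψ = ∑ a, ∑ b, star (ψ b) * D b a * ψ a := by
    simp only [dotProduct, Matrix.mulVec, Pi.star_apply, Finset.mul_sum]
    rw [Finset.sum_comm]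
    exact Finset.sum_congr rfl fun a _ => Finset.sum_congr rfl fun b _ => by ring
  rw [h]
  simp only [Finset.sum_mul, Finset.mul_sum]
  exact Finset.sum_congr rfl fun a _ => Finset.sum_congr rfl fun b _ =>
    Finset.sum_congr rfl fun c _ => Finset.sum_congr rfl fun d _ => by ring

lemma labelTensor_id : labelTensor (fun _ : Fin m => some true) =
    ((4 : ℂ)⁻¹) ^ m • idTensor (BitString m) := by
  funext X
  simp only [labelTensor, siteTensor, Pi.smul_apply, smul_eq_mul, Finset.prod_mul_distrib,
    Finset.prod_const, Finset.card_univ, Fintype.card_fin]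
  congr 1
  simp only [idTensor]
  rw [Finset.prod_ite_zero]
  simp [funext_iff, forall_and]

lemma labelTensor_swap : labelTensor (fun _ : Fin m => some false) =
    ((2 : ℂ)⁻¹) ^ m • swapTensor (BitString m) := by
  funext X
  simp only [labelTensor, siteTensor, Pi.smul_apply, smul_eq_mul, Finset.prod_mul_distrib,
    Finset.prod_const, Finset.card_univ, Fintype.card_fin]
  congr 1
  simp only [swapTensor]
  rw [Finset.prod_ite_zero]
  simp [funext_iff, forall_and]

lemma labelTensor_none : labelTensor (fun _ : Fin m => none) =
    vecMoment (fun x => (1 : Op m) x (fun _ => false)) := by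
  funext X
  simp only [labelTensor, siteTensor, vecMoment, Matrix.one_apply]
  rw [Finset.prod_ite_zero]
  have h : ∀ s, legHom s (if X s = (fun _ => false) then (1 : ℂ) else 0) =
      if X s = (fun _ => false) then 1 else 0 := by
    intro s; split_ifs <;> simp
  simp only [h]
  rw [Finset.prod_ite_zero]
  have hiff : (∀ i ∈ (Finset.univ : Finset (Fin m)), (fun s => X s i) = fun _ => false) ↔
      ∀ s ∈ Finset.univ, X s = fun _ => false := by
    simp only [funext_iff, Finset.mem_univ, true_imp_iff]
    exact forall_comm
  by_cases h1 : ∀ s ∈ Finset.univ, X s = fun _ => false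
  · rw [if_pos h1, if_pos (hiff.2 h1)]
    simp
  · rw [if_neg h1, if_neg (hiff.not.2 h1)]

lemma quadForm_idTensor (D : Op m) : quadForm D (idTensor (BitString m)) = D.trace ^ 2 := by
  rw [quadForm_apply, sum_fin_four, sq]
  have h1 : ∀ a b c d : BitString m, idTensor (BitString m) ![a, b, c, d] * (D b a * D d c) =
      if b = a then (if d = c then D b a * D d c else 0) else 0 := by
    intro a b c d
    simp only [idTensor, Matrix.cons_val_zero, Matrix.cons_val_one, Matrix.cons_val]
    by_cases h1 : b = a <;> by_cases h2 : d = c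
    · simp [h1, h2]
    · simp [h1, h2, Ne.symm h2]
    · simp [h1, Ne.symm h1]
    · simp [h1, Ne.symm h1]
  simp only [Matrix.cons_val_zero, Matrix.cons_val_one, Matrix.cons_val, h1,
    Finset.sum_ite_irrel, Finset.sum_const_zero, Finset.sum_ite_eq', Finset.mem_univ, if_true]
  simp only [Matrix.trace, Matrix.diag, Finset.sum_mul_sum]

lemma quadForm_swapTensor (D : Op m) :
    quadForm D (swapTensor (BitString m)) = (D * D).trace := by
  rw [quadForm_apply, sum_fin_four]
  have h1 : ∀ a b c d : BitString m, swapTensor (BitString m) ![a, b, c, d] * (D b a * D d c) =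
      if d = a then (if c = b then D b a * D d c else 0) else 0 := by
    intro a b c d
    simp only [swapTensor, Matrix.cons_val_zero, Matrix.cons_val_one, Matrix.cons_val]
    by_cases h1 : d = a <;> by_cases h2 : c = b
    · simp [h1, h2]
    · simp [h1, h2]
    · simp [h1, Ne.symm h1]
    · simp [h1, Ne.symm h1]
  simp only [Matrix.cons_val_zero, Matrix.cons_val_one, Matrix.cons_val, h1,
    Finset.sum_ite_eq', Finset.mem_univ, if_true]
  simp only [Matrix.trace, Matrix.diag, Matrix.mul_apply]
  exact Finset.sum_congr rfl fun a _ => Finset.sum_congr rfl fun b _ => mul_comm _ _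

lemma norm_quadForm_le {D : Op m} {M : Tensor m} {b K : ℝ} (hM : ∀ X, ‖M X‖ ≤ b)
    (hD : ∀ x y, ‖D x y‖ ≤ K) : ‖quadForm D M‖ ≤ 16 ^ m * (b * K ^ 2) := by
  rw [quadForm_apply]
  refine (norm_sum_le _ _).trans ?_
  have hK : 0 ≤ K := (norm_nonneg _).trans (hD (fun _ => false) fun _ => false)
  have hb : 0 ≤ b := (norm_nonneg _).trans (hM fun _ _ => false)
  calc _ ≤ ∑ _X : Fin 4 → BitString m, b * K ^ 2 := by
        refine Finset.sum_le_sum fun X _ => ?_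
        rw [norm_mul, norm_mul, sq]
        exact mul_le_mul (hM X) (mul_le_mul (hD _ _) (hD _ _) (norm_nonneg _) hK)
          (by positivity) hb
    _ = 16 ^ m * (b * K ^ 2) := by
        rw [Finset.sum_const, nsmul_eq_mul, Finset.card_univ, Fintype.card_fun, card_bitString,
          Fintype.card_fin]
        push_cast
        rw [← pow_mul, mul_comm m 4, pow_mul]
        norm_num

end QuadForm

/-! ### Random circuits -/

section RandomCircuits

/-- All identities give a multiple of the squared trace, which is zero. All swaps give `2 ^ (-m)`
times the trace of `D * D`, at most `1`, which is the conserved value. For other labellings the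
crude bound `4 * 64 ^ m` is paid by the potential, which is at least `2 ^ (-m)`. -/
lemma quadForm_labelTensor_le {m : ℕ} {D : Op m} (htr : D.trace = 0)
    (hsq : ‖(D * D).trace‖ ≤ 2 ^ m) (hD : ∀ x y, ‖D x y‖ ≤ 2 ^ (m + 1)) (μ : Fin m → SiteLabel) :
    ‖quadForm D (labelTensor μ)‖ ≤ prodFun conservedValue μ + 4 * 128 ^ m * potential μ := by
  have hc0 : ∀ l, 0 ≤ conservedValue l := by
    intro l; rcases l with _ | _ | _ <;> norm_num [conservedValue, swapValue]
  have hc := prodFun_nonneg hc0 μ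
  by_cases h : IsTrivialLabel μ
  · rw [potential, if_pos h, mul_zero, add_zero]
    obtain ⟨b, hb⟩ := h
    obtain rfl : μ = fun _ => some b := funext hb
    cases b
    · rw [labelTensor_swap, map_smul, quadForm_swapTensor, smul_eq_mul, norm_mul, norm_pow,
        norm_inv, Complex.norm_ofNat]
      have h1 : prodFun conservedValue (fun _ : Fin m => some false) = 1 := by
        simp [prodFun, conservedValue, swapValue]
      rw [h1, inv_pow]
      calc _ ≤ ((2 : ℝ) ^ m)⁻¹ * 2 ^ m := by gcongr
        _ = 1 := inv_mul_cancel₀ (by positivity)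
    · rw [labelTensor_id, map_smul, quadForm_idTensor, htr]
      simpa using hc
  · rw [potential, if_neg h]
    have h1 : (1 / 2 : ℝ) ^ m ≤ prodFun potentialValue μ := by
      have : ∏ _i : Fin m, (1 / 2 : ℝ) ≤ ∏ i, potentialValue (μ i) := by
        refine Finset.prod_le_prod (fun _ _ => by norm_num) fun i _ => ?_
        rcases μ i with _ | _ | _ <;> norm_num [potentialValue]
      simpa [prodFun] using this
    refine (norm_quadForm_le (norm_labelTensor_le μ) hD).trans ?_
    have h2 : (16 : ℝ) ^ m * (1 * (2 ^ (m + 1)) ^ 2) = 4 * 128 ^ m * (1 / 2) ^ m := by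
      rw [mul_assoc 4, ← mul_pow, pow_succ 2 m, mul_pow, ← pow_mul, mul_comm m 2, pow_mul]
      rw [show (128 * (1 / 2) : ℝ) = 16 * 2 ^ 2 by norm_num, mul_pow]
      ring
    rw [h2]
    have h3 : 4 * 128 ^ m * (1 / 2 : ℝ) ^ m ≤ 4 * 128 ^ m * prodFun potentialValue μ := by gcongr
    linarith

/-- The initial labelling has conserved value `2 ^ (-m)` for `m = M + 2`, and the potential term
adds at most four times as much after the sweeps. -/
lemma norm_quadForm_ideal_le {M : ℕ} {D : Op (M + 2)} (htr : D.trace = 0)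
    (hsq : ‖(D * D).trace‖ ≤ 2 ^ (M + 2)) (hD : ∀ x y, ‖D x y‖ ≤ 2 ^ (M + 3))
    {P : Matrix (Fin 4 → BitString 2) (Fin 4 → BitString 2) ℂ}
    (hP : ∀ l l', P *ᵥ pairTensor l l' = (idWeight l l' : ℂ) • pairTensor (some true) (some true) +
      (1 - idWeight l l' : ℂ) • pairTensor (some false) (some false)) :
    ‖quadForm D (runGates P (sweeps M (60 * (M + 2))) (labelTensor fun _ => none))‖ ≤
      5 * (2 ^ (M + 2))⁻¹ := by
  have hes : ∀ e ∈ sweeps M (60 * (M + 2)), Function.Injective e := by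
    intro e he
    obtain ⟨i, rfl⟩ := exists_of_mem_sweeps he
    exact edgeMap_injective i
  refine (norm_runGates_labelTensor_le hP (quadForm D) _ (quadForm_labelTensor_le htr hsq hD)
    _ hes _).trans ?_
  rw [chainStep_add_mul]
  have h1 := chainStep_conserved_le _ hes fun _ => none
  have h2 := chainStep_sweeps_potential_le (M := M) (60 * (M + 2)) fun _ => none
  have h3 : prodFun conservedValue (fun _ : Fin (M + 2) => none) = (2 ^ (M + 2))⁻¹ := by
    simp [prodFun, conservedValue, swapValue]
  have h4 : potential (fun _ : Fin (M + 2) => none) ≤ 1 := by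
    refine (potential_le _).trans (Finset.prod_le_one (fun _ _ => potentialValue_nonneg _) ?_)
    intro i _
    norm_num [potentialValue]
  -- Sixty sweeps per qubit are enough since `128 * (9 / 10) ^ 60 ≤ 1 / 2`.
  have h5 : (128 : ℝ) ^ (M + 2) * (9 / 10) ^ (60 * (M + 2)) ≤ (2 ^ (M + 2))⁻¹ := by
    rw [pow_mul, ← mul_pow, ← inv_pow]
    exact pow_le_pow_left₀ (by positivity) (by norm_num) _
  have h6 : (9 / 10 : ℝ) ^ (60 * (M + 2)) * potential (fun _ : Fin (M + 2) => none) ≤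
      (9 / 10) ^ (60 * (M + 2)) := mul_le_of_le_one_right (by positivity) h4
  have h7 : 4 * 128 ^ (M + 2) * chainStep (sweeps M (60 * (M + 2))) potential (fun _ => none) ≤
      4 * 128 ^ (M + 2) * (9 / 10) ^ (60 * (M + 2)) := by
    gcongr
    exact h2.trans h6
  rw [h3] at h1
  linarith

lemma circuitTensors_mono {G : GateSet} {m d d' : ℕ} (h : d ≤ d') :
    circuitTensors G m d ⊆ circuitTensors G m d' :=
  fun _ ⟨U, hU, hM⟩ => ⟨U, hU.mono h, hM⟩

/-- Random circuits of polynomial depth over a universal gate set: the second moment of the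
expectation of a traceless observable is exponentially small. -/
theorem GateSet.Universal.exists_random_circuit {G : GateSet} (hG : G.Universal) :
    ∃ C : ℕ, ∀ M : ℕ, ∃ T ∈ convexHull ℝ (circuitTensors G (M + 2) (C * (M + 2) ^ 4)),
      ∀ D : Op (M + 2), D.trace = 0 → ‖(D * D).trace‖ ≤ 2 ^ (M + 2) →
        (∀ x y, ‖D x y‖ ≤ 2 ^ (M + 3)) → ‖quadForm D T‖ ≤ 6 * (2 ^ (M + 2))⁻¹ := by
  obtain ⟨s, d₀, P, r, hs, hV, hr0, hr1, hL, hP, h1, h2⟩ := hG.exists_moment_average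
  obtain ⟨c, hc⟩ := exists_pow_lt_of_lt_one (show (0 : ℝ) < 1 / 2 by norm_num) hr1
  -- At most `60 * (M + 2) ^ 2` gates run in sequence, each replaced by `(c + 1) * 549 * (M + 2) ^
  -- 2` random circuits of depth `d₀`; `c + 1` of these reduce the error by a factor of at least
  -- two.
  refine ⟨60 * ((c + 1) * 549 * d₀), fun M => ?_⟩
  -- The part `540 = 9 * 60` compensates the error growth `512 = 2 ^ 9` per gate, and the rest
  -- covers the remaining `7 * (M + 2) + 2` bits.
  obtain ⟨E, hE⟩ : ∃ E, E = 549 * (M + 2) ^ 2 := ⟨_, rfl⟩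
  have hE0 : 0 < E := by rw [hE]; positivity
  set es := sweeps M (60 * (M + 2)) with hes
  set k := (c + 1) * E with hk
  have hes' : ∀ e ∈ es, ∃ (a : ℕ) (h : a + 2 ≤ M + 2), e = shiftFin a h := by
    intro e he
    obtain ⟨i, rfl⟩ := exists_of_mem_sweeps he
    exact ⟨i.val, by omega, rfl⟩
  have hlen : es.length ≤ 60 * (M + 2) ^ 2 := by
    rw [hes, length_sweeps, sq, ← mul_assoc]
    gcongr
    omega
  have hmem : labelTensor (fun _ : Fin (M + 2) => none) ∈
      convexHull ℝ (circuitTensors G (M + 2) 0) :=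
    subset_convexHull ℝ _ ⟨1, rfl, labelTensor_none⟩
  refine ⟨runGates (averageMoment s ^ k) es (labelTensor fun _ => none), ?_, fun D htr hsq hD => ?_⟩
  · refine convexHull_mono (circuitTensors_mono ?_) (runGates_mem hs hV k es hes' hmem)
    calc es.length * (k * d₀) + 0 ≤ 60 * (M + 2) ^ 2 * (k * d₀) := by
          rw [add_zero]; gcongr
      _ = _ := by rw [hk, hE]; ring
  · have hη : ∀ X Y, ‖(averageMoment s ^ k - P) X Y‖ ≤ (1 / 2) ^ E := by
      intro X Y
      obtain ⟨L, hLk⟩ : ∃ L, k = L + 1 := ⟨k - 1, by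
        have : 0 < k := by positivity
        omega⟩
      refine (hLk ▸ hL L X Y : ‖(averageMoment s ^ k - P) X Y‖ ≤ r ^ k).trans ?_
      rw [hk, pow_mul]
      refine pow_le_pow_left₀ (by positivity) ?_ _
      exact (pow_le_pow_of_le_one hr0 hr1.le (Nat.le_succ c)).trans hc.le
    have hdiff := norm_runGates_sub_le hs hV k hP hη es hes' hmem (ε := 0)
      (N := labelTensor fun _ => none) (by simp)
    have hq := norm_quadForm_le hdiff hD
    have hideal := norm_quadForm_ideal_le htr hsq hD (mulVec_pairTensor h1 h2)
    rw [map_sub] at hq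
    have hsmall : (16 : ℝ) ^ (M + 2) * (512 ^ es.length * (0 + (1 / 2) ^ E) *
        (2 ^ (M + 3)) ^ 2) ≤ (2 ^ (M + 2))⁻¹ := by
      have e1 : (512 : ℝ) ^ es.length ≤ 512 ^ (60 * (M + 2) ^ 2) :=
        pow_le_pow_right₀ (by norm_num) hlen
      have e2 : (16 : ℝ) ^ (M + 2) * (512 ^ (60 * (M + 2) ^ 2) * (2 ^ (M + 3)) ^ 2) *
          2 ^ (M + 2) ≤ 2 ^ E := by
        rw [show (16 : ℝ) = 2 ^ 4 by norm_num, show (512 : ℝ) = 2 ^ 9 by norm_num, ← pow_mul,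
          ← pow_mul, ← pow_mul, ← pow_add, ← pow_add, ← pow_add]
        refine pow_le_pow_right₀ (by norm_num) ?_
        have h3 : (M + 2) * 2 ≤ (M + 2) ^ 2 := by rw [sq]; exact Nat.mul_le_mul_left _ (by omega)
        rw [hE]
        generalize (M + 2) ^ 2 = q at h3 ⊢
        omega
      rw [zero_add, one_div, inv_pow, le_inv_comm₀ (by positivity) (by positivity)]
      rw [show (16 : ℝ) ^ (M + 2) * (512 ^ es.length * (2 ^ E)⁻¹ *
        (2 ^ (M + 3)) ^ 2) = (16 : ℝ) ^ (M + 2) * (512 ^ es.length * (2 ^ (M + 3)) ^ 2) *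
        (2 ^ E)⁻¹ by ring, mul_inv, inv_inv,
        le_inv_mul_iff₀ (by positivity)]
      refine le_trans ?_ e2
      gcongr
    have := norm_sub_norm_le (quadForm D (runGates (averageMoment s ^ k) es
      (labelTensor fun _ => none))) (quadForm D (runGates P es (labelTensor fun _ => none)))
    linarith

end RandomCircuits

/-! ### Far from uniform -/

section Anticoncentration

open Topology

/-- The bias between the outcomes `00` and `01` in the state `V χ`. -/
def bias (V : Op 2) (χ : BitString 2 → ℂ) : ℝ :=
  |‖(V *ᵥ χ) ![false, false]‖ ^ 2 - ‖(V *ᵥ χ) ![false, true]‖ ^ 2|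

lemma bias_smul_left {z : ℂ} (hz : ‖z‖ = 1) (V : Op 2) (χ : BitString 2 → ℂ) :
    bias (z • V) χ = bias V χ := by
  simp [bias, Matrix.smul_mulVec, hz]

lemma bias_smul_right (c : ℝ) (V : Op 2) (χ : BitString 2 → ℂ) :
    bias V ((c : ℂ) • χ) = c ^ 2 * bias V χ := by
  simp only [bias, Matrix.mulVec_smul, Pi.smul_apply, smul_eq_mul, norm_mul, mul_pow,
    Complex.norm_real, Real.norm_eq_abs, sq_abs]
  rw [← mul_sub, abs_mul, abs_of_nonneg (sq_nonneg c)]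

lemma continuous_bias_left (χ : BitString 2 → ℂ) : Continuous fun V : Op 2 => bias V χ := by
  unfold bias
  have h : Continuous fun V : Op 2 => V *ᵥ χ := continuous_id.matrix_mulVec continuous_const
  fun_prop

lemma continuous_bias_right (V : Op 2) : Continuous (bias V) := by
  unfold bias
  have h : Continuous fun χ : BitString 2 → ℂ => V *ᵥ χ :=
    continuous_const.matrix_mulVec continuous_id
  fun_prop

/-- Some unitary sends `χ` to a positive multiple of `00`, where the bias is maximal; a circuit
close to it, up to phase, still has positive bias. -/
lemma GateSet.Universal.exists_bias_pos {G : GateSet} (hG : G.Universal) {χ : BitString 2 → ℂ}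
    (hχ : χ ≠ 0) : ∃ V ∈ circuitMonoid G 2, 0 < bias V χ := by
  obtain ⟨W, hW, r, hr, hWχ⟩ := exists_unitary_mulVec_eq_single ![false, false] χ
  have hr0 : r ≠ 0 := by
    rintro rfl
    apply hχ
    have h := congrArg (fun v => Wᴴ *ᵥ v) hWχ
    simp only [Matrix.mulVec_mulVec, ← Matrix.star_eq_conjTranspose,
      Matrix.mem_unitaryGroup_iff'.1 hW] at h
    simpa using h
  have hpos : 0 < bias W χ := by
    unfold bias
    have hne : ![false, true] ≠ ![false, false] := by decide
    rw [hWχ, Pi.single_eq_same, Pi.single_eq_of_ne hne]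
    have hr2 : 0 < r ^ 2 := by positivity
    simpa using hr2
  obtain ⟨g, hg, hgV⟩ := hG.exists_tendsto hW
  obtain ⟨k, hk⟩ := (((continuous_bias_left χ).tendsto W).comp hg |>.eventually
    (lt_mem_nhds hpos)).exists
  obtain ⟨z, V, hz, hV, hzV⟩ := hgV k
  refine ⟨V, hV, ?_⟩
  rw [Function.comp_apply, hzV, bias_smul_left hz] at hk
  exact hk

/-- Finitely many circuits over a universal gate set bias every state. -/
lemma GateSet.Universal.exists_finset_bias {G : GateSet} (hG : G.Universal) :
    ∃ (F : Finset (Op 2)) (d : ℕ) (κ : ℝ), F.Nonempty ∧ 0 < κ ∧ (∀ V ∈ F, IsCircuit G 2 d V) ∧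
      ∀ χ : BitString 2 → ℂ, κ * ∑ b, ‖χ b‖ ^ 2 ≤ ∑ V ∈ F, bias V χ := by
  classical
  set S : Set (BitString 2 → ℂ) := {χ | ∑ b, ‖χ b‖ ^ 2 = 1} with hS
  have hSc : IsCompact S := by
    refine Metric.isCompact_of_isClosed_isBounded (isClosed_eq (by fun_prop) continuous_const) ?_
    refine (Metric.isBounded_closedBall (x := (0 : BitString 2 → ℂ)) (r := 1)).subset ?_
    intro χ hχ
    rw [mem_closedBall_zero_iff, pi_norm_le_iff_of_nonneg zero_le_one]
    intro b
    have := Finset.single_le_sum (f := fun a => ‖χ a‖ ^ 2) (fun a _ => sq_nonneg _)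
      (Finset.mem_univ b)
    exact (sq_le_one_iff₀ (norm_nonneg _)).1 (this.trans_eq hχ)
  have hSne : S.Nonempty := by
    refine ⟨Pi.single (fun _ => false) 1, ?_⟩
    change ∑ b, _ = _
    rw [Finset.sum_eq_single fun _ => false]
    · simp
    · intro b _ hb; simp [hb]
    · simp
  have hne : ∀ χ ∈ S, χ ≠ 0 := by
    rintro _ h rfl
    simp [hS] at h
  -- No single circuit need bias every state, but compactness of the sphere yields finitely many.
  -- Their total bias is continuous and positive there and so has a positive minimum, which
  -- homogeneity of degree two extends to all vectors.
  obtain ⟨t, ht⟩ := hSc.elim_finite_subcover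
    (fun V : circuitMonoid G 2 => {χ | 0 < bias (V : Op 2) χ})
    (fun V => isOpen_lt continuous_const (continuous_bias_right _)) (fun χ hχ => by
      obtain ⟨V, hV, h⟩ := hG.exists_bias_pos (hne χ hχ)
      exact Set.mem_iUnion.2 ⟨⟨V, hV⟩, h⟩)
  choose dep hdep using fun V : circuitMonoid G 2 => V.2
  have hbias : ∀ V χ, 0 ≤ bias V χ := fun V χ => abs_nonneg _
  have hcov : ∀ χ ∈ S, ∃ V ∈ t, 0 < bias (V : Op 2) χ := by
    intro χ hχ
    simpa using ht hχ
  have hcont : Continuous fun χ => ∑ V ∈ t, bias (V : Op 2) χ :=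
    continuous_finsetSum _ fun V _ => continuous_bias_right _
  obtain ⟨χ₀, hχ₀, hmin⟩ := hSc.exists_isMinOn hSne hcont.continuousOn
  obtain ⟨V₀, hV₀, hV₀'⟩ := hcov χ₀ hχ₀
  refine ⟨t.image Subtype.val, t.sup dep, ∑ V ∈ t, bias (V : Op 2) χ₀,
    ⟨V₀, Finset.mem_image_of_mem _ hV₀⟩,
    Finset.sum_pos' (fun V _ => hbias _ _) ⟨V₀, hV₀, hV₀'⟩, ?_, fun χ => ?_⟩
  · intro V hV
    obtain ⟨V, hVt, rfl⟩ := Finset.mem_image.1 hV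
    exact (hdep V).mono (Finset.le_sup hVt)
  · rw [Finset.sum_image fun _ _ _ _ h => Subtype.val_injective h]
    set ρ := ∑ b, ‖χ b‖ ^ 2 with hρ
    have hρ0 : 0 ≤ ρ := Finset.sum_nonneg fun b _ => sq_nonneg _
    rcases hρ0.eq_or_lt with h0 | h0
    · rw [← h0, mul_zero]
      exact Finset.sum_nonneg fun V _ => hbias _ _
    · have hmem : (((√ρ)⁻¹ : ℝ) : ℂ) • χ ∈ S := by
        change ∑ b, ‖(((√ρ)⁻¹ : ℝ) : ℂ) * χ b‖ ^ 2 = 1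
        simp only [norm_mul, mul_pow, Complex.norm_real, Real.norm_eq_abs, sq_abs]
        rw [← Finset.mul_sum, ← hρ, inv_pow, Real.sq_sqrt hρ0, inv_mul_cancel₀ h0.ne']
      have h1 := hmin hmem
      simp only [Set.mem_ofPred_eq, bias_smul_right] at h1
      rw [← Finset.mul_sum, inv_pow, Real.sq_sqrt hρ0, le_inv_mul_iff₀ h0] at h1
      rwa [mul_comm]

/-- Exchanging the bits of `x` at the two sites with `y` is an involution on pairs, so every string
is counted four times. -/
lemma sum_sum_extend {n : ℕ} {e : Fin 2 → Fin n} (he : Function.Injective e)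
    (f : BitString n → ℝ) : ∑ x, ∑ y : BitString 2, f (Function.extend e y x) = 4 * ∑ x, f x := by
  have hinv : Function.Involutive fun p : BitString n × BitString 2 =>
      (Function.extend e p.2 p.1, p.1 ∘ e) := by
    rintro ⟨x, y⟩
    simp only [extend_comp_self he, extend_extend he]
    rw [extend_eq_of_agree he fun _ _ => rfl]
  rw [← Fintype.sum_prod_type', hinv.bijective.sum_comp (fun p : BitString n × BitString 2 => f p.1),
    Fintype.sum_prod_type]
  simp only [Finset.sum_const, Finset.card_univ, card_bitString, nsmul_eq_mul]
  rw [Finset.mul_sum]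
  norm_num

/-- Conditioned on the other qubits, the last gate acts on a two-qubit vector `χ x`. The uniform
distribution has no bias between `00` and `01`, so each bias bounds a part of the distance from
below. -/
lemma sum_tv_uniformDist_ge {n : ℕ} {e : Fin 2 → Fin n} (he : Function.Injective e)
    {F : Finset (Op 2)} {κ : ℝ} (hF : ∀ V ∈ F, V ∈ Matrix.unitaryGroup (BitString 2) ℂ)
    (hκ : ∀ χ : BitString 2 → ℂ, κ * ∑ b, ‖χ b‖ ^ 2 ≤ ∑ V ∈ F, bias V χ) {U : Op n}
    (hU : U ∈ Matrix.unitaryGroup (BitString n) ℂ) :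
    κ / 2 ≤ ∑ V : F, tv (bornDist (embedOp e (V : Op 2) * U)
      (mul_mem (embedOp_mem_unitary he (hF V V.2)) hU)) (uniformDist n) := by
  set P : F → ProbDist n := fun V => bornDist (embedOp e (V : Op 2) * U)
      (mul_mem (embedOp_mem_unitary he (hF V V.2)) hU) with hP
  set χ : BitString n → BitString 2 → ℂ := fun x y => U (Function.extend e y x) fun _ => false
    with hχ
  have hPχ : ∀ (V : F) x y, (P V).1 (Function.extend e y x) = ‖((V : Op 2) *ᵥ χ x) y‖ ^ 2 := by
    intro V x y
    change ‖(embedOp e (V : Op 2) *ᵥ fun z => U z fun _ => false) (Function.extend e y x)‖ ^ 2 = _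
    rw [embedOp_mulVec he, extend_comp_self he]
    simp only [extend_extend he]
    rfl
  have hsum : ∑ x, ∑ y, ‖χ x y‖ ^ 2 = 4 := by
    rw [hχ, sum_sum_extend he fun x => ‖U x fun _ => false‖ ^ 2, sum_norm_sq_col hU, mul_one]
  have hbias : ∀ V : F, ∑ x, bias (V : Op 2) (χ x) ≤ 8 * tv (P V) (uniformDist n) := by
    intro V
    have h8 : 8 * tv (P V) (uniformDist n) = ∑ x, ∑ y : BitString 2,
        |(P V).1 (Function.extend e y x) - (2 ^ n : ℝ)⁻¹| := by
      rw [sum_sum_extend he fun x => |(P V).1 x - (2 ^ n : ℝ)⁻¹|]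
      unfold tv uniformDist
      ring
    rw [h8]
    refine Finset.sum_le_sum fun x _ => ?_
    have hne : ![false, false] ≠ ![false, true] := by decide
    have hpair := Finset.sum_le_sum_of_subset_of_nonneg
      (f := fun y => |(P V).1 (Function.extend e y x) - (2 ^ n : ℝ)⁻¹|)
      (Finset.subset_univ {![false, false], ![false, true]}) fun _ _ _ => abs_nonneg _
    rw [Finset.sum_pair hne] at hpair
    refine le_trans ?_ hpair
    rw [bias, ← hPχ, ← hPχ, abs_sub_comm ((P V).1 (Function.extend e ![false, true] x))]
    exact abs_sub_le _ _ _
  have h1 : κ * 4 ≤ ∑ V : F, ∑ x, bias (V : Op 2) (χ x) := by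
    rw [Finset.sum_comm, ← hsum, Finset.mul_sum]
    refine Finset.sum_le_sum fun x _ => (hκ (χ x)).trans_eq ?_
    exact (Finset.sum_coe_sort F fun V => bias V (χ x)).symm
  have h2 := Finset.sum_le_sum fun (V : F) (_ : V ∈ Finset.univ) => hbias V
  rw [← Finset.mul_sum] at h2
  linarith

end Anticoncentration

/-! ### Observables -/

section Observables

variable {n : ℕ}

lemma trace_conj_diagonal {W : Op n} (hW : W ∈ Matrix.unitaryGroup (BitString n) ℂ)
    (f : BitString n → ℂ) : (Wᴴ * Matrix.diagonal f * W).trace = ∑ x, f x := by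
  rw [Matrix.trace_mul_cycle, ← Matrix.star_eq_conjTranspose, Matrix.mem_unitaryGroup_iff.1 hW,
    one_mul, Matrix.trace_diagonal]

/-- The deviation of an expectation from its value for the uniform distribution is the expectation of
a traceless observable. -/
lemma exists_observable {W : Op n} (hW : W ∈ Matrix.unitaryGroup (BitString n) ℂ)
    {φ : BitString n → ℝ} (hφ : ∀ x, |φ x| ≤ 1) :
    ∃ D : Op n, D.trace = 0 ∧ ‖(D * D).trace‖ ≤ 2 ^ n ∧ (∀ x y, ‖D x y‖ ≤ 2 ^ (n + 1)) ∧
      ∀ U (hU : U ∈ Matrix.unitaryGroup (BitString n) ℂ),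
        quadForm D (vecMoment fun x => U x fun _ => false) =
          ((expect (bornDist (W * U) (mul_mem hW hU)) φ - expect (uniformDist n) φ) ^ 2 : ℝ) := by
  set c := expect (uniformDist n) φ with hc
  have hc' : c * 2 ^ n = ∑ x, φ x := by
    rw [hc, expect]
    simp only [uniformDist]
    rw [← Finset.mul_sum, mul_comm, mul_inv_cancel_left₀ (by positivity)]
  have hcard : ∑ _x : BitString n, (1 : ℝ) = 2 ^ n := by simp
  have hmean : ∑ x, (φ x - c) = 0 := by
    rw [Finset.sum_sub_distrib, ← hc']
    simp [mul_comm]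
  have hsq : ∑ x, (φ x - c) ^ 2 ≤ 2 ^ n := by
    have h1 : ∑ x, (φ x - c) ^ 2 = ∑ x, φ x ^ 2 - c * ∑ x, (φ x - c) - c * ∑ x, φ x := by
      rw [Finset.mul_sum, Finset.mul_sum, ← Finset.sum_sub_distrib, ← Finset.sum_sub_distrib]
      exact Finset.sum_congr rfl fun x _ => by ring
    have h2 : ∑ x, φ x ^ 2 ≤ ∑ _x : BitString n, (1 : ℝ) :=
      Finset.sum_le_sum fun x _ => (sq_le_one_iff_abs_le_one _).2 (hφ x)
    rw [h1, hmean, ← hc']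
    have : 0 ≤ c * (c * 2 ^ n) := by
      rw [← mul_assoc]; exact mul_nonneg (mul_self_nonneg c) (by positivity)
    linarith
  have hcabs : |c| ≤ 1 := by
    have h1 : |c * 2 ^ n| ≤ 2 ^ n := by
      rw [hc', ← hcard]
      exact (Finset.abs_sum_le_sum_abs _ _).trans (Finset.sum_le_sum fun x _ => hφ x)
    rw [abs_mul, abs_of_pos (by positivity : (0 : ℝ) < 2 ^ n)] at h1
    exact (mul_le_iff_le_one_left (by positivity)).1 h1
  set f : BitString n → ℂ := fun x => ((φ x - c : ℝ) : ℂ) with hf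
  have hfn : ∀ x, ‖f x‖ ≤ 2 := by
    intro x
    rw [hf, Complex.norm_real, Real.norm_eq_abs]
    exact (abs_sub _ _).trans (by linarith [hφ x])
  -- The centred test in the Heisenberg picture: the final unitary `W` is absorbed into the
  -- observable. Centring at the uniform mean makes it traceless.
  refine ⟨Wᴴ * Matrix.diagonal f * W, ?_, ?_, fun x y => ?_, fun U hU => ?_⟩
  · rw [trace_conj_diagonal hW, hf, ← Complex.ofReal_sum, hmean, Complex.ofReal_zero]
  · have h : Wᴴ * Matrix.diagonal f * W * (Wᴴ * Matrix.diagonal f * W) =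
        Wᴴ * Matrix.diagonal (fun x => f x * f x) * W := by
      rw [← Matrix.diagonal_mul_diagonal]
      have hW' := Matrix.mem_unitaryGroup_iff.1 hW
      rw [Matrix.star_eq_conjTranspose] at hW'
      calc _ = Wᴴ * Matrix.diagonal f * (W * Wᴴ) * Matrix.diagonal f * W := by
            simp only [Matrix.mul_assoc]
        _ = _ := by rw [hW', Matrix.mul_one]; simp only [Matrix.mul_assoc]
    rw [h, trace_conj_diagonal hW]
    have h2 : ∑ x, f x * f x = ((∑ x, (φ x - c) ^ 2 : ℝ) : ℂ) := by
      push_cast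
      exact Finset.sum_congr rfl fun x _ => by rw [hf]; push_cast; ring
    rw [h2, Complex.norm_real, Real.norm_of_nonneg (Finset.sum_nonneg fun x _ => sq_nonneg _)]
    exact hsq
  · have hent : ∀ a b, ‖W a b‖ ≤ 1 := fun a b => entry_norm_bound_of_unitary hW a b
    rw [Matrix.mul_apply]
    refine (norm_sum_le _ _).trans ?_
    calc _ ≤ ∑ _z : BitString n, (2 : ℝ) := by
          refine Finset.sum_le_sum fun z _ => ?_
          rw [Matrix.mul_diagonal, Matrix.conjTranspose_apply, norm_mul, norm_mul, norm_star]
          have h1 := mul_le_mul (hent z x) (hfn z) (norm_nonneg _) zero_le_one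
          have h2 := mul_le_mul h1 (hent z y) (norm_nonneg _) (by norm_num)
          linarith
      _ = 2 ^ (n + 1) := by simp [pow_succ]
  · set ψ : BitString n → ℂ := fun x => U x fun _ => false with hψ
    rw [quadForm_vecMoment, Complex.ofReal_pow]
    congr 1
    have h1 : star ψ ⬝ᵥ (Wᴴ * Matrix.diagonal f * W) *ᵥ ψ =
        star (W *ᵥ ψ) ⬝ᵥ Matrix.diagonal f *ᵥ (W *ᵥ ψ) := by
      rw [Matrix.star_mulVec, ← Matrix.dotProduct_mulVec, Matrix.mulVec_mulVec,
        Matrix.mulVec_mulVec]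
    have h2 : ∀ x, (bornDist (W * U) (mul_mem hW hU)).1 x = ‖(W *ᵥ ψ) x‖ ^ 2 := fun x => rfl
    have h3 : expect (bornDist (W * U) (mul_mem hW hU)) φ - c =
        ∑ x, (bornDist (W * U) (mul_mem hW hU)).1 x * (φ x - c) := by
      simp only [mul_sub, Finset.sum_sub_distrib, ← Finset.sum_mul]
      rw [(bornDist (W * U) (mul_mem hW hU)).2.2, one_mul]
      rfl
    rw [h1, h3, Complex.ofReal_sum]
    refine Finset.sum_congr rfl fun x _ => ?_
    rw [Matrix.mulVec_diagonal, h2, Pi.star_apply, hf, Complex.ofReal_mul, Complex.ofReal_pow,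
      ← Complex.conj_mul', Complex.star_def]
    ring

end Observables

/-! ### Universal gate sets -/

section UniversalFamily

/-- Over a universal gate set, circuits of polynomial depth generate hard families. -/
lemma GateSet.Universal.exists_hardFamily {G : GateSet} (hG : G.Universal) :
    ∃ (C B : ℕ) (t : ℝ), 0 < t ∧ ∀ M : ℕ,
      HardFamily (outputDistributions G (M + 2) (B + C * (M + 2) ^ 4))
        (6 * (2 ^ (M + 2))⁻¹) t := by
  obtain ⟨F, B, κ, hF, hκ, hFc, hbias⟩ := hG.exists_finset_bias
  obtain ⟨C, hC⟩ := hG.exists_random_circuit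
  have hcard : (0 : ℝ) < F.card := by exact_mod_cast hF.card_pos
  refine ⟨C, B, κ / 2 / F.card, by positivity, fun M => ?_⟩
  obtain ⟨T, hT, hTD⟩ := hC M
  obtain ⟨ι, hι, w, z, hw, hw1, hz, rfl⟩ := mem_convexHull_iff_exists_fintype.1 hT
  choose U hU hzU using hz
  set e : Fin 2 → Fin (M + 2) := shiftFin 0 (by omega) with he
  have hinj : Function.Injective e := shiftFin_injective 0 _
  have hFu : ∀ V ∈ F, embedOp e V ∈ Matrix.unitaryGroup (BitString (M + 2)) ℂ := fun V hV =>
    embedOp_mem_unitary hinj (hFc V hV).mem_unitary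
  have hconst : ∀ c : ℝ, ∑ _V : F, (F.card : ℝ)⁻¹ * c = c := by
    intro c
    rw [Finset.sum_const, Finset.card_univ, Fintype.card_coe, nsmul_eq_mul,
      mul_inv_cancel_left₀ hcard.ne']
  -- A member is a random circuit followed by an independent, uniformly chosen biasing gate on the
  -- first two qubits.
  refine ⟨F × ι, inferInstance, fun p => (F.card : ℝ)⁻¹ * w p.2,
    fun p => bornDist (embedOp e p.1 * U p.2)
      (mul_mem (hFu _ p.1.2) (hU p.2).mem_unitary), uniformDist (M + 2),
    fun p => mul_nonneg (by positivity) (hw _), ?_, fun p => ?_, fun φ hφ => ?_, ?_⟩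
  · rw [Fintype.sum_prod_type]
    simp only [← Finset.mul_sum, hw1]
    rw [Finset.mul_sum]
    exact hconst 1
  · have h := ((hFc _ p.1.2).shift 0 (by omega : 0 + 2 ≤ M + 2)).mul (hU p.2)
    exact bornDist_mem h
  · rw [Fintype.sum_prod_type, ← hconst (6 * (2 ^ (M + 2))⁻¹)]
    refine Finset.sum_le_sum fun V _ => ?_
    simp only [mul_assoc]
    rw [← Finset.mul_sum]
    refine mul_le_mul_of_nonneg_left ?_ (by positivity)
    -- The second moment bound holds for all admissible observables, so it applies for each fixed
    -- final gate and survives averaging over them.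
    obtain ⟨D, h1, h2, h3, h4⟩ := exists_observable (hFu V V.2) hφ
    have h5 := hTD D h1 h2 h3
    rw [map_sum] at h5
    have h6 : ∀ i, quadForm D (w i • z i) =
        ((w i * (expect (bornDist (embedOp e V * U i)
          (mul_mem (hFu _ V.2) (hU i).mem_unitary)) φ - expect (uniformDist (M + 2)) φ) ^ 2 : ℝ) :
            ℂ) := by
      intro i
      rw [← Complex.coe_smul, map_smul, hzU, h4 _ (hU i).mem_unitary, smul_eq_mul,
        Complex.ofReal_mul]
    simp only [h6] at h5
    rw [← Complex.ofReal_sum, Complex.norm_real] at h5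
    exact (le_abs_self _).trans h5
  · rw [Fintype.sum_prod_type, Finset.sum_comm]
    simp only [mul_assoc]
    simp only [← Finset.mul_sum]
    rw [div_eq_inv_mul]
    refine mul_le_mul_of_nonneg_left ?_ (by positivity)
    calc κ / 2 = ∑ i, w i * (κ / 2) := by rw [← Finset.sum_mul, hw1, one_mul]
      _ ≤ _ := Finset.sum_le_sum fun i _ => mul_le_mul_of_nonneg_left
          (sum_tv_uniformDist_ge hinj (fun V hV => (hFc V hV).mem_unitary) hbias
            (hU i).mem_unitary) (hw i)

/-- The number of qubits is a multiple of `log n`, and the fourth power of the logarithm comes from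
the depth `B + C * (M + 2) ^ 4` of the random circuits. -/
theorem GateSet.Universal.sqHard {G : GateSet} (hG : G.Universal) {d : ℕ → ℕ}
    (hd : (fun n : ℕ => Real.log n ^ 4) =o[atTop] (fun n : ℕ => (d n : ℝ))) :
    SQHard (fun n => outputDistributions G n (d n)) := by
  obtain ⟨C, B, t, ht, H⟩ := hG.exists_hardFamily
  refine sqHard_of_hardFamily ht fun A => ?_
  filter_upwards [eventually_log_pow_le hd (2 * A + 3) B C,
    eventually_mul_log_le (2 * A + 1), eventually_ge_atTop 4] with n h1 h2 h3
  have hlog : 1 ≤ Nat.log 2 n := Nat.log_pos (by norm_num) (by omega)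
  -- This gives `2 * A * Nat.log 2 n + 3` qubits; the three extra ones contribute `2 ^ (-3)`, which
  -- absorbs the constant `6`.
  refine ((H (2 * A * Nat.log 2 n + 1)).pad (n := n) ?_).mono (outputDistributions_mono ?_) ?_
  · nlinarith
  · refine le_trans ?_ h1
    rw [add_comm B]
    gcongr
    nlinarith
  · refine le_trans ?_ (inv_two_pow_log_le h3 A)
    rw [show 2 * A * Nat.log 2 n + 1 + 2 = 2 * A * Nat.log 2 n + 3 by ring, pow_add, mul_inv]
    have : (0 : ℝ) < (2 ^ (2 * A * Nat.log 2 n))⁻¹ := by positivity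
    linarith

end UniversalFamily

end CircuitLearning

end

theorem theorem4 :
    (∀ d : ℕ → ℕ, (fun n : ℕ => Real.log n) =o[atTop] (fun n : ℕ => (d n : ℝ)) →
      SQHard (fun n => outputDistributions cliffordGates n (d n))) ∧
    (∀ G : GateSet, G.Universal →
      ∃ k : ℕ, ∀ d : ℕ → ℕ,
        (fun n : ℕ => Real.log n ^ k) =o[atTop] (fun n : ℕ => (d n : ℝ)) →
          SQHard (fun n => outputDistributions G n (d n))) ∧
    (∃ G : GateSet, G.one.Finite ∧ G.two.Finite ∧ G.Universal ∧
      ∀ d : ℕ → ℕ,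
        (fun n : ℕ => Real.log n ^ 2) =o[atTop] (fun n : ℕ => (d n : ℝ)) →
          SQHard (fun n => outputDistributions G n (d n))) :=
  ⟨fun _ hd => sqHard_cliffordGates hd,
    fun _ hG => ⟨4, fun _ hd => hG.sqHard hd⟩,
    finiteGates, Set.finite_empty, finiteGates_two_finite, finiteGates_universal,
    fun _ hd => sqHard_finiteGates hd⟩
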